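/- **Setting.** Let $p\ge q\ge 0$ be integers with $d:=p+q>2$, let $\eta=\mathrm{diag}(1,\dots,1,-1,\dots,-1)$ with $p+1$ entries $1$ and $q+1$ entries $-1$ (indices $0,\dots,d+1$), and let $G=SO(p+1,q+1)_0$ be the identity component of $SO(\eta)$, with Lie algebra $\mathfrak g$. Put $F_{\mu\nu}=E_{\mu\nu}-E_{\nu\mu}$ with $(E_{\mu\nu})^\sigma{}_\rho=\delta^\sigma_\mu\eta_{\nu\rho}$, $B(X,Y)=\mathrm{tr}(XY)$, and let $\Omega_{\mathfrak g}=\sum_{\mu<\nu}F_{\mu\nu}F_{\mu\nu}^\vee$, where $(F_{\mu\nu}^\vee)$ is the $B$-dual basis, be the quadratic Casimir element. Let $D_0=-F_{0,d+1}$, let $M$ be the group of those $g\in G$ that act on $\mathrm{span}(e_0,e_{d+1})$ as $+1$ or as $-1$, and let $H=M\exp(\mathbb R D_0)$. With $\iota(0)=[e_0+e_{d+1}]$ and $\infty=[e_0-e_{d+1}]$, let $\tilde G\subseteq G$ be the set of those $x$ for which representatives of the four points $\iota(0),\infty,x\,\iota(0),x\,\infty$ are linearly independent and pairwise non-orthogonal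 with respect to $\eta$. Let $\alpha,\beta\in\mathbb C$, and let $W=\mathbb C$ be the $H$-bimodule on which $M$ acts trivially and $D_0$ acts by $\alpha$ on the left and by $\beta$ on the right. Let $E^W(\tilde G,H)$ be the space of smooth $f:\tilde G\to\mathbb C$ with $$f(m e^{sD_0}\,g\,m'e^{s'D_0})=e^{\alpha s}f(g)e^{\beta s'}\qquad(g\in\tilde G,\ m,m'\in M,\ s,s'\in\mathbb R).$$ For $X\in\mathfrak g$ put $(X\cdot f)(g)=\frac{d}{dt}\big|_{0}f(ge^{tX})$ and $(f\cdot X)(g)=\frac{d}{dt}\big|_{0}f(e^{tX}g)$; these extend to actions of $U(\mathfrak g)$. **Cartan subsets.** $C_I=\exp(\mathfrak c_I)\,t_I$ with $\mathfrak c_I=\mathbb RX_0\oplus\mathbb RX_1$, where, with $t_{\phi,\psi}=\exp(\phi F_{0,1}+\psi F_{d,d+1})$: * for $q=0$ (Euclidean case) the only Cartan subset, here labelled $\mathrm{E}$: $X_0=F_{0,1}$, $X_1=F_{d,d+1}$, $t=1$; * for $q\ge1$ (including the Lorentzian case $q=1$): $I=\emptyset$: $F_{0,1},\,F_{d,d+1}$,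 $t=1$; $I=\{0\}$ and $I=\{2\}$: $F_{0,1}+F_{d,d+1},\ F_{0,d}-F_{1,d+1}$, with $t=1$ and $t=t_{0,\pi}$; $I=\{1\}$: $F_{0,1},\,F_{2,d+1}$, $t=1$; $I=\{0,1\},\{0,2\},\{1,2\}$: $F_{0,d},\,F_{1,d+1}$, with $t=1$, $t_{\pi/2,\pi/2}$, $t_{0,\pi}$; and, only if $q\ge2$, $I=\{1\}'$: $F_{d,d+1},\,F_{0,d-1}$, $t=1$. Linear functionals $\epsilon_1,\epsilon_2$ on $\mathfrak c_I$ are given by $(\epsilon_i(X_0),\epsilon_i(X_1))_{i=1,2}$ equal to $(i,1),(i,-1)$ for $I=\mathrm E,\{1\},\{1\}'$; $(i,i),(i,-i)$ for $\emptyset$; $(2i,0),(0,2)$ for $\{0\}$; $(0,2),(2i,0)$ for $\{2\}$; and $(1,1),(1,-1)$ for $\{0,1\},\{0,2\},\{1,2\}$. Let $B^*$ be the bilinear form on the complex span of $\epsilon_1,\epsilon_2$ for which they are orthonormal, and $\|\gamma\|^2=B^*(\gamma,\gamma)$. The parameter regions $Y_I\subset\mathbb C^2\ni(\chi_1,\chi_2)$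 and the parametrisations $x_I:Y_I\to C_I$, $x_I(\chi)=\exp(c_0X_0+c_1X_1)t_I$, are: * $\mathrm E,\{1\},\{1\}'$: $\chi_1=-a+i\theta$, $\chi_2=a+i\theta$ with $a>0$, $0<\theta<\pi$; $c_0=\frac{\chi_1+\chi_2-2\pi i}{2i}$, $c_1=\frac{\chi_1-\chi_2}{2}$; * $\emptyset$: $\chi_j=i\theta_j$, $0<\theta_1<\theta_2<\pi$; $c_0=\frac{\chi_1+\chi_2-2\pi i}{2i}$, $c_1=\frac{\chi_1-\chi_2}{2i}$; * $\{0\}$: $\chi_1\in i(0,\pi)$, $\chi_2\in\mathbb R_{>0}+i\pi$; $c_0=\frac{\chi_1-i\pi}{2i}$, $c_1=\frac{\chi_2-i\pi}{2}$; * $\{2\}$: $\chi_1\in\mathbb R_{>0}$, $\chi_2\in i(0,\pi)$; $c_0=\frac{\chi_2}{2i}$, $c_1=\frac{\chi_1}{2}$; * $\{0,1\}$: $\chi_j=a_j+i\pi$, $0<a_1<a_2$; $\{0,2\}$: $\chi_1=a_1$, $\chi_2=a_2+i\pi$, $a_1,a_2>0$; $\{1,2\}$: $\chi_j=a_j$,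 $0<a_1<a_2$; in these three cases $c_0=\frac{a_1+a_2}{2}$, $c_1=\frac{a_1-a_2}{2}$. Put $\Psi_I(f)=f\circ x_I$. Each $Y_I$ is an open subset of a real affine plane whose directions are spanned by $v_j=(\epsilon_1(X_j),\epsilon_2(X_j))$, $j=0,1$, which are a $\mathbb C$-basis of $\mathbb C^2$; $\partial_{\chi_1},\partial_{\chi_2}$ denote the complex combinations of directional derivatives on $Y_I$ with $\partial_{v_j}=\epsilon_1(X_j)\partial_{\chi_1}+\epsilon_2(X_j)\partial_{\chi_2}$. For $\gamma=\gamma_1\epsilon_1+\gamma_2\epsilon_2$ and $c\in\mathbb C$, $e^{c\gamma}$ is the function $\exp(c(\gamma_1\chi_1+\gamma_2\chi_2))$, and $\partial_\gamma=\gamma_1\partial_{\chi_1}+\gamma_2\partial_{\chi_2}$. **Root data.** Let $R=\{\pm\epsilon_i,\ \pm\epsilon_1\pm\epsilon_2,\ \pm2\epsilon_i\}$, of type $BC_2$, with $R^+=\{\epsilon_1,\epsilon_2,\epsilon_1\pm\epsilon_2,2\epsilon_1,2\epsilon_2\}$. Define Weyl-invariant functions on $R$: | | $\pm\epsilon_i$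 | $\pm\epsilon_1\pm\epsilon_2$ | $\pm2\epsilon_i$ | |---|---|---|---| | $k$ | $0$ | $\frac{d-2}{2}$ | $\frac12$ | | $m$ | $\alpha$ | $\frac{d-2}{2}$ | $\frac{1-\alpha+\beta}{2}$ | | $l^2$ | $-\alpha\beta$ | $0$ | $-\left(\frac{\alpha-\beta}{2}\right)^2$ | For a Weyl-invariant $\kappa:R\to\mathbb C$ put $\rho(\kappa)=\frac12\sum_{\gamma\in R^+}\kappa_\gamma\gamma$ and $$L(\kappa)=\partial_{\chi_1}^2+\partial_{\chi_2}^2+\sum_{\gamma\in R^+}\kappa_\gamma\frac{1+e^{-\gamma}}{1-e^{-\gamma}}\,\partial_\gamma .$$ ($L(k)$ is the Heckman–Opdam Laplacian of type $C_2$.) Put $\delta=\prod_{\gamma\in R^+}(e^{\gamma/2}-e^{-\gamma/2})^{(m-k)_\gamma}$ on $Y_I$, with principal powers. **Theorem.** For every $I$ as above: 1. $x_I(Y_I)\subseteq\tilde G$. 2. Let $\Sigma(\mathfrak g:\mathfrak c_I)$ be the set of nonzero functionals $\gamma$ on $\mathfrak c_{I,\mathbb C}$ with $\mathfrak g_\gamma=\{X\in\mathfrak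 g_{\mathbb C}:[Z,X]=\gamma(Z)X\ \forall Z\in\mathfrak c_I\}\neq0$. Then $2\Sigma(\mathfrak g:\mathfrak c_I)$ is the set of those roots $\gamma\in R$ with $2\gamma\notin R$, and $k_{2\gamma}=\frac12\dim_{\mathbb C}\mathfrak g_\gamma$ for $\gamma\in\Sigma(\mathfrak g:\mathfrak c_I)$. 3. For every $f\in E^W(\tilde G,H)$ the function $\Psi_I(f)$ is smooth on $Y_I$, and on $Y_I$ $$\Psi_I(\Omega_{\mathfrak g}\cdot f)=\Psi_I(f\cdot\Omega_{\mathfrak g})=\Big(L(k)+\sum_{\gamma\in R^+}\frac{l_\gamma^2\,B^*(\gamma,\gamma)}{(e^{\gamma/2}-e^{-\gamma/2})^2}\Big)\Psi_I(f)=\delta\Big(L(m)+\frac{\beta(\beta+d)}{2}\Big)\delta^{-1}\,\Psi_I(f).$$ 4. As operators on smooth functions on $Y_I$, $$L(k)+\sum_{\gamma\in R^+}\frac{l_\gamma^2\,B^*(\gamma,\gamma)}{(e^{\gamma/2}-e^{-\gamma/2})^2}=\delta\big(L(m)+\|\rho(m)\|^2-\|\rho(k)\|^2\big)\delta^{-1},$$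 and $$\|\rho(k)\|^2=\frac{d^2-2d+2}{4},\qquad \|\rho(m)\|^2=\frac{(d+\beta-1)^2+(\beta+1)^2}{4}.$$ 5. There is a constant $c\neq0$ with, on $Y_I$ (principal powers), $$\delta=c\,\cosh^{\frac{-\alpha+\beta}{2}}\!\big(\tfrac{\chi_1}{2}\big)\cosh^{\frac{-\alpha+\beta}{2}}\!\big(\tfrac{\chi_2}{2}\big)\sinh^{\frac{\alpha+\beta}{2}}\!\big(\tfrac{\chi_1}{2}\big)\sinh^{\frac{\alpha+\beta}{2}}\!\big(\tfrac{\chi_2}{2}\big).$$ -/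

import Mathlib

open scoped Matrix ContDiff

noncomputable section

namespace ConformalCasimir

/-! ### The group `SO(p+1,q+1)₀`, its generators, and the Casimir element -/

/-- Diagonal entries of the form of signature `(p+1,q+1)`; the indices are `0, …, d+1`, `d = p+q`. -/
def eta (p n : ℕ) : ℝ := if n ≤ p then 1 else -1

/-- The Gram matrix `η` of signature `(p+1,q+1)` on `ℝ^{d+2}`. -/
def metric (p q : ℕ) : Matrix (Fin (p + q + 2)) (Fin (p + q + 2)) ℝ :=
  Matrix.diagonal fun i => eta p i

/-- `F_{μν} = E_{μν} - E_{νμ}` with `(E_{μν})^σ_ρ = δ^σ_μ η_{νρ}`. -/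
def genF (p q μ ν : ℕ) : Matrix (Fin (p + q + 2)) (Fin (p + q + 2)) ℝ :=
  Matrix.of fun i j =>
    (if (i : ℕ) = μ ∧ (j : ℕ) = ν then eta p ν else 0)
      - (if (i : ℕ) = ν ∧ (j : ℕ) = μ then eta p μ else 0)

/-- The element of the basis dual to `(F_{μν})_{μ<ν}` with respect to `B(X,Y) = tr(XY)`. -/
def genFDual (p q μ ν : ℕ) : Matrix (Fin (p + q + 2)) (Fin (p + q + 2)) ℝ :=
  (-(1 / 2) * eta p μ * eta p ν) • genF p q μ ν

/-- `(F_{μν}^∨)` and `(F_{μν})` are dual for the trace form. -/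
theorem trace_genFDual_mul_genF (p q : ℕ) {μ ν ρ σ : ℕ} (h₁ : μ < ν) (h₂ : ν < p + q + 2)
    (h₃ : ρ < σ) (h₄ : σ < p + q + 2) :
    (genFDual p q μ ν * genF p q ρ σ).trace = if μ = ρ ∧ ν = σ then 1 else 0 := by
  have key : ∀ i j : Fin (p + q + 2), genF p q μ ν i j * genF p q ρ σ j i
      = (if i = (⟨μ, by omega⟩ : Fin (p + q + 2)) then
          (if j = (⟨ν, by omega⟩ : Fin (p + q + 2)) then
            -(if μ = ρ ∧ ν = σ then eta p μ * eta p ν else 0) else 0) else 0)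
        + (if i = (⟨ν, by omega⟩ : Fin (p + q + 2)) then
          (if j = (⟨μ, by omega⟩ : Fin (p + q + 2)) then
            -(if μ = ρ ∧ ν = σ then eta p μ * eta p ν else 0) else 0) else 0) := by
    rintro ⟨i, hi⟩ ⟨j, hj⟩
    simp only [genF, Matrix.of_apply, Fin.mk.injEq]
    split_ifs <;> first | omega | (simp_all; done) | (subst_vars; ring1) | (simp_all; ring1)
  have hη : ∀ n, eta p n * eta p n = 1 := by
    intro n; unfold eta; split_ifs <;> norm_num
  rw [genFDual, Matrix.smul_mul, Matrix.trace_smul, smul_eq_mul]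
  have h : (genF p q μ ν * genF p q ρ σ).trace
      = -(2 * if μ = ρ ∧ ν = σ then eta p μ * eta p ν else 0) := by
    simp only [Matrix.trace, Matrix.diag_apply, Matrix.mul_apply, key, Finset.sum_add_distrib,
      Finset.sum_ite_irrel, Finset.sum_const_zero, Finset.sum_ite_eq', Finset.mem_univ, if_true]
    ring
  rw [h]
  split_ifs
  · linear_combination (eta p μ * eta p μ) * hη ν + hη μ
  · simp

/-- The group `SO(p+1,q+1)`. -/
def specialOrthogonal (p q : ℕ) : Set (Matrix (Fin (p + q + 2)) (Fin (p + q + 2)) ℝ) :=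
  {g | gᵀ * metric p q * g = metric p q ∧ g.det = 1}

/-- `G = SO(p+1,q+1)₀`, the identity component. -/
def groupG (p q : ℕ) : Set (Matrix (Fin (p + q + 2)) (Fin (p + q + 2)) ℝ) :=
  connectedComponentIn (specialOrthogonal p q) 1

/-- The generator `D_0 = F^{0,d+1} = -F_{0,d+1}` of dilations; `𝔞 = ℝ D_0`. -/
def dilation (p q : ℕ) : Matrix (Fin (p + q + 2)) (Fin (p + q + 2)) ℝ :=
  -genF p q 0 (p + q + 1)

/-- The `j`-th standard basis vector of `ℝ^{d+2}`. -/
def stdVec (p q j : ℕ) : Fin (p + q + 2) → ℝ := fun i => if (i : ℕ) = j then 1 else 0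

/-- The group `M`. The centraliser of `𝔞` in `G` is `M × exp(ℝ D_0)`, where `M` consists of the
elements of `G` that act on the plane spanned by `e_0, e_{d+1}` as `1` or as `-1`. -/
def groupM (p q : ℕ) : Set (Matrix (Fin (p + q + 2)) (Fin (p + q + 2)) ℝ) :=
  {g | g ∈ groupG p q ∧ ∃ ε : ℝ, (ε = 1 ∨ ε = -1) ∧
    g *ᵥ stdVec p q 0 = ε • stdVec p q 0 ∧
    g *ᵥ stdVec p q (p + q + 1) = ε • stdVec p q (p + q + 1)}

/-- The form `η` on `ℝ^{d+2}`. -/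
def form (p q : ℕ) (v w : Fin (p + q + 2) → ℝ) : ℝ := v ⬝ᵥ (metric p q *ᵥ w)

/-- Null vectors representing the four points `(ι(0), ∞, x ι(0), x ∞)`, where
`ι(0) = (1:0:1)` and `∞ = (1:0:-1)`. -/
def fourPoints (p q : ℕ) (x : Matrix (Fin (p + q + 2)) (Fin (p + q + 2)) ℝ) :
    Fin 4 → (Fin (p + q + 2) → ℝ) :=
  ![stdVec p q 0 + stdVec p q (p + q + 1),
    stdVec p q 0 - stdVec p q (p + q + 1),
    x *ᵥ (stdVec p q 0 + stdVec p q (p + q + 1)),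
    x *ᵥ (stdVec p q 0 - stdVec p q (p + q + 1))]

/-- The open dense set `G̃ ⊆ G` of those `x` for which `(ι(0), ∞, x ι(0), x ∞)` is in general
position: linearly independent and pairwise non-orthogonal. -/
def tildeG (p q : ℕ) : Set (Matrix (Fin (p + q + 2)) (Fin (p + q + 2)) ℝ) :=
  {x | x ∈ groupG p q ∧ LinearIndependent ℝ (fourPoints p q x) ∧
    ∀ i j, i ≠ j → form p q (fourPoints p q x i) (fourPoints p q x j) ≠ 0}

section Smooth

attribute [local instance] Matrix.linftyOpNormedRing Matrix.linftyOpNormedAlgebra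

/-- The space `E^W(G̃, H)`, `H = M exp(ℝ D_0)`, for the scalar bimodule `W = ℂ` on which `M` acts
trivially and `D_0` acts by `α` on the left and by `β` on the right: smooth functions on `G̃` with
`f(h g h') = h · f(g) · h'`. Only the values of `f` on `G̃` matter. -/
def IsSpherical (p q : ℕ) (α β : ℂ)
    (f : Matrix (Fin (p + q + 2)) (Fin (p + q + 2)) ℝ → ℂ) : Prop :=
  ContDiffOn ℝ ∞ f (tildeG p q) ∧
  ∀ g ∈ tildeG p q, ∀ m ∈ groupM p q, ∀ m' ∈ groupM p q, ∀ s s' : ℝ,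
    f ((m * NormedSpace.exp (s • dilation p q)) * g * (m' * NormedSpace.exp (s' • dilation p q)))
      = Complex.exp (α * s) * f g * Complex.exp (β * s')

end Smooth

/-- `(X · f)(g) = d/dt f(g exp(tX))` at `t = 0`. -/
def leftAct {n : ℕ} (X : Matrix (Fin n) (Fin n) ℝ) (f : Matrix (Fin n) (Fin n) ℝ → ℂ) :
    Matrix (Fin n) (Fin n) ℝ → ℂ :=
  fun g => deriv (fun t : ℝ => f (g * NormedSpace.exp (t • X))) 0

/-- `(f · X)(g) = d/dt f(exp(tX) g)` at `t = 0`. -/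
def rightAct {n : ℕ} (f : Matrix (Fin n) (Fin n) ℝ → ℂ) (X : Matrix (Fin n) (Fin n) ℝ) :
    Matrix (Fin n) (Fin n) ℝ → ℂ :=
  fun g => deriv (fun t : ℝ => f (NormedSpace.exp (t • X) * g)) 0

/-- `Ω_𝔤 · f`, where `Ω_𝔤 = ∑_{μ<ν} F_{μν} F_{μν}^∨` is the quadratic Casimir element with respect
to `B(X,Y) = tr(XY)`. -/
def casimirLeft (p q : ℕ) (f : Matrix (Fin (p + q + 2)) (Fin (p + q + 2)) ℝ → ℂ) :
    Matrix (Fin (p + q + 2)) (Fin (p + q + 2)) ℝ → ℂ :=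
  fun g => ∑ ν ∈ Finset.range (p + q + 2), ∑ μ ∈ Finset.range ν,
    leftAct (genF p q μ ν) (leftAct (genFDual p q μ ν) f) g

/-- `f · Ω_𝔤`. -/
def casimirRight (p q : ℕ) (f : Matrix (Fin (p + q + 2)) (Fin (p + q + 2)) ℝ → ℂ) :
    Matrix (Fin (p + q + 2)) (Fin (p + q + 2)) ℝ → ℂ :=
  fun g => ∑ ν ∈ Finset.range (p + q + 2), ∑ μ ∈ Finset.range ν,
    rightAct (rightAct f (genF p q μ ν)) (genFDual p q μ ν) g

/-! ### The Cartan subsets `C_I` and their parametrisations -/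

/-- Labels of the Cartan subsets: `euclid` is the only one for `q = 0`; the others are
`C_∅, C_{0}, C_{2}, C_{1}, C_{1}', C_{0,1}, C_{0,2}, C_{1,2}` for `q > 0`. -/
inductive CartanLabel : Type
  | euclid | empty | s0 | s2 | s1 | s1prime | s01 | s02 | s12

/-- Which labels occur for `SO(p+1,q+1)₀`. -/
def CartanLabel.Occurs (q : ℕ) : CartanLabel → Prop
  | .euclid => q = 0
  | .s1prime => 2 ≤ q
  | _ => 1 ≤ q

/-- A basis `X_0, X_1` of `𝔠_I`. -/
def cartanGen (p q : ℕ) :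
    CartanLabel → Fin 2 → Matrix (Fin (p + q + 2)) (Fin (p + q + 2)) ℝ
  | .euclid => ![genF p q 0 1, genF p q (p + q) (p + q + 1)]
  | .empty => ![genF p q 0 1, genF p q (p + q) (p + q + 1)]
  | .s0 => ![genF p q 0 1 + genF p q (p + q) (p + q + 1),
      genF p q 0 (p + q) - genF p q 1 (p + q + 1)]
  | .s2 => ![genF p q 0 1 + genF p q (p + q) (p + q + 1),
      genF p q 0 (p + q) - genF p q 1 (p + q + 1)]
  | .s1 => ![genF p q 0 1, genF p q 2 (p + q + 1)]
  | .s1prime => ![genF p q (p + q) (p + q + 1), genF p q 0 (p + q - 1)]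
  | .s01 => ![genF p q 0 (p + q), genF p q 1 (p + q + 1)]
  | .s02 => ![genF p q 0 (p + q), genF p q 1 (p + q + 1)]
  | .s12 => ![genF p q 0 (p + q), genF p q 1 (p + q + 1)]

/-- The element `t_I` with `C_I = exp(𝔠_I) t_I`; here `t_{φ,ψ} = exp(φ F_{0,1} + ψ F_{d,d+1})`. -/
def cartanTwist (p q : ℕ) : CartanLabel → Matrix (Fin (p + q + 2)) (Fin (p + q + 2)) ℝ
  | .s2 => NormedSpace.exp (Real.pi • genF p q (p + q) (p + q + 1))
  | .s12 => NormedSpace.exp (Real.pi • genF p q (p + q) (p + q + 1))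
  | .s02 => NormedSpace.exp
      ((Real.pi / 2) • genF p q 0 1 + (Real.pi / 2) • genF p q (p + q) (p + q + 1))
  | _ => 1

/-- The functionals `ε_1, ε_2` on `𝔠_I`: the entry `(j, i)` is the value of `ε_{i+1}` on the basis
vector `X_j`. -/
def cartanEps : CartanLabel → Matrix (Fin 2) (Fin 2) ℂ
  | .euclid => !![Complex.I, Complex.I; 1, -1]
  | .empty => !![Complex.I, Complex.I; Complex.I, -Complex.I]
  | .s0 => !![2 * Complex.I, 0; 0, 2]
  | .s2 => !![0, 2 * Complex.I; 2, 0]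
  | .s1 => !![Complex.I, Complex.I; 1, -1]
  | .s1prime => !![Complex.I, Complex.I; 1, -1]
  | .s01 => !![1, 1; 1, -1]
  | .s02 => !![1, 1; 1, -1]
  | .s12 => !![1, 1; 1, -1]

/-- The parameter region `Y_I ⊆ ℂ²`, whose points are `(χ_1, χ_2) = (χ 0, χ 1)`. -/
def region : CartanLabel → Set (Fin 2 → ℂ)
  | .empty => {χ | (χ 0).re = 0 ∧ (χ 1).re = 0 ∧ 0 < (χ 0).im ∧ (χ 0).im < (χ 1).im ∧
      (χ 1).im < Real.pi}
  | .s0 => {χ | (χ 0).re = 0 ∧ 0 < (χ 0).im ∧ (χ 0).im < Real.pi ∧ 0 < (χ 1).re ∧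
      (χ 1).im = Real.pi}
  | .s2 => {χ | 0 < (χ 0).re ∧ (χ 0).im = 0 ∧ (χ 1).re = 0 ∧ 0 < (χ 1).im ∧
      (χ 1).im < Real.pi}
  | .s01 => {χ | 0 < (χ 0).re ∧ (χ 0).re < (χ 1).re ∧ (χ 0).im = Real.pi ∧
      (χ 1).im = Real.pi}
  | .s02 => {χ | 0 < (χ 0).re ∧ 0 < (χ 1).re ∧ (χ 0).im = 0 ∧ (χ 1).im = Real.pi}
  | .s12 => {χ | 0 < (χ 0).re ∧ (χ 0).re < (χ 1).re ∧ (χ 0).im = 0 ∧ (χ 1).im = 0}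
  | _ => {χ | 0 < (χ 1).re ∧ (χ 0).re = -(χ 1).re ∧ (χ 0).im = (χ 1).im ∧
      0 < (χ 0).im ∧ (χ 0).im < Real.pi}

/-- Coefficients of `X_0, X_1` in the parametrisation of `C_I` by `Y_I`. Real parts of quotients by
`2i` are taken only of numbers that are real for `χ ∈ Y_I`. -/
def cartanCoord : CartanLabel → (Fin 2 → ℂ) → Fin 2 → ℝ
  | .empty, χ => ![((χ 0 + χ 1 - 2 * Real.pi * Complex.I) / (2 * Complex.I)).re,
      ((χ 0 - χ 1) / (2 * Complex.I)).re]
  | .s0, χ => ![((χ 0 - Complex.I * Real.pi) / (2 * Complex.I)).re, (χ 1).re / 2]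
  | .s2, χ => ![(χ 1 / (2 * Complex.I)).re, (χ 0).re / 2]
  | .s01, χ => ![(χ 0 + χ 1).re / 2, (χ 0 - χ 1).re / 2]
  | .s02, χ => ![(χ 0 + χ 1).re / 2, (χ 0 - χ 1).re / 2]
  | .s12, χ => ![(χ 0 + χ 1).re / 2, (χ 0 - χ 1).re / 2]
  | _, χ => ![((χ 0 + χ 1 - 2 * Real.pi * Complex.I) / (2 * Complex.I)).re,
      (χ 0 - χ 1).re / 2]

/-- The parametrisation `Y_I → C_I = exp(𝔠_I) t_I`. -/
def param (p q : ℕ) (I : CartanLabel) (χ : Fin 2 → ℂ) :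
    Matrix (Fin (p + q + 2)) (Fin (p + q + 2)) ℝ :=
  NormedSpace.exp (∑ j, cartanCoord I χ j • cartanGen p q I j) * cartanTwist p q I

/-- `Ψ_I(f)`: restriction to `C_I`, read in the parametrisation. -/
def restrict (p q : ℕ) (I : CartanLabel)
    (f : Matrix (Fin (p + q + 2)) (Fin (p + q + 2)) ℝ → ℂ) : (Fin 2 → ℂ) → ℂ :=
  fun χ => f (param p q I χ)

/-- For a functional `γ = γ_0 ε_1 + γ_1 ε_2` on `𝔠_{I,ℂ}`, the space `𝔤_γ ⊆ 𝔤_ℂ` of those `X` with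
`[Z, X] = γ(Z) X` for all `Z ∈ 𝔠_I`. -/
def rootSpace (p q : ℕ) (I : CartanLabel) (γ : Fin 2 → ℂ) :
    Submodule ℂ (Matrix (Fin (p + q + 2)) (Fin (p + q + 2)) ℂ) where
  carrier := {X | Xᵀ * (metric p q).map (algebraMap ℝ ℂ)
        + (metric p q).map (algebraMap ℝ ℂ) * X = 0 ∧
      ∀ j, (cartanGen p q I j).map (algebraMap ℝ ℂ) * X
        - X * (cartanGen p q I j).map (algebraMap ℝ ℂ) = (∑ i, cartanEps I j i * γ i) • X}
  add_mem' := by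
    rintro X Y ⟨hX, hX'⟩ ⟨hY, hY'⟩
    refine ⟨?_, fun j => ?_⟩
    · rw [Matrix.transpose_add, add_mul, mul_add, add_add_add_comm, hX, hY, add_zero]
    · rw [mul_add, add_mul, add_sub_add_comm, hX' j, hY' j, smul_add]
  zero_mem' := by simp
  smul_mem' := by
    rintro c X ⟨hX, hX'⟩
    refine ⟨?_, fun j => ?_⟩
    · rw [Matrix.transpose_smul, smul_mul_assoc, mul_smul_comm, ← smul_add, hX, smul_zero]
    · rw [mul_smul_comm, smul_mul_assoc, ← smul_sub, hX' j, smul_comm]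

/-- The roots `Σ(𝔤 : 𝔠_I)`, in coordinates with respect to `ε_1, ε_2`. -/
def cartanRoots (p q : ℕ) (I : CartanLabel) : Set (Fin 2 → ℂ) :=
  {γ | γ ≠ 0 ∧ rootSpace p q I γ ≠ ⊥}

/-! ### The root system `BC_2` and the Heckman–Opdam Laplacian -/

/-- `B^*(γ,γ)` for `γ = γ_0 ε_1 + γ_1 ε_2`; `ε_1, ε_2` are orthonormal. -/
def rootNormSq (γ : Fin 2 → ℤ) : ℤ := γ 0 ^ 2 + γ 1 ^ 2

/-- The root system of type `BC_2`: the vectors `±ε_i`, `±ε_1 ± ε_2`, `±2ε_i`. -/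
def rootsBC : Set (Fin 2 → ℤ) :=
  {γ | rootNormSq γ = 1 ∨ rootNormSq γ = 2 ∨ rootNormSq γ = 4}

/-- The positive roots `ε_1, ε_2, ε_1 + ε_2, ε_1 - ε_2, 2ε_1, 2ε_2`. -/
def posRoots : Finset (Fin 2 → ℤ) :=
  {![1, 0], ![0, 1], ![1, 1], ![1, -1], ![2, 0], ![0, 2]}

/-- The Weyl-invariant function on `BC_2` with value `a` on `±ε_i`, `b` on `±ε_1 ± ε_2`, and `c` on
`±2ε_i`. -/
def invariantFun (a b c : ℂ) (γ : Fin 2 → ℤ) : ℂ :=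
  if rootNormSq γ = 1 then a else if rootNormSq γ = 2 then b
  else if rootNormSq γ = 4 then c else 0

/-- The multiplicity `k`, extended by zero to `±ε_i`. -/
def multK (d : ℕ) : (Fin 2 → ℤ) → ℂ := invariantFun 0 (((d : ℂ) - 2) / 2) (1 / 2)

/-- The multiplicity `m`. -/
def multM (d : ℕ) (α β : ℂ) : (Fin 2 → ℤ) → ℂ :=
  invariantFun α (((d : ℂ) - 2) / 2) ((1 - α + β) / 2)

/-- The coefficients `l_γ²`. -/
def coeffL (α β : ℂ) : (Fin 2 → ℤ) → ℂ :=
  invariantFun (-(α * β)) 0 (-((α - β) / 2) ^ 2)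

/-- The function `e^{cγ}`, `c ∈ ℂ`, where `e^{ε_i}` is `χ ↦ exp(χ_i)`. -/
def rootExp (c : ℂ) (γ : Fin 2 → ℤ) (χ : Fin 2 → ℂ) : ℂ :=
  Complex.exp (c * (γ 0 * χ 0 + γ 1 * χ 1))

/-- The derivations `∂_{χ_1}, ∂_{χ_2}` (`i = 0, 1`) of complex-valued functions on the real slice
`Y_I`. The rows `v_0, v_1` of `cartanEps I` are a real basis of the directions of `Y_I` and a complex
basis of `ℂ²`; `∂_{χ_i}` is the complex combination of the derivatives along `v_0, v_1` for which
the derivative along `v_j` is `∑ i, (v_j)_i ∂_{χ_i}`. -/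
def partialChi (I : CartanLabel) (i : Fin 2) (F : (Fin 2 → ℂ) → ℂ) : (Fin 2 → ℂ) → ℂ :=
  fun χ => ∑ j, (cartanEps I)⁻¹ i j * deriv (fun s : ℝ => F (χ + s • cartanEps I j)) 0

theorem isUnit_det_cartanEps (I : CartanLabel) : IsUnit (cartanEps I).det := by
  rw [isUnit_iff_ne_zero]
  cases I <;> simp [cartanEps, Matrix.det_fin_two, Complex.ext_iff] <;> norm_num

/-- The Heckman–Opdam Laplacian
`L(κ) = ∂_{ε_1}² + ∂_{ε_2}² + ∑_{γ>0} κ_γ (1 + e^{-γ})/(1 - e^{-γ}) ∂_γ` on functions on `Y_I`. -/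
def laplacian (I : CartanLabel) (κ : (Fin 2 → ℤ) → ℂ) (F : (Fin 2 → ℂ) → ℂ) :
    (Fin 2 → ℂ) → ℂ :=
  fun χ => partialChi I 0 (partialChi I 0 F) χ + partialChi I 1 (partialChi I 1 F) χ
    + ∑ γ ∈ posRoots, κ γ * ((1 + rootExp (-1) γ χ) / (1 - rootExp (-1) γ χ))
        * (γ 0 * partialChi I 0 F χ + γ 1 * partialChi I 1 F χ)

/-- `∑_{γ>0} l_γ² B^*(γ,γ) / (e^{γ/2} - e^{-γ/2})²`. -/
def potential (α β : ℂ) (χ : Fin 2 → ℂ) : ℂ :=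
  ∑ γ ∈ posRoots, coeffL α β γ * rootNormSq γ
    / (rootExp (1 / 2) γ χ - rootExp (-(1 / 2)) γ χ) ^ 2

/-- `δ = ∏_{γ>0} (e^{γ/2} - e^{-γ/2})^{(m-k)_γ}`, with principal powers. -/
def deltaFun (d : ℕ) (α β : ℂ) (χ : Fin 2 → ℂ) : ℂ :=
  ∏ γ ∈ posRoots,
    (rootExp (1 / 2) γ χ - rootExp (-(1 / 2)) γ χ) ^ (multM d α β γ - multK d γ)

/-- `‖ρ(κ)‖²` with `ρ(κ) = (1/2) ∑_{γ>0} κ_γ γ`, in the complex bilinear extension of `B^*`. -/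
def rhoNormSq (κ : (Fin 2 → ℤ) → ℂ) : ℂ :=
  ∑ i, ((1 / 2) * ∑ γ ∈ posRoots, κ γ * (γ i : ℂ)) ^ 2

end ConformalCasimir

end

open ConformalCasimir

/-! The proof is a radial-part computation at a point `x` of the Cartan subset. The first and second
derivatives of `f` at `x` along right-invariant vector fields are extended complex linearly to `D₁`
and `D₂`, where the first argument of `D₂` is the field that is applied first (`exists_isJet`). Left
equivariance evaluates `D₂` when its first argument lies in the Lie algebra of `H`; right
equivariance evaluates it when its second argument lies in the conjugate of that Lie algebra by `x`;
and `D₂ A B - D₂ B A = D₁ (A * B - B * A)` allows reordering. It therefore suffices to split the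
entries of the Casimir tensor into such pieces and into elements of `𝔠_I`, which act as derivatives
on `Y_I`.

After complexification all labels look alike. The dilation and `𝔠_I` act on four coordinates only,
and on these `so(4, ℂ) = sl(2, ℂ) ⊕ sl(2, ℂ)` acts on `ℂ² ⊗ ℂ²`. A model (`IsCartanModel`, supplied
by `exists_isCartanModel`) is a weight basis in which the dilation is the standard `stdR 0 1 + stdR
1 1` and conjugation by `x` sends `stdR i 1` to `stdR i (-exp (χ i))` (`param_stdR`). The labels
differ only in finite matrix checks.

The Casimir tensor then has three contributions. Each `sl(2)` factor gives `∂² + coth χ_i ∂` and a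
potential (`factor_value`). Each of the `d - 2` remaining coordinates gives the terms with `coth
((χ_1 ± χ_2)/2)`, because the kernels of the dilation and of its conjugate are complementary in the
four-space (`cross_value`). Pairs of remaining coordinates lie in `𝔪` and give nothing. The sum is
`casimirTensor_eq_radial`; conjugation invariance of the tensor (`casimirTensor_conj`) makes the
left and right actions of the Casimir agree.

The same model settles the other geometric claims. The four points are eigenvectors of the dilation
and of its conjugate, hence explicit pure tensors (`IsModel.mem_tildeG`); the root spaces are weight
spaces of skew tensors, whose dimension is a count of index pairs (`finrank_weightSpace`).

For the conjugation, `δ` is up to a constant a product of functions of one coordinate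
(`deltaFun_eq`) with logarithmic derivatives rational in `exp (χ i)`. Comparing coefficients leaves
two kinds of rational identity, `conj_identity` and `conj_identity_single`; the constants they leave
behind add up to `β(β+d)/2 = ‖ρ(m)‖² - ‖ρ(k)‖²`.

Two analytic points need care: `f` is smooth only within `G̃`, which has empty interior among
matrices, so it is first extended along a retraction (`exists_smooth_extension`); and principal
powers of products must be split without crossing the branch cut (`sinh_half_mul_cosh_half_cpow`).
-/

namespace ConformalCasimir

open Matrix Filter Topology

/-! ### The group `G`, its exponentials, and relative openness of `G̃`. -/

section Group

attribute [local instance] Matrix.linftyOpNormedRing Matrix.linftyOpNormedAlgebra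

/-- `X` is infinitesimally orthogonal for the bilinear form with Gram matrix `S`. -/
def IsSkew {n R : Type*} [Fintype n] [CommRing R] (S X : Matrix n n R) : Prop :=
  Xᵀ * S + S * X = 0

variable {p q : ℕ}

theorem eta_mul_self (p n : ℕ) : eta p n * eta p n = 1 := by
  unfold eta; split_ifs <;> norm_num

theorem metric_mul_self : metric p q * metric p q = 1 := by
  simp [metric, Matrix.diagonal_mul_diagonal, eta_mul_self]

theorem metric_transpose : (metric p q)ᵀ = metric p q := by
  simp [metric]

theorem metric_inv : (metric p q)⁻¹ = metric p q :=
  Matrix.inv_eq_left_inv metric_mul_self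

theorem isUnit_metric : IsUnit (metric p q) :=
  IsUnit.of_mul_eq_one _ metric_mul_self

theorem IsSkew.transpose_mul {n R : Type*} [Fintype n] [CommRing R] {S X : Matrix n n R}
    (h : IsSkew S X) : Xᵀ * S = -(S * X) := eq_neg_of_add_eq_zero_left h

theorem IsSkew.smul {n R : Type*} [Fintype n] [CommRing R] {S X : Matrix n n R}
    (h : IsSkew S X) (c : R) : IsSkew S (c • X) := by
  simp only [IsSkew, Matrix.transpose_smul, Matrix.smul_mul, Matrix.mul_smul, ← smul_add]
  rw [show Xᵀ * S + S * X = 0 from h, smul_zero]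

theorem IsSkew.add {n R : Type*} [Fintype n] [CommRing R] {S X Y : Matrix n n R}
    (hX : IsSkew S X) (hY : IsSkew S Y) : IsSkew S (X + Y) := by
  simp only [IsSkew, Matrix.transpose_add, add_mul, mul_add]
  rw [add_add_add_comm, show Xᵀ * S + S * X = 0 from hX, show Yᵀ * S + S * Y = 0 from hY, add_zero]

theorem one_mem_specialOrthogonal : (1 : Matrix _ _ ℝ) ∈ specialOrthogonal p q := by
  simp [specialOrthogonal]

theorem mul_mem_specialOrthogonal {g h : Matrix _ _ ℝ} (hg : g ∈ specialOrthogonal p q)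
    (hh : h ∈ specialOrthogonal p q) : g * h ∈ specialOrthogonal p q := by
  refine ⟨?_, by rw [Matrix.det_mul, hg.2, hh.2, one_mul]⟩
  rw [Matrix.transpose_mul]
  calc hᵀ * gᵀ * metric p q * (g * h) = hᵀ * (gᵀ * metric p q * g) * h := by
        simp only [Matrix.mul_assoc]
    _ = _ := by rw [hg.1, hh.1]

theorem groupG_subset : groupG p q ⊆ specialOrthogonal p q :=
  connectedComponentIn_subset _ _

theorem one_mem_groupG : (1 : Matrix _ _ ℝ) ∈ groupG p q :=
  mem_connectedComponentIn one_mem_specialOrthogonal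

/-- Left translation by `g` carries the component of `1` to a connected set containing `g`, hence
into that same component. -/
theorem mul_mem_groupG {g h : Matrix _ _ ℝ} (hg : g ∈ groupG p q) (hh : h ∈ groupG p q) :
    g * h ∈ groupG p q := by
  have hpre : IsPreconnected ((fun y => g * y) '' groupG p q) :=
    isPreconnected_connectedComponentIn.image _ (continuous_const.mul continuous_id).continuousOn
  have hsub : (fun y => g * y) '' groupG p q ⊆ specialOrthogonal p q := by
    rintro _ ⟨y, hy, rfl⟩
    exact mul_mem_specialOrthogonal (groupG_subset hg) (groupG_subset hy)
  have hmem : g ∈ (fun y => g * y) '' groupG p q := ⟨1, one_mem_groupG, mul_one g⟩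
  have := hpre.subset_connectedComponentIn hmem hsub
  rw [← connectedComponentIn_eq hg] at this
  exact this ⟨h, hh, rfl⟩

theorem mem_groupG_of_path {γ : ℝ → Matrix (Fin (p + q + 2)) (Fin (p + q + 2)) ℝ}
    (hγ : ContinuousOn γ (Set.Icc 0 1)) (h0 : γ 0 = 1)
    (h : ∀ t ∈ Set.Icc (0 : ℝ) 1, γ t ∈ specialOrthogonal p q) : γ 1 ∈ groupG p q := by
  have hpre : IsPreconnected (γ '' Set.Icc 0 1) := isPreconnected_Icc.image _ hγ
  refine hpre.subset_connectedComponentIn ⟨0, by simp, h0⟩ ?_ ⟨1, by simp, rfl⟩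
  rintro _ ⟨t, ht, rfl⟩
  exact h t ht

theorem inv_eq_of_mem {g : Matrix _ _ ℝ} (hg : g ∈ specialOrthogonal p q) :
    metric p q * gᵀ * metric p q * g = 1 := by
  rw [Matrix.mul_assoc (metric p q), Matrix.mul_assoc, hg.1, metric_mul_self]

/-- Skewness says that `Xᵀ` is conjugate to `-X` by the metric, so `exp Xᵀ` is conjugate to `exp
(-X)`. This yields only `det ^ 2 = 1`; the sign follows because `exp X` is the square of `exp (X /
2)`. -/
theorem exp_mem_specialOrthogonal {X : Matrix _ _ ℝ} (hX : IsSkew (metric p q) X) :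
    NormedSpace.exp X ∈ specialOrthogonal p q := by
  have key : ∀ {X : Matrix (Fin (p + q + 2)) (Fin (p + q + 2)) ℝ}, IsSkew (metric p q) X →
      (NormedSpace.exp X)ᵀ * metric p q * NormedSpace.exp X = metric p q := by
    intro X hX
    have h1 : Xᵀ = metric p q * (-X) * (metric p q)⁻¹ := by
      rw [metric_inv, mul_neg, ← hX.transpose_mul, Matrix.mul_assoc, metric_mul_self, mul_one]
    rw [← Matrix.exp_transpose, h1, Matrix.exp_conj _ _ isUnit_metric, metric_inv,
      Matrix.mul_assoc _ (metric p q) (metric p q), metric_mul_self, mul_one, Matrix.mul_assoc,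
      ← Matrix.exp_add_of_commute _ _ (Commute.neg_left (Commute.refl X))]
    simp
  have hdet : ∀ {X : Matrix (Fin (p + q + 2)) (Fin (p + q + 2)) ℝ}, IsSkew (metric p q) X →
      (NormedSpace.exp X).det ^ 2 = 1 := by
    intro X hX
    have h := congrArg Matrix.det (key hX)
    have hu : (metric p q).det ≠ 0 := ((Matrix.isUnit_iff_isUnit_det _).1 isUnit_metric).ne_zero
    rw [Matrix.det_mul, Matrix.det_mul, Matrix.det_transpose] at h
    apply mul_right_cancel₀ hu
    linear_combination h
  refine ⟨key hX, ?_⟩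
  have h2 : NormedSpace.exp X
      = NormedSpace.exp ((1 / 2 : ℝ) • X) * NormedSpace.exp ((1 / 2 : ℝ) • X) := by
    rw [← Matrix.exp_add_of_commute _ _ (Commute.refl _), ← add_smul]
    norm_num
  rw [h2, Matrix.det_mul, ← pow_two]
  exact hdet (hX.smul _)

theorem exp_mem_groupG {X : Matrix _ _ ℝ} (hX : IsSkew (metric p q) X) :
    NormedSpace.exp X ∈ groupG p q := by
  have := mem_groupG_of_path (p := p) (q := q) (γ := fun t => NormedSpace.exp (t • X))
    (Continuous.continuousOn ((NormedSpace.exp_continuous).comp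
      (continuous_id.smul continuous_const))) (by simp)
    (fun t _ => exp_mem_specialOrthogonal (hX.smul t))
  simpa using this

/-- General position is open in the space of all matrices; only membership in `G` is not, and it
stays as a hypothesis. Curves inside `G` through `x` thus stay in `G̃` for small times. -/
theorem eventually_mem_tildeG {x : Matrix _ _ ℝ} (hx : x ∈ tildeG p q) :
    ∀ᶠ g in 𝓝 x, g ∈ groupG p q → g ∈ tildeG p q := by
  have hc : Continuous (fourPoints p q) := by
    refine continuous_pi fun i => ?_
    fin_cases i
    · exact continuous_const
    · exact continuous_const
    · exact continuous_id.matrix_mulVec continuous_const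
    · exact continuous_id.matrix_mulVec continuous_const
  have h1 : ∀ᶠ g in 𝓝 x, LinearIndependent ℝ (fourPoints p q g) :=
    hc.continuousAt.eventually (isOpen_setOfPred_linearIndependent.mem_nhds hx.2.1)
  have h2 : ∀ᶠ g in 𝓝 x, ∀ i j, i ≠ j →
      form p q (fourPoints p q g i) (fourPoints p q g j) ≠ 0 := by
    refine eventually_all.2 fun i => eventually_all.2 fun j => ?_
    by_cases hij : i = j
    · exact Eventually.of_forall fun _ h => absurd hij h
    · have hcf : Continuous fun g => form p q (fourPoints p q g i) (fourPoints p q g j) :=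
        ((continuous_apply i).comp hc).dotProduct
          (continuous_const.matrix_mulVec ((continuous_apply j).comp hc))
      exact (hcf.continuousAt.eventually_ne (hx.2.2 i j hij)).mono fun g hg _ => hg
  filter_upwards [h1, h2] with g hg1 hg2 hg
  exact ⟨hg, hg1, hg2⟩

theorem eventually_exp_mul_mem {x X : Matrix _ _ ℝ} (hx : x ∈ tildeG p q)
    (hX : IsSkew (metric p q) X) :
    ∀ᶠ t : ℝ in 𝓝 0, NormedSpace.exp (t • X) * x ∈ tildeG p q := by
  have hc : ContinuousAt (fun t : ℝ => NormedSpace.exp (t • X) * x) 0 :=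
    (((NormedSpace.exp_continuous).comp
      (continuous_id.smul continuous_const)).mul continuous_const).continuousAt
  have h := hc.eventually (p := fun g => g ∈ groupG p q → g ∈ tildeG p q)
    (by simpa using eventually_mem_tildeG hx)
  exact h.mono fun t ht => ht (mul_mem_groupG (exp_mem_groupG (hX.smul t)) hx.1)

/-! ### A smooth retraction onto the group -/

/-- The Cayley transform. -/
noncomputable def cayley {n : Type*} [Fintype n] [DecidableEq n] (A : Matrix n n ℝ) :
    Matrix n n ℝ :=
  (1 - A) * Ring.inverse (1 + A)

theorem cayley_zero {n : Type*} [Fintype n] [DecidableEq n] :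
    cayley (0 : Matrix n n ℝ) = 1 := by simp [cayley]

theorem cayley_one {n : Type*} [Fintype n] [DecidableEq n] :
    cayley (1 : Matrix n n ℝ) = 0 := by simp [cayley]

theorem contDiffAt_cayley {n : Type*} [Fintype n] [DecidableEq n] {A : Matrix n n ℝ}
    (hA : IsUnit (1 + A)) : ContDiffAt ℝ ∞ cayley A := by
  obtain ⟨u, hu⟩ := hA
  have h : ContDiffAt ℝ ∞ (fun B : Matrix n n ℝ => Ring.inverse (1 + B)) A :=
    ContDiffAt.comp (n := ∞) (f := fun B : Matrix n n ℝ => 1 + B) A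
      (by rw [← hu]; exact contDiffAt_ringInverse ℝ u)
      (contDiffAt_const.add contDiffAt_id)
  exact (contDiffAt_const.sub contDiffAt_id).mul h

/-- With `u = (1 + y)⁻¹` one has `1 + cayley y = 2u` and `1 - cayley y = 2yu`, whose quotient is
`y`. One transform therefore serves both as a chart at `1` and as its inverse. -/
theorem cayley_cayley {n : Type*} [Fintype n] [DecidableEq n] {y : Matrix n n ℝ}
    (hy : IsUnit (1 + y)) : cayley (cayley y) = y := by
  have h1 : (1 + y) * Ring.inverse (1 + y) = 1 := Ring.mul_inverse_cancel _ hy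
  have ha : 1 + cayley y = (2 : ℝ) • Ring.inverse (1 + y) := by
    rw [cayley]; nth_rw 1 [← h1]; rw [← add_mul, add_add_sub_cancel,
      one_add_one_eq_two, two_smul, two_mul]
  have hs : 1 - cayley y = (2 : ℝ) • (y * Ring.inverse (1 + y)) := by
    rw [cayley]; nth_rw 1 [← h1]; rw [← sub_mul, ← smul_mul_assoc]
    congr 1; rw [two_smul]; abel
  have hinv : Ring.inverse ((2 : ℝ) • Ring.inverse (1 + y)) = (1 / 2 : ℝ) • (1 + y) := by
    rw [← Matrix.nonsing_inv_eq_ringInverse]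
    apply Matrix.inv_eq_right_inv
    rw [smul_mul_smul_comm, Ring.inverse_mul_cancel _ hy]; norm_num
  rw [cayley, ha, hs, hinv, smul_mul_smul_comm, Matrix.mul_assoc, Ring.inverse_mul_cancel _ hy]
  norm_num

/-- Moving a transpose past the metric exchanges `1 - B` and `1 + B`. These commute, so the factors
cancel in the form; the same exchange shows that they have equal determinants. -/
theorem cayley_mem_specialOrthogonal {B : Matrix _ _ ℝ} (hB : IsSkew (metric p q) B)
    (hu : IsUnit (1 + B)) : cayley B ∈ specialOrthogonal p q := by
  have h1 : (1 + B) * Ring.inverse (1 + B) = 1 := Ring.mul_inverse_cancel _ hu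
  have h2 : (1 - B)ᵀ * metric p q = metric p q * (1 + B) := by
    rw [Matrix.transpose_sub, Matrix.transpose_one, sub_mul, hB.transpose_mul, one_mul, mul_add,
      mul_one, sub_neg_eq_add]
  have h3 : (1 + B)ᵀ * metric p q = metric p q * (1 - B) := by
    rw [Matrix.transpose_add, Matrix.transpose_one, add_mul, hB.transpose_mul, one_mul, mul_sub,
      mul_one, ← sub_eq_add_neg]
  have h4 : (Ring.inverse (1 + B))ᵀ * (1 + B)ᵀ = 1 := by
    rw [← Matrix.transpose_mul, h1, Matrix.transpose_one]
  refine ⟨?_, ?_⟩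
  · rw [cayley, Matrix.transpose_mul]
    calc (Ring.inverse (1 + B))ᵀ * (1 - B)ᵀ * metric p q * ((1 - B) * Ring.inverse (1 + B))
        = (Ring.inverse (1 + B))ᵀ * ((1 - B)ᵀ * metric p q) * ((1 - B) * Ring.inverse (1 + B)) := by
          simp only [Matrix.mul_assoc]
      _ = (Ring.inverse (1 + B))ᵀ * metric p q * ((1 + B) * (1 - B)) * Ring.inverse (1 + B) := by
          rw [h2]; simp only [Matrix.mul_assoc]
      _ = (Ring.inverse (1 + B))ᵀ * metric p q * ((1 - B) * (1 + B)) * Ring.inverse (1 + B) := by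
          congr 2; noncomm_ring
      _ = (Ring.inverse (1 + B))ᵀ * (metric p q * (1 - B)) *
            ((1 + B) * Ring.inverse (1 + B)) := by simp only [Matrix.mul_assoc]
      _ = metric p q := by
          rw [← h3, h1, mul_one, ← Matrix.mul_assoc, h4, one_mul]
  · have hdet : (1 - B).det = (1 + B).det := by
      have h := congrArg Matrix.det h2
      have hη : (metric p q).det ≠ 0 := ((Matrix.isUnit_iff_isUnit_det _).1 isUnit_metric).ne_zero
      rw [Matrix.det_mul, Matrix.det_mul, Matrix.det_transpose] at h
      apply mul_right_cancel₀ hη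
      linear_combination h
    rw [cayley, Matrix.det_mul, hdet, ← Matrix.det_mul, h1, Matrix.det_one]

theorem isSkew_cayley {y : Matrix _ _ ℝ} (hy : yᵀ * metric p q * y = metric p q)
    (hu : IsUnit (1 + y)) : IsSkew (metric p q) (cayley y) := by
  have h1 : (1 + y) * Ring.inverse (1 + y) = 1 := Ring.mul_inverse_cancel _ hu
  have h4 : (Ring.inverse (1 + y))ᵀ * (1 + y)ᵀ = 1 := by
    rw [← Matrix.transpose_mul, h1, Matrix.transpose_one]
  have key : (1 - y)ᵀ * metric p q * (1 + y) + (1 + y)ᵀ * metric p q * (1 - y) = 0 := by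
    simp only [Matrix.transpose_sub, Matrix.transpose_add, Matrix.transpose_one, add_mul, sub_mul,
      mul_add, mul_sub, one_mul, mul_one, hy]
    abel
  rw [IsSkew, cayley, Matrix.transpose_mul]
  calc (Ring.inverse (1 + y))ᵀ * (1 - y)ᵀ * metric p q
        + metric p q * ((1 - y) * Ring.inverse (1 + y))
      = (Ring.inverse (1 + y))ᵀ * (1 - y)ᵀ * metric p q * ((1 + y) * Ring.inverse (1 + y))
        + ((Ring.inverse (1 + y))ᵀ * (1 + y)ᵀ) * (metric p q * ((1 - y) * Ring.inverse (1 + y))) :=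
        by rw [h1, h4, mul_one, one_mul]
    _ = (Ring.inverse (1 + y))ᵀ * ((1 - y)ᵀ * metric p q * (1 + y)
          + (1 + y)ᵀ * metric p q * (1 - y)) * Ring.inverse (1 + y) := by
        simp only [mul_add, add_mul, Matrix.mul_assoc]
    _ = 0 := by rw [key]; simp

/-- The projection onto infinitesimally orthogonal matrices. -/
noncomputable def skewPart (p q : ℕ) (A : Matrix (Fin (p + q + 2)) (Fin (p + q + 2)) ℝ) :
    Matrix (Fin (p + q + 2)) (Fin (p + q + 2)) ℝ :=
  (1 / 2 : ℝ) • (A - metric p q * Aᵀ * metric p q)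

theorem isSkew_skewPart (A : Matrix _ _ ℝ) : IsSkew (metric p q) (skewPart p q A) := by
  have h : metric p q * (metric p q * Aᵀ * metric p q) = Aᵀ * metric p q := by
    rw [← Matrix.mul_assoc, ← Matrix.mul_assoc, metric_mul_self, one_mul]
  have h' : metric p q * (A * metric p q) * metric p q = metric p q * A := by
    rw [Matrix.mul_assoc, Matrix.mul_assoc, metric_mul_self, mul_one]
  simp only [IsSkew, skewPart, Matrix.transpose_smul, Matrix.transpose_sub, Matrix.transpose_mul,
    Matrix.transpose_transpose, metric_transpose, Matrix.smul_mul, Matrix.mul_smul, ← smul_add,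
    sub_mul, mul_sub, h, h']
  rw [sub_add_sub_cancel', sub_self, smul_zero]

theorem skewPart_eq_self {A : Matrix _ _ ℝ} (hA : IsSkew (metric p q) A) :
    skewPart p q A = A := by
  rw [skewPart, Matrix.mul_assoc, hA.transpose_mul, mul_neg, ← Matrix.mul_assoc, metric_mul_self,
    one_mul, sub_neg_eq_add, ← two_smul ℝ, smul_smul]
  norm_num

theorem contDiff_skewPart : ContDiff ℝ ∞ (skewPart p q) := by
  have ht : ContDiff ℝ ∞ (fun A : Matrix (Fin (p + q + 2)) (Fin (p + q + 2)) ℝ => Aᵀ) :=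
    (LinearMap.toContinuousLinearMap (Matrix.transposeLinearEquiv (Fin (p + q + 2))
      (Fin (p + q + 2)) ℝ ℝ).toLinearMap).contDiff
  exact ContDiff.const_smul (1 / 2 : ℝ)
    (contDiff_id.sub ((contDiff_const.mul ht).mul contDiff_const))

/-- In the unit ball `1 + t • B` is invertible for `t ∈ [0, 1]`, so `t ↦ cayley (t • B)` is a path
in the special orthogonal group starting at `1`; its end lies in the identity component. -/
theorem eventually_cayley_mem_groupG :
    ∀ᶠ B in 𝓝 (0 : Matrix (Fin (p + q + 2)) (Fin (p + q + 2)) ℝ),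
      IsSkew (metric p q) B → cayley B ∈ groupG p q := by
  filter_upwards [Metric.ball_mem_nhds 0 one_pos] with B hB hskew
  have hu : ∀ t ∈ Set.Icc (0 : ℝ) 1, IsUnit (1 + t • B) := by
    intro t ht
    have : ‖-(t • B)‖ < 1 := by
      rw [norm_neg, norm_smul, Real.norm_of_nonneg ht.1]
      rw [mem_ball_zero_iff] at hB
      nlinarith [norm_nonneg B, ht.2]
    simpa using isUnit_one_sub_of_norm_lt_one this
  have := mem_groupG_of_path (p := p) (q := q) (γ := fun t => cayley (t • B)) ?_
    (by simp [cayley_zero]) (fun t ht => cayley_mem_specialOrthogonal (hskew.smul t) (hu t ht))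
  · simpa using this
  · intro t ht
    have h1 : ContinuousAt (fun t : ℝ => t • B) t :=
      (continuous_id.smul continuous_const).continuousAt
    exact (ContinuousAt.comp (f := fun t : ℝ => t • B)
      (contDiffAt_cayley (hu t ht)).continuousAt h1).continuousWithinAt

/-- A function that is smooth on `G̃` agrees on `G̃` near each point with a function that is
smooth in the space of all matrices. -/
theorem exists_smooth_extension {f : Matrix (Fin (p + q + 2)) (Fin (p + q + 2)) ℝ → ℂ}
    (hf : ContDiffOn ℝ ∞ f (tildeG p q)) {x : Matrix _ _ ℝ} (hx : x ∈ tildeG p q) :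
    ∃ φ : Matrix (Fin (p + q + 2)) (Fin (p + q + 2)) ℝ → ℂ, ContDiffAt ℝ ∞ φ x ∧
      ∀ᶠ g in 𝓝 x, g ∈ tildeG p q → f g = φ g := by
  set xi := metric p q * xᵀ * metric p q
  have hxi : xi * x = 1 := inv_eq_of_mem (groupG_subset hx.1)
  have hxi' : x * xi = 1 := mul_eq_one_comm.1 hxi
  -- Translate `x` to `1`, pass to the Cayley chart, project linearly onto skew matrices and come
  -- back. The resulting `r` is smooth near `x`, takes values in `G̃` there, and fixes the points of
  -- `G̃` near `x`, so `f ∘ r` is the extension.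
  let A : Matrix (Fin (p + q + 2)) (Fin (p + q + 2)) ℝ → Matrix _ _ ℝ := fun g =>
    skewPart p q (cayley (g * xi))
  let r : Matrix (Fin (p + q + 2)) (Fin (p + q + 2)) ℝ → Matrix _ _ ℝ := fun g => cayley (A g) * x
  have h2 : IsUnit (1 + (1 : Matrix (Fin (p + q + 2)) (Fin (p + q + 2)) ℝ)) :=
    IsUnit.of_mul_eq_one ((1 / 2 : ℝ) • 1) (by
      rw [mul_smul_comm, mul_one, ← two_smul ℝ, smul_smul]; norm_num)
  have hmul : ContDiff ℝ ∞ (fun g : Matrix (Fin (p + q + 2)) (Fin (p + q + 2)) ℝ => g * xi) :=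
    contDiff_id.mul contDiff_const
  have hAx : A x = 0 := by simp [A, hxi', cayley_one, skewPart]
  have hA : ContDiffAt ℝ ∞ A x := by
    refine contDiff_skewPart.contDiffAt.comp x (ContDiffAt.comp x (contDiffAt_cayley ?_)
      hmul.contDiffAt)
    rw [hxi']; exact h2
  have hr : ContDiffAt ℝ ∞ r x := by
    refine ContDiffAt.mul (ContDiffAt.comp x (contDiffAt_cayley ?_) hA) contDiffAt_const
    rw [hAx]; simp
  have hrx : r x = x := by simp [r, hAx, cayley_zero]
  have hrG : ∀ᶠ g in 𝓝 x, r g ∈ tildeG p q := by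
    have e1 : ∀ᶠ g in 𝓝 x, cayley (A g) ∈ groupG p q := by
      have := hA.continuousAt.eventually (p := fun B => IsSkew (metric p q) B →
        cayley B ∈ groupG p q) (by rw [hAx]; exact eventually_cayley_mem_groupG)
      exact this.mono fun g hg => hg (isSkew_skewPart _)
    have e2 := hr.continuousAt.eventually (p := fun g => g ∈ groupG p q → g ∈ tildeG p q)
      (by rw [hrx]; exact eventually_mem_tildeG hx)
    filter_upwards [e1, e2] with g h1 h2
    exact h2 (mul_mem_groupG h1 hx.1)
  refine ⟨f ∘ r, ?_, ?_⟩
  -- The set of points that `r` sends into `G̃` is a neighbourhood of `x`, so smoothness within it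
  -- is smoothness at `x`.
  · have hfr : ContDiffWithinAt ℝ ∞ f (tildeG p q) (r x) := by rw [hrx]; exact hf x hx
    have := ContDiffWithinAt.comp (s := {g | r g ∈ tildeG p q}) x hfr hr.contDiffWithinAt
      (fun g hg => hg)
    exact this.contDiffAt hrG
  · have e3 : ∀ᶠ g in 𝓝 x, IsUnit (1 + g * xi) := by
      have hc : ContinuousAt (fun g => 1 + g * xi) x :=
        (continuous_const.add (continuous_id.mul continuous_const)).continuousAt
      apply hc.eventually (p := fun B => IsUnit B)
      dsimp only
      rw [hxi']
      exact Units.isOpen.mem_nhds h2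
    filter_upwards [e3] with g hu hg
    have hO : (g * xi)ᵀ * metric p q * (g * xi) = metric p q := by
      have hg1 := (groupG_subset hg.1).1
      have hx1 := (groupG_subset hx.1).1
      rw [Matrix.transpose_mul]
      calc xiᵀ * gᵀ * metric p q * (g * xi) = xiᵀ * (gᵀ * metric p q * g) * xi := by
            simp only [Matrix.mul_assoc]
        _ = xiᵀ * (xᵀ * metric p q * x) * xi := by rw [hg1, hx1]
        _ = (x * xi)ᵀ * metric p q * (x * xi) := by
            rw [Matrix.transpose_mul x xi]; simp only [Matrix.mul_assoc]
        _ = metric p q := by rw [hxi']; simp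
    have : r g = g := by
      simp only [r, A]
      rw [skewPart_eq_self (isSkew_cayley hO hu), cayley_cayley hu, Matrix.mul_assoc, hxi, mul_one]
    simp [this]

end Group

end ConformalCasimir

namespace ConformalCasimir

open Matrix Filter Topology

/-! ### Complexified second-order jets along right-invariant fields. -/

section Jet

attribute [local instance] Matrix.linftyOpNormedRing Matrix.linftyOpNormedAlgebra

/-- Complexification of a real matrix. -/
noncomputable abbrev cx {m n : Type*} (X : Matrix m n ℝ) : Matrix m n ℂ := X.map (algebraMap ℝ ℂ)

theorem cx_mul {l m k : Type*} [Fintype m] (X : Matrix l m ℝ) (Y : Matrix m k ℝ) :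
    cx (X * Y) = cx X * cx Y := Matrix.map_mul

theorem cx_add {m k : Type*} (X Y : Matrix m k ℝ) : cx (X + Y) = cx X + cx Y := by
  ext; simp

theorem cx_sub {m k : Type*} (X Y : Matrix m k ℝ) : cx (X - Y) = cx X - cx Y := by
  ext; simp

theorem cx_neg {m k : Type*} (X : Matrix m k ℝ) : cx (-X) = -cx X := by
  ext; simp

theorem cx_smul {m k : Type*} (c : ℝ) (X : Matrix m k ℝ) : cx (c • X) = (c : ℂ) • cx X := by
  ext; simp

theorem cx_zero {m k : Type*} : cx (0 : Matrix m k ℝ) = 0 := by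
  ext; simp

theorem cx_one {n : Type*} [DecidableEq n] : cx (1 : Matrix n n ℝ) = 1 := by
  ext i j; by_cases h : i = j <;> simp [Matrix.one_apply, h]

theorem cx_transpose {m k : Type*} (X : Matrix m k ℝ) : cx Xᵀ = (cx X)ᵀ := rfl

theorem cx_re_add_cx_im {m k : Type*} (A : Matrix m k ℂ) :
    cx (A.map Complex.re) + Complex.I • cx (A.map Complex.im) = A := by
  ext i j
  simp only [Matrix.add_apply, Matrix.map_apply, Matrix.smul_apply, smul_eq_mul,
    Complex.coe_algebraMap]
  rw [mul_comm]; exact Complex.re_add_im _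

theorem cx_add_I_smul_cx_eq_zero {m k : Type*} {P Q : Matrix m k ℝ}
    (h : cx P + Complex.I • cx Q = 0) : P = 0 ∧ Q = 0 := by
  have key : ∀ i j, P i j = 0 ∧ Q i j = 0 := by
    intro i j
    have := congrFun (congrFun h i) j
    simpa [Complex.ext_iff] using this
  exact ⟨by ext i j; exact (key i j).1, by ext i j; exact (key i j).2⟩

variable {n : Type*}

/-- The extension is `A ↦ ℓ (Re A) + i ℓ (Im A)`. Linearity in `ℓ` and a general target `V` are what
allow it to be applied twice, once in each argument of a bilinear form. -/
theorem exists_complexify {V : Type*} [AddCommGroup V] [Module ℂ V] :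
    ∃ T : (Matrix n n ℝ →ₗ[ℝ] V) →ₗ[ℝ] (Matrix n n ℂ →ₗ[ℂ] V),
      ∀ ℓ X, T ℓ (cx X) = ℓ X := by
  have hre : ∀ (c : ℂ) (A : Matrix n n ℂ), (c • A).map Complex.re
      = c.re • A.map Complex.re - c.im • A.map Complex.im := by
    intro c A; ext; simp
  have him : ∀ (c : ℂ) (A : Matrix n n ℂ), (c • A).map Complex.im
      = c.re • A.map Complex.im + c.im • A.map Complex.re := by
    intro c A; ext; simp
  have hadd : ∀ (A B : Matrix n n ℂ), (A + B).map Complex.re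
      = A.map Complex.re + B.map Complex.re := by intro A B; ext; simp
  have hadd' : ∀ (A B : Matrix n n ℂ), (A + B).map Complex.im
      = A.map Complex.im + B.map Complex.im := by intro A B; ext; simp
  refine ⟨{
    toFun := fun ℓ =>
      { toFun := fun A => ℓ (A.map Complex.re) + Complex.I • ℓ (A.map Complex.im)
        map_add' := ?_
        map_smul' := ?_ }
    map_add' := ?_
    map_smul' := ?_ }, ?_⟩
  · intro A B
    simp only [hadd, hadd', map_add, smul_add]; abel
  · intro c A
    simp only [hre, him, map_add, map_sub, map_smul, RingHom.id_apply, smul_add]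
    have e : ∀ (r : ℝ) (v : V), r • v = (r : ℂ) • v := fun r v => rfl
    simp only [e, smul_smul]
    have h1 : c = c.re + Complex.I * c.im := by rw [mul_comm]; exact (Complex.re_add_im c).symm
    have h2 : c * Complex.I = Complex.I * c.re - c.im := by
      linear_combination Complex.I * h1 + (c.im : ℂ) * Complex.I_mul_I
    have h3 : ∀ v : V, c • v = (c.re : ℂ) • v + (Complex.I * c.im) • v := fun v => by
      rw [← add_smul, ← h1]
    rw [h2, h3, sub_smul]
    abel
  · intro ℓ ℓ'
    ext A
    simp only [LinearMap.add_apply, LinearMap.coe_mk, AddHom.coe_mk, smul_add]; abel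
  · intro c ℓ
    ext A
    simp only [LinearMap.smul_apply, LinearMap.coe_mk, AddHom.coe_mk, RingHom.id_apply, smul_add,
      smul_comm c Complex.I]
  · intro ℓ X
    have h1 : (cx X).map Complex.re = X := by ext; simp
    have h2 : (cx X).map Complex.im = 0 := by ext; simp
    simp [h1, h2]

theorem exists_complexify₂ (H : Matrix n n ℝ →ₗ[ℝ] Matrix n n ℝ →ₗ[ℝ] ℂ)
    (hH : ∀ X Y, H X Y = H Y X) :
    ∃ D : Matrix n n ℂ →ₗ[ℂ] Matrix n n ℂ →ₗ[ℂ] ℂ,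
      (∀ X Y, D (cx X) (cx Y) = H X Y) ∧ ∀ A B, D A B = D B A := by
  obtain ⟨T, hT⟩ := exists_complexify (n := n) (V := ℂ)
  obtain ⟨U, hU⟩ := exists_complexify (n := n) (V := Matrix n n ℂ →ₗ[ℂ] ℂ)
  have h : ∀ X Y, U (T ∘ₗ H) (cx X) (cx Y) = H X Y := by
    intro X Y; rw [hU, LinearMap.comp_apply, hT]
  refine ⟨U (T ∘ₗ H), h, fun A B => ?_⟩
  rw [← cx_re_add_cx_im A, ← cx_re_add_cx_im B]
  simp only [map_add, map_smul, LinearMap.add_apply, LinearMap.smul_apply, h, smul_eq_mul]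
  rw [hH (A.map Complex.re), hH (A.map Complex.im), hH (A.map Complex.re) (B.map Complex.im),
    hH (A.map Complex.im) (B.map Complex.im)]
  ring

variable {p q : ℕ}

theorem IsSkew.re_im {Z : Matrix (Fin (p + q + 2)) (Fin (p + q + 2)) ℂ}
    (h : IsSkew (cx (metric p q)) Z) :
    IsSkew (metric p q) (Z.map Complex.re) ∧ IsSkew (metric p q) (Z.map Complex.im) := by
  apply cx_add_I_smul_cx_eq_zero
  have h' : Zᵀ * cx (metric p q) + cx (metric p q) * Z = 0 := h
  rw [← cx_re_add_cx_im Z] at h'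
  rw [← h']
  simp only [cx_add, cx_mul, cx_transpose, Matrix.transpose_add, Matrix.transpose_smul, add_mul,
    mul_add, Matrix.smul_mul, Matrix.mul_smul, smul_add]
  abel

theorem mul_cx_eq_zero_re_im {m k l : Type*} [Fintype k] {Z : Matrix m k ℂ} {D : Matrix k l ℝ}
    (h : Z * cx D = 0) : Z.map Complex.re * D = 0 ∧ Z.map Complex.im * D = 0 := by
  apply cx_add_I_smul_cx_eq_zero
  rw [← cx_re_add_cx_im Z] at h
  simpa only [cx_mul, Matrix.add_mul, Matrix.smul_mul] using h

theorem IsSkew.cx {X : Matrix (Fin (p + q + 2)) (Fin (p + q + 2)) ℝ}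
    (h : IsSkew (metric p q) X) : IsSkew (cx (metric p q)) (cx X) := by
  rw [IsSkew, ← cx_transpose, ← cx_mul, ← cx_mul, ← cx_add, show Xᵀ * _ + _ = 0 from h, cx_zero]

/-- `D₁`, `D₂` are the complex-linear extensions of the first and second derivatives of `f` at `x`
along right-invariant vector fields, and `f` transforms under `H × H` by the characters `α`, `β`. -/
structure IsJet (p q : ℕ) (α β : ℂ) (f : Matrix (Fin (p + q + 2)) (Fin (p + q + 2)) ℝ → ℂ)
    (x : Matrix (Fin (p + q + 2)) (Fin (p + q + 2)) ℝ)
    (D₁ : Matrix (Fin (p + q + 2)) (Fin (p + q + 2)) ℂ →ₗ[ℂ] ℂ)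
    (D₂ : Matrix (Fin (p + q + 2)) (Fin (p + q + 2)) ℂ →ₗ[ℂ]
      Matrix (Fin (p + q + 2)) (Fin (p + q + 2)) ℂ →ₗ[ℂ] ℂ) : Prop where
  comm : ∀ A B, D₂ A B - D₂ B A = D₁ (A * B - B * A)
  right_one : ∀ X, IsSkew (metric p q) X → rightAct f X x = D₁ (cx X)
  right_two : ∀ X Y, IsSkew (metric p q) X → IsSkew (metric p q) Y →
    HasDerivAt (fun t : ℝ => rightAct f X (NormedSpace.exp (t • Y) * x)) (D₂ (cx X) (cx Y)) 0
  left_two : ∀ X Y, IsSkew (metric p q) X → IsSkew (metric p q) Y →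
    leftAct X (leftAct Y f) x = D₂ (cx x * cx X * cx x⁻¹) (cx x * cx Y * cx x⁻¹)
  m_left : ∀ Z, IsSkew (cx (metric p q)) Z → Z * cx (dilation p q) = 0 →
    D₁ Z = 0 ∧ ∀ Y, IsSkew (cx (metric p q)) Y → D₂ Z Y = 0
  m_right : ∀ Z, IsSkew (cx (metric p q)) Z → Z * cx (dilation p q) = 0 →
    D₁ (cx x * Z * cx x⁻¹) = 0 ∧
    ∀ Y, IsSkew (cx (metric p q)) Y → D₂ Y (cx x * Z * cx x⁻¹) = 0
  a_left : D₁ (cx (dilation p q)) = α * f x ∧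
    ∀ Y, IsSkew (cx (metric p q)) Y → D₂ (cx (dilation p q)) Y = α * D₁ Y
  a_right : D₁ (cx x * cx (dilation p q) * cx x⁻¹) = β * f x ∧
    ∀ Y, IsSkew (cx (metric p q)) Y →
      D₂ Y (cx x * cx (dilation p q) * cx x⁻¹) = β * D₁ Y

theorem isSkew_genF {μ ν : ℕ} : IsSkew (metric p q) (genF p q μ ν) := by
  ext i j
  simp only [metric, Matrix.add_apply, Matrix.mul_diagonal, Matrix.diagonal_mul,
    Matrix.transpose_apply, genF, Matrix.of_apply, Matrix.zero_apply]
  have e1 : ((j : ℕ) = μ ∧ (i : ℕ) = ν) ↔ ((i : ℕ) = ν ∧ (j : ℕ) = μ) := and_comm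
  have e2 : ((j : ℕ) = ν ∧ (i : ℕ) = μ) ↔ ((i : ℕ) = μ ∧ (j : ℕ) = ν) := and_comm
  simp only [e1, e2]
  by_cases h1 : (i : ℕ) = μ ∧ (j : ℕ) = ν <;> by_cases h2 : (i : ℕ) = ν ∧ (j : ℕ) = μ
  · have e3 : μ = ν := h1.1.symm.trans h2.1
    rw [if_pos h1, if_pos h2, if_pos h1, if_pos h2, h1.1, h1.2, e3]; ring
  · rw [if_pos h1, if_neg h2, if_pos h1, if_neg h2, h1.1, h1.2]; ring
  · rw [if_neg h1, if_pos h2, if_neg h1, if_pos h2, h2.1, h2.2]; ring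
  · rw [if_neg h1, if_neg h2, if_neg h1, if_neg h2]; ring

theorem isSkew_dilation : IsSkew (metric p q) (dilation p q) := by
  have := (isSkew_genF (p := p) (q := q) (μ := 0) (ν := p + q + 1)).smul (-1)
  simpa [dilation] using this

theorem dilation_mulVec_zero : dilation p q *ᵥ stdVec p q 0 = stdVec p q (p + q + 1) := by
  ext i
  simp only [dilation, Matrix.mulVec, dotProduct, Matrix.neg_apply, genF, Matrix.of_apply, stdVec]
  rw [Finset.sum_eq_single ⟨0, by omega⟩]
  · by_cases h : (i : ℕ) = p + q + 1 <;> simp [h, eta]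
  · intro j _ hj
    have : (j : ℕ) ≠ 0 := fun h => hj (Fin.ext h)
    simp [this]
  · simp

theorem dilation_mulVec_last : dilation p q *ᵥ stdVec p q (p + q + 1) = stdVec p q 0 := by
  ext i
  simp only [dilation, Matrix.mulVec, dotProduct, Matrix.neg_apply, genF, Matrix.of_apply, stdVec]
  rw [Finset.sum_eq_single ⟨p + q + 1, by omega⟩]
  · by_cases h : (i : ℕ) = 0 <;> simp [h, eta]
  · intro j _ hj
    have : (j : ℕ) ≠ p + q + 1 := fun h => hj (Fin.ext h)
    simp [this]
  · simp

theorem one_mem_groupM : (1 : Matrix _ _ ℝ) ∈ groupM p q :=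
  ⟨one_mem_groupG, 1, Or.inl rfl, by simp, by simp⟩

/-- An intertwiner passes through every power and so through the exponential series. Since `K` may
be rectangular, this covers vectors fixed by a one-parameter group, restriction to invariant
subspaces, and conjugation. -/
theorem exp_mul_eq_mul_exp {𝕜 m k : Type*} [RCLike 𝕜] [Fintype m] [DecidableEq m] [Fintype k]
    [DecidableEq k] {C : Matrix m m 𝕜} {K : Matrix m k 𝕜} {C' : Matrix k k 𝕜}
    (h : C * K = K * C') : NormedSpace.exp C * K = K * NormedSpace.exp C' := by
  have hpow : ∀ i : ℕ, C ^ i * K = K * C' ^ i := by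
    intro i
    induction i with
    | zero => simp
    | succ i ih => rw [pow_succ, Matrix.mul_assoc, h, ← Matrix.mul_assoc, ih, pow_succ,
        Matrix.mul_assoc]
  have h1 := (NormedSpace.exp_series_hasSum_exp' (𝕂 := 𝕜) C).map
    (Matrix.addMonoidHomMulRight K) (continuous_id.matrix_mul continuous_const)
  have h2 := (NormedSpace.exp_series_hasSum_exp' (𝕂 := 𝕜) C').map
    (Matrix.addMonoidHomMulLeft K) (continuous_const.matrix_mul continuous_id)
  have e : (Matrix.addMonoidHomMulRight K ∘ fun i : ℕ => ((i.factorial : 𝕜)⁻¹ • C ^ i))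
      = Matrix.addMonoidHomMulLeft K ∘ fun i : ℕ => ((i.factorial : 𝕜)⁻¹ • C' ^ i) := by
    ext1 i
    simp [hpow]
  rw [e] at h1
  exact h1.unique h2

theorem exp_mulVec_eq_self {m : Type*} [Fintype m] [DecidableEq m] {Z : Matrix m m ℝ} {v : m → ℝ}
    (hv : Z *ᵥ v = 0) : NormedSpace.exp Z *ᵥ v = v := by
  have h : Z * Matrix.replicateCol Unit v
      = Matrix.replicateCol Unit v * (0 : Matrix Unit Unit ℝ) := by
    rw [← Matrix.replicateCol_mulVec, hv, Matrix.mul_zero]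
    rfl
  have h' := exp_mul_eq_mul_exp h
  rw [NormedSpace.exp_zero, Matrix.mul_one, ← Matrix.replicateCol_mulVec] at h'
  exact Matrix.replicateCol_injective h'

/-- The dilation interchanges `e_0` and `e_{d+1}`, so `Z * dilation p q = 0` forces `Z` to
annihilate both and `exp Z` to fix them. -/
theorem exp_mem_groupM {Z : Matrix _ _ ℝ} (hZ : IsSkew (metric p q) Z)
    (hD : Z * dilation p q = 0) : NormedSpace.exp Z ∈ groupM p q := by

  have h0 : Z *ᵥ stdVec p q 0 = 0 := by
    rw [← dilation_mulVec_last, Matrix.mulVec_mulVec, hD, Matrix.zero_mulVec]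
  have h1 : Z *ᵥ stdVec p q (p + q + 1) = 0 := by
    rw [← dilation_mulVec_zero, Matrix.mulVec_mulVec, hD, Matrix.zero_mulVec]
  exact ⟨exp_mem_groupG hZ, 1, Or.inl rfl, by rw [one_smul, exp_mulVec_eq_self h0],
    by rw [one_smul, exp_mulVec_eq_self h1]⟩

section Algebra

variable {𝔸 : Type*} [NormedRing 𝔸] [NormedAlgebra ℝ 𝔸] [CompleteSpace 𝔸] {f φ : 𝔸 → ℂ} {g x : 𝔸}

theorem deriv_exp_mul (hφ : DifferentiableAt ℝ φ g) (X : 𝔸)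
    (h : ∀ᶠ t : ℝ in 𝓝 0, f (NormedSpace.exp (t • X) * g) = φ (NormedSpace.exp (t • X) * g)) :
    deriv (fun t : ℝ => f (NormedSpace.exp (t • X) * g)) 0 = fderiv ℝ φ g (X * g) := by
  have h1 : HasDerivAt (fun t : ℝ => NormedSpace.exp (t • X) * g) (X * g) 0 := by
    simpa using (hasDerivAt_exp_smul_const (𝕂 := ℝ) X 0).mul_const g
  have h2 : HasFDerivAt φ (fderiv ℝ φ g) (NormedSpace.exp ((0 : ℝ) • X) * g) := by
    simpa using hφ.hasFDerivAt
  exact ((h2.comp_hasDerivAt (0 : ℝ) h1).congr_of_eventuallyEq h).deriv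

theorem deriv_mul_exp (hφ : DifferentiableAt ℝ φ g) (X : 𝔸)
    (h : ∀ᶠ t : ℝ in 𝓝 0, f (g * NormedSpace.exp (t • X)) = φ (g * NormedSpace.exp (t • X))) :
    deriv (fun t : ℝ => f (g * NormedSpace.exp (t • X))) 0 = fderiv ℝ φ g (g * X) := by
  have h1 : HasDerivAt (fun t : ℝ => g * NormedSpace.exp (t • X)) (g * X) 0 := by
    simpa using (hasDerivAt_exp_smul_const (𝕂 := ℝ) X 0).const_mul g
  have h2 : HasFDerivAt φ (fderiv ℝ φ g) (g * NormedSpace.exp ((0 : ℝ) • X)) := by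
    simpa using hφ.hasFDerivAt
  exact ((h2.comp_hasDerivAt (0 : ℝ) h1).congr_of_eventuallyEq h).deriv

/-- The product rule gives the Hessian and a second term, since the field `g ↦ X * g` varies with
`g`. The second term is the source of the commutator in `IsJet.comm`. -/
theorem hasDerivAt_fderiv_exp_mul (hφ : ContDiffAt ℝ ∞ φ x) (X Y : 𝔸) :
    HasDerivAt (fun t : ℝ => fderiv ℝ φ (NormedSpace.exp (t • Y) * x)
      (X * (NormedSpace.exp (t • Y) * x)))
      (fderiv ℝ (fderiv ℝ φ) x (Y * x) (X * x) + fderiv ℝ φ x (X * (Y * x))) 0 := by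
  have h1 : HasDerivAt (fun t : ℝ => NormedSpace.exp (t • Y) * x) (Y * x) 0 := by
    simpa using (hasDerivAt_exp_smul_const (𝕂 := ℝ) Y 0).mul_const x
  have h2 : HasFDerivAt (fderiv ℝ φ) (fderiv ℝ (fderiv ℝ φ) x)
      (NormedSpace.exp ((0 : ℝ) • Y) * x) := by
    simpa using
      ((hφ.fderiv_right (m := 1) (by norm_cast)).differentiableAt one_ne_zero).hasFDerivAt
  have h3 : HasDerivAt (fun t : ℝ => fderiv ℝ φ (NormedSpace.exp (t • Y) * x))
      (fderiv ℝ (fderiv ℝ φ) x (Y * x)) 0 := h2.comp_hasDerivAt (0 : ℝ) h1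
  have h4 := h3.clm_apply (h1.const_mul X)
  simp only [zero_smul, NormedSpace.exp_zero, one_mul] at h4
  exact h4

theorem hasDerivAt_fderiv_mul_exp (hφ : ContDiffAt ℝ ∞ φ x) (X Y : 𝔸) :
    HasDerivAt (fun t : ℝ => fderiv ℝ φ (x * NormedSpace.exp (t • X))
      (x * NormedSpace.exp (t • X) * Y))
      (fderiv ℝ (fderiv ℝ φ) x (x * X) (x * Y) + fderiv ℝ φ x (x * X * Y)) 0 := by
  have h1 : HasDerivAt (fun t : ℝ => x * NormedSpace.exp (t • X)) (x * X) 0 := by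
    simpa using (hasDerivAt_exp_smul_const (𝕂 := ℝ) X 0).const_mul x
  have h2 : HasFDerivAt (fderiv ℝ φ) (fderiv ℝ (fderiv ℝ φ) x)
      (x * NormedSpace.exp ((0 : ℝ) • X)) := by
    simpa using
      ((hφ.fderiv_right (m := 1) (by norm_cast)).differentiableAt one_ne_zero).hasFDerivAt
  have h3 : HasDerivAt (fun t : ℝ => fderiv ℝ φ (x * NormedSpace.exp (t • X)))
      (fderiv ℝ (fderiv ℝ φ) x (x * X)) 0 := h2.comp_hasDerivAt (0 : ℝ) h1
  have h4 := h3.clm_apply (h1.mul_const Y)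
  simp only [zero_smul, NormedSpace.exp_zero, mul_one] at h4
  exact h4

theorem tendsto_exp_mul (X x : 𝔸) :
    Tendsto (fun t : ℝ => NormedSpace.exp (t • X) * x) (𝓝 0) (𝓝 x) := by
  have h1 : HasDerivAt (fun t : ℝ => NormedSpace.exp (t • X) * x) (X * x) 0 := by
    simpa using (hasDerivAt_exp_smul_const (𝕂 := ℝ) X 0).mul_const x
  simpa using h1.continuousAt.tendsto

theorem tendsto_mul_exp (X x : 𝔸) :
    Tendsto (fun t : ℝ => x * NormedSpace.exp (t • X)) (𝓝 0) (𝓝 x) := by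
  have h1 : HasDerivAt (fun t : ℝ => x * NormedSpace.exp (t • X)) (x * X) 0 := by
    simpa using (hasDerivAt_exp_smul_const (𝕂 := ℝ) X 0).const_mul x
  simpa using h1.continuousAt.tendsto

omit [CompleteSpace 𝔸] in
theorem exists_jet_of_contDiffAt (hφ : ContDiffAt ℝ ∞ φ x) :
    ∃ (ℓ : 𝔸 →ₗ[ℝ] ℂ) (H : 𝔸 →ₗ[ℝ] 𝔸 →ₗ[ℝ] ℂ),
      (∀ X Y, H X Y = H Y X) ∧ (∀ X, ℓ X = fderiv ℝ φ x X) ∧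
      (∀ X Y, H X Y = fderiv ℝ (fderiv ℝ φ) x X Y) := by
  have hsymm : IsSymmSndFDerivAt ℝ φ x :=
    (hφ.of_le (m := 2) (by norm_cast)).isSymmSndFDerivAt (by simp)
  exact ⟨(fderiv ℝ φ x).toLinearMap,
    (ContinuousLinearMap.coeLM ℝ).comp (fderiv ℝ (fderiv ℝ φ) x).toLinearMap,
    fun X Y => hsymm X Y, fun _ => rfl, fun _ _ => rfl⟩

end Algebra

section

variable {x : Matrix (Fin (p + q + 2)) (Fin (p + q + 2)) ℝ}
  {f φ : Matrix (Fin (p + q + 2)) (Fin (p + q + 2)) ℝ → ℂ}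

theorem inv_mul_of_mem_tildeG (hx : x ∈ tildeG p q) : x⁻¹ * x = 1 := by
  rw [Matrix.inv_eq_left_inv (inv_eq_of_mem (groupG_subset hx.1)),
    inv_eq_of_mem (groupG_subset hx.1)]

theorem mul_inv_of_mem_tildeG (hx : x ∈ tildeG p q) : x * x⁻¹ = 1 :=
  mul_eq_one_comm.1 (inv_mul_of_mem_tildeG hx)

theorem eventually_mul_exp_mem {X : Matrix _ _ ℝ} (hx : x ∈ tildeG p q)
    (hX : IsSkew (metric p q) X) :
    ∀ᶠ t : ℝ in 𝓝 0, x * NormedSpace.exp (t • X) ∈ tildeG p q :=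
  ((tendsto_mul_exp X x).eventually (eventually_mem_tildeG hx)).mono fun t ht =>
    ht (mul_mem_groupG hx.1 (exp_mem_groupG (hX.smul t)))

/-- The formula is needed at all points of `G̃` near `x`, not only at `x`, because it is
differentiated once more. -/
theorem eventually_rightAct_eq (hφ : ContDiffAt ℝ ∞ φ x)
    (hfφ : ∀ᶠ g in 𝓝 x, g ∈ tildeG p q → f g = φ g) {X : Matrix _ _ ℝ}
    (hX : IsSkew (metric p q) X) :
    ∀ᶠ g in 𝓝 x, g ∈ tildeG p q → rightAct f X g = fderiv ℝ φ g (X * g) := by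
  have hd : ∀ᶠ g in 𝓝 x, ContDiffAt ℝ 1 φ g :=
    (hφ.of_le (m := 1) (by norm_cast)).eventually (by simp)
  filter_upwards [hd, hfφ.eventually_nhds] with g hg hev hgt
  refine deriv_exp_mul (hg.differentiableAt one_ne_zero) X ?_
  filter_upwards [(tendsto_exp_mul X g).eventually hev, eventually_exp_mul_mem hgt hX]
    with t ht ht'
  exact ht ht'

theorem eventually_leftAct_eq (hφ : ContDiffAt ℝ ∞ φ x)
    (hfφ : ∀ᶠ g in 𝓝 x, g ∈ tildeG p q → f g = φ g) {X : Matrix _ _ ℝ}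
    (hX : IsSkew (metric p q) X) :
    ∀ᶠ g in 𝓝 x, g ∈ tildeG p q → leftAct X f g = fderiv ℝ φ g (g * X) := by
  have hd : ∀ᶠ g in 𝓝 x, ContDiffAt ℝ 1 φ g :=
    (hφ.of_le (m := 1) (by norm_cast)).eventually (by simp)
  filter_upwards [hd, hfφ.eventually_nhds] with g hg hev hgt
  refine deriv_mul_exp (hg.differentiableAt one_ne_zero) X ?_
  filter_upwards [(tendsto_mul_exp X g).eventually hev, eventually_mul_exp_mem hgt hX]
    with t ht ht'
  exact ht ht'

theorem IsSkew.conj {X : Matrix _ _ ℝ} (hX : IsSkew (metric p q) X) (hx : x ∈ tildeG p q) :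
    IsSkew (metric p q) (x * X * x⁻¹) := by
  have h1 := (groupG_subset hx.1).1
  have h2 := mul_inv_of_mem_tildeG hx
  have h3 : (x⁻¹)ᵀ * xᵀ = 1 := by rw [← Matrix.transpose_mul, h2, Matrix.transpose_one]
  rw [IsSkew]
  calc (x * X * x⁻¹)ᵀ * metric p q + metric p q * (x * X * x⁻¹)
      = (x⁻¹)ᵀ * (Xᵀ * xᵀ * metric p q) * (x * x⁻¹)
        + ((x⁻¹)ᵀ * xᵀ) * metric p q * (x * X * x⁻¹) := by
        rw [h2, h3, Matrix.transpose_mul, Matrix.transpose_mul, mul_one, one_mul]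
        simp only [Matrix.mul_assoc]
    _ = (x⁻¹)ᵀ * (Xᵀ * (xᵀ * metric p q * x) + (xᵀ * metric p q * x) * X) * x⁻¹ := by
        simp only [mul_add, add_mul, Matrix.mul_assoc]
    _ = 0 := by rw [h1, show Xᵀ * metric p q + metric p q * X = 0 from hX]; simp

/-- Left and right transformation behaviour under one-parameter groups, at the level of jets. -/
theorem exists_jet {hf : ContDiffOn ℝ ∞ f (tildeG p q)} (hx : x ∈ tildeG p q) :
    ∃ (D₁ : Matrix (Fin (p + q + 2)) (Fin (p + q + 2)) ℂ →ₗ[ℂ] ℂ)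
      (D₂ : Matrix (Fin (p + q + 2)) (Fin (p + q + 2)) ℂ →ₗ[ℂ]
        Matrix (Fin (p + q + 2)) (Fin (p + q + 2)) ℂ →ₗ[ℂ] ℂ),
      (∀ A B, D₂ A B - D₂ B A = D₁ (A * B - B * A)) ∧
      (∀ X, IsSkew (metric p q) X → rightAct f X x = D₁ (cx X)) ∧
      (∀ X Y, IsSkew (metric p q) X → IsSkew (metric p q) Y →
        HasDerivAt (fun t : ℝ => rightAct f X (NormedSpace.exp (t • Y) * x))
          (D₂ (cx X) (cx Y)) 0) ∧
      (∀ X Y, IsSkew (metric p q) X → IsSkew (metric p q) Y →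
        leftAct X (leftAct Y f) x = D₂ (cx (x * X * x⁻¹)) (cx (x * Y * x⁻¹))) := by
  obtain ⟨φ, hφ, hfφ⟩ := exists_smooth_extension hf hx
  have hxi := inv_mul_of_mem_tildeG hx
  obtain ⟨ℓ₀, H₀, hs, hℓ₀, hH₀⟩ := exists_jet_of_contDiffAt hφ
  obtain ⟨T, hT⟩ := exists_complexify (n := Fin (p + q + 2)) (V := ℂ)
  obtain ⟨H, hH, hHs⟩ := exists_complexify₂ H₀ hs
  let R : Matrix (Fin (p + q + 2)) (Fin (p + q + 2)) ℂ →ₗ[ℂ] _ := LinearMap.mulRight ℂ (cx x)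
  let D₁ := T ℓ₀ ∘ₗ R
  -- The Hessian is symmetric, so the antisymmetric part of `D₂` comes entirely from the added term
  -- `D₁ (A * B)`.
  let D₂ := H.compl₁₂ R R + (LinearMap.mul ℂ _).compr₂ D₁
  have hD₁ : ∀ A, D₁ A = T ℓ₀ (A * cx x) := fun _ => rfl
  have hD₂ : ∀ A B, D₂ A B = H (A * cx x) (B * cx x) + T ℓ₀ (A * B * cx x) := fun _ _ => rfl
  have hD₁r : ∀ X, D₁ (cx X) = fderiv ℝ φ x (X * x) := by
    intro X; rw [hD₁, ← cx_mul, hT, hℓ₀]; rfl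
  have hD₂r : ∀ X Y, D₂ (cx X) (cx Y)
      = fderiv ℝ (fderiv ℝ φ) x (Y * x) (X * x) + fderiv ℝ φ x (X * (Y * x)) := by
    intro X Y
    rw [hD₂, ← cx_mul, ← cx_mul, ← cx_mul, ← cx_mul, hT, hH, hℓ₀, hs, hH₀, Matrix.mul_assoc]
    rfl
  refine ⟨D₁, D₂, ?_, ?_, ?_, ?_⟩
  · intro A B
    rw [hD₂, hD₂, hD₁, hHs, sub_mul, map_sub]; ring
  · intro X hX
    rw [hD₁r]
    exact (eventually_rightAct_eq hφ hfφ hX).self_of_nhds hx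
  · intro X Y hX hY
    rw [hD₂r]
    refine (hasDerivAt_fderiv_exp_mul hφ X Y).congr_of_eventuallyEq ?_
    filter_upwards [(tendsto_exp_mul Y x).eventually (eventually_rightAct_eq hφ hfφ hX),
      eventually_exp_mul_mem hx hY] with t h1 h2
    exact h1 h2
  · intro X Y hX hY
    rw [hD₂r]
    have e1 : ∀ Z, x * Z * x⁻¹ * x = x * Z := fun Z => by rw [Matrix.mul_assoc, hxi, mul_one]
    have e2 : x * X * x⁻¹ * (x * Y) = x * X * Y := by
      rw [← Matrix.mul_assoc, e1]
    rw [e1, e1, e2]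
    have h := (hasDerivAt_fderiv_mul_exp hφ X Y).congr_of_eventuallyEq
      (f₁ := fun t : ℝ => leftAct Y f (x * NormedSpace.exp (t • X))) (by
        filter_upwards [(tendsto_mul_exp X x).eventually (eventually_leftAct_eq hφ hfφ hY),
          eventually_mul_exp_mem hx hX] with t h1 h2
        exact h1 h2)
    rw [show leftAct X (leftAct Y f) x = _ from h.deriv, ← hH₀, hs, hH₀]
    rfl

end

end Jet

end ConformalCasimir

namespace ConformalCasimir

open Matrix Filter Topology

/-! ### Equivariance under `H` expressed on jets. -/

section Characters

attribute [local instance] Matrix.linftyOpNormedRing Matrix.linftyOpNormedAlgebra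

variable {p q : ℕ} {x : Matrix (Fin (p + q + 2)) (Fin (p + q + 2)) ℝ}
  {f : Matrix (Fin (p + q + 2)) (Fin (p + q + 2)) ℝ → ℂ}

theorem hasDerivAt_cexp_mul (c : ℂ) (a : ℂ) :
    HasDerivAt (fun s : ℝ => Complex.exp (c * s) * a) (c * a) 0 := by
  have h1 : HasDerivAt (fun s : ℝ => c * (s : ℂ)) c 0 := by
    simpa using (Complex.ofRealCLM.hasDerivAt (x := (0 : ℝ))).const_mul c
  simpa using h1.cexp.mul_const a

/-- Left equivariance makes `f` an eigenfunction of `Z` on all of `G̃`, and this identity can be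
differentiated along `Y`. The known field is therefore the one applied first: the first slot of
`D₂`. -/
theorem left_character {D₁ : Matrix (Fin (p + q + 2)) (Fin (p + q + 2)) ℂ →ₗ[ℂ] ℂ}
    {D₂ : Matrix (Fin (p + q + 2)) (Fin (p + q + 2)) ℂ →ₗ[ℂ]
      Matrix (Fin (p + q + 2)) (Fin (p + q + 2)) ℂ →ₗ[ℂ] ℂ}
    (h1 : ∀ X, IsSkew (metric p q) X → rightAct f X x = D₁ (cx X))
    (h2 : ∀ X Y, IsSkew (metric p q) X → IsSkew (metric p q) Y →
        HasDerivAt (fun t : ℝ => rightAct f X (NormedSpace.exp (t • Y) * x))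
          (D₂ (cx X) (cx Y)) 0) (hx : x ∈ tildeG p q)
    {Z : Matrix _ _ ℝ} {c : ℂ} (hZ : IsSkew (metric p q) Z)
    (hc : ∀ g ∈ tildeG p q, ∀ s : ℝ,
      f (NormedSpace.exp (s • Z) * g) = Complex.exp (c * s) * f g) :
    D₁ (cx Z) = c * f x ∧
      ∀ Y, IsSkew (metric p q) Y → D₂ (cx Z) (cx Y) = c * D₁ (cx Y) := by
  have key : ∀ g ∈ tildeG p q, rightAct f Z g = c * f g := by
    intro g hg
    rw [rightAct, funext (hc g hg)]
    exact (hasDerivAt_cexp_mul c (f g)).deriv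
  refine ⟨by rw [← h1 Z hZ, key x hx], fun Y hY => ?_⟩
  rw [← (h2 Z Y hZ hY).deriv, ← h1 Y hY, rightAct, ← deriv_const_mul_field]
  apply Filter.EventuallyEq.deriv_eq
  filter_upwards [eventually_exp_mul_mem hx hY] with t ht
  exact key _ ht

theorem exp_smul_conj_mul (hx : x ∈ tildeG p q) (Z : Matrix _ _ ℝ) (t : ℝ) :
    NormedSpace.exp (t • (x * Z * x⁻¹)) * x = x * NormedSpace.exp (t • Z) := by
  apply exp_mul_eq_mul_exp
  rw [Matrix.smul_mul, Matrix.mul_assoc, inv_mul_of_mem_tildeG hx, mul_one, Matrix.mul_smul]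

/-- Moving from `x` along the conjugate of `Z` is right translation by `exp (t • Z)`, which commutes
with the action of `Y`. The known field is therefore the one applied last: the second slot of `D₂`.
-/
theorem right_character {D₁ : Matrix (Fin (p + q + 2)) (Fin (p + q + 2)) ℂ →ₗ[ℂ] ℂ}
    {D₂ : Matrix (Fin (p + q + 2)) (Fin (p + q + 2)) ℂ →ₗ[ℂ]
      Matrix (Fin (p + q + 2)) (Fin (p + q + 2)) ℂ →ₗ[ℂ] ℂ}
    (h1 : ∀ X, IsSkew (metric p q) X → rightAct f X x = D₁ (cx X))
    (h2 : ∀ X Y, IsSkew (metric p q) X → IsSkew (metric p q) Y →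
        HasDerivAt (fun t : ℝ => rightAct f X (NormedSpace.exp (t • Y) * x))
          (D₂ (cx X) (cx Y)) 0) (hx : x ∈ tildeG p q)
    {Z : Matrix _ _ ℝ} {c : ℂ} (hZ : IsSkew (metric p q) Z)
    (hc : ∀ g ∈ tildeG p q, ∀ s : ℝ,
      f (g * NormedSpace.exp (s • Z)) = Complex.exp (c * s) * f g) :
    D₁ (cx (x * Z * x⁻¹)) = c * f x ∧
      ∀ Y, IsSkew (metric p q) Y → D₂ (cx Y) (cx (x * Z * x⁻¹)) = c * D₁ (cx Y) := by
  have hZ' := hZ.conj hx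
  refine ⟨?_, fun Y hY => ?_⟩
  · rw [← h1 _ hZ', rightAct]
    simp only [exp_smul_conj_mul hx]
    rw [funext (hc x hx)]
    exact (hasDerivAt_cexp_mul c (f x)).deriv
  · rw [← (h2 Y _ hY hZ').deriv, ← h1 Y hY]
    simp only [exp_smul_conj_mul hx]
    have key : ∀ t : ℝ, rightAct f Y (x * NormedSpace.exp (t • Z))
        = Complex.exp (c * t) * rightAct f Y x := by
      intro t
      rw [rightAct, rightAct, ← deriv_const_mul_field]
      apply Filter.EventuallyEq.deriv_eq
      filter_upwards [eventually_exp_mul_mem hx hY] with s hs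
      rw [← hc _ hs, Matrix.mul_assoc]
    rw [funext key]
    exact (hasDerivAt_cexp_mul c _).deriv

theorem exists_isJet {α β : ℂ} (hf : IsSpherical p q α β f) (hx : x ∈ tildeG p q) :
    ∃ D₁ D₂, IsJet p q α β f x D₁ D₂ := by
  obtain ⟨D₁, D₂, hcomm, h1, h2, h3⟩ := exists_jet (hf := hf.1) hx
  -- Invariance under `M` is the character `c = 0`. Complex `Z` are handled below through their real
  -- and imaginary parts, which again are skew and annihilate the same plane.
  have hml : ∀ Z, IsSkew (metric p q) Z → Z * dilation p q = 0 → ∀ g ∈ tildeG p q, ∀ s : ℝ,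
      f (NormedSpace.exp (s • Z) * g) = Complex.exp (0 * s) * f g := by
    intro Z hZ hD g hg s
    have := hf.2 g hg _ (exp_mem_groupM (hZ.smul s) (by rw [Matrix.smul_mul, hD, smul_zero]))
      1 one_mem_groupM 0 0
    simpa using this
  have hmr : ∀ Z, IsSkew (metric p q) Z → Z * dilation p q = 0 → ∀ g ∈ tildeG p q, ∀ s : ℝ,
      f (g * NormedSpace.exp (s • Z)) = Complex.exp (0 * s) * f g := by
    intro Z hZ hD g hg s
    have := hf.2 g hg 1 one_mem_groupM
      _ (exp_mem_groupM (hZ.smul s) (by rw [Matrix.smul_mul, hD, smul_zero])) 0 0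
    simpa using this
  have hal : ∀ g ∈ tildeG p q, ∀ s : ℝ,
      f (NormedSpace.exp (s • dilation p q) * g) = Complex.exp (α * s) * f g := by
    intro g hg s
    simpa using hf.2 g hg 1 one_mem_groupM 1 one_mem_groupM s 0
  have har : ∀ g ∈ tildeG p q, ∀ s : ℝ,
      f (g * NormedSpace.exp (s • dilation p q)) = Complex.exp (β * s) * f g := by
    intro g hg s
    have := hf.2 g hg 1 one_mem_groupM 1 one_mem_groupM 0 s
    rw [mul_comm (Complex.exp _)]
    simpa using this
  have hcx : ∀ Z, cx x * cx Z * cx x⁻¹ = cx (x * Z * x⁻¹) := by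
    intro Z; rw [cx_mul, cx_mul]
  refine ⟨D₁, D₂, hcomm, h1, h2, ?_, ?_, ?_, ?_, ?_⟩
  · intro X Y hX hY
    rw [hcx, hcx]; exact h3 X Y hX hY
  · intro Z hZ hD
    obtain ⟨hZ1, hZ2⟩ := hZ.re_im
    obtain ⟨hD1, hD2⟩ := mul_cx_eq_zero_re_im hD
    have k1 := left_character h1 h2 hx hZ1 (hml _ hZ1 hD1)
    have k2 := left_character h1 h2 hx hZ2 (hml _ hZ2 hD2)
    rw [← cx_re_add_cx_im Z]
    refine ⟨by rw [map_add, map_smul, k1.1, k2.1]; simp, fun Y hY => ?_⟩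
    obtain ⟨hY1, hY2⟩ := hY.re_im
    rw [← cx_re_add_cx_im Y]
    simp only [map_add, map_smul, LinearMap.add_apply, LinearMap.smul_apply, k1.2 _ hY1,
      k1.2 _ hY2, k2.2 _ hY1, k2.2 _ hY2]
    simp
  · intro Z hZ hD
    obtain ⟨hZ1, hZ2⟩ := hZ.re_im
    obtain ⟨hD1, hD2⟩ := mul_cx_eq_zero_re_im hD
    have k1 := right_character h1 h2 hx hZ1 (hmr _ hZ1 hD1)
    have k2 := right_character h1 h2 hx hZ2 (hmr _ hZ2 hD2)
    rw [← cx_re_add_cx_im Z, mul_add, add_mul, Matrix.mul_smul, Matrix.smul_mul, hcx, hcx]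
    refine ⟨by rw [map_add, map_smul, k1.1, k2.1]; simp, fun Y hY => ?_⟩
    obtain ⟨hY1, hY2⟩ := hY.re_im
    rw [← cx_re_add_cx_im Y]
    simp only [map_add, map_smul, LinearMap.add_apply, LinearMap.smul_apply, k1.2 _ hY1,
      k1.2 _ hY2, k2.2 _ hY1, k2.2 _ hY2]
    simp
  · have k := left_character h1 h2 hx isSkew_dilation hal
    refine ⟨k.1, fun Y hY => ?_⟩
    obtain ⟨hY1, hY2⟩ := hY.re_im
    rw [← cx_re_add_cx_im Y]
    simp only [map_add, map_smul, k.2 _ hY1, k.2 _ hY2, smul_eq_mul]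
    ring
  · have k := right_character h1 h2 hx isSkew_dilation har
    rw [hcx]
    refine ⟨k.1, fun Y hY => ?_⟩
    obtain ⟨hY1, hY2⟩ := hY.re_im
    rw [← cx_re_add_cx_im Y]
    simp only [map_add, map_smul, LinearMap.add_apply, LinearMap.smul_apply, k.2 _ hY1, k.2 _ hY2,
      smul_eq_mul]
    ring

end Characters

end ConformalCasimir

namespace ConformalCasimir

open Matrix

/-! ### Bivectors and the basis-independent Casimir tensor. -/

section Tensor

variable {n : Type*} [Fintype n] [DecidableEq n]

/-- A bilinear form evaluated on a tensor given by its matrix of coefficients. -/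
noncomputable def tensorEval (B : (n → ℂ) →ₗ[ℂ] (n → ℂ) →ₗ[ℂ] ℂ) : Matrix n n ℂ →ₗ[ℂ] ℂ where
  toFun M := ∑ i, ∑ j, M i j * B (Pi.single i 1) (Pi.single j 1)
  map_add' M N := by simp [add_mul, Finset.sum_add_distrib]
  map_smul' c M := by simp [Finset.mul_sum, mul_assoc]

theorem tensorEval_vecMulVec (B : (n → ℂ) →ₗ[ℂ] (n → ℂ) →ₗ[ℂ] ℂ) (v w : n → ℂ) :
    tensorEval B (vecMulVec v w) = B v w := by
  conv_rhs => rw [pi_eq_sum_univ' v, pi_eq_sum_univ' w]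
  simp only [tensorEval, vecMulVec_apply, Finset.mul_sum, mul_assoc, LinearMap.coe_mk,
    AddHom.coe_mk, map_sum, map_smul, LinearMap.sum_apply, LinearMap.smul_apply, smul_eq_mul]
  rw [Finset.sum_comm]
  exact Finset.sum_congr rfl fun _ _ => Finset.sum_congr rfl fun _ _ => by ring

theorem tensorEval_diagonal (B : (n → ℂ) →ₗ[ℂ] (n → ℂ) →ₗ[ℂ] ℂ) (c : n → ℂ) :
    tensorEval B (diagonal c) = ∑ i, c i * B (Pi.single i 1) (Pi.single i 1) := by
  simp [tensorEval, diagonal_apply]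

/-- `(v, w) ↦ (v wᵀ - w vᵀ) S`. -/
noncomputable def wedge (S : Matrix n n ℂ) : (n → ℂ) →ₗ[ℂ] (n → ℂ) →ₗ[ℂ] Matrix n n ℂ :=
  LinearMap.mk₂ ℂ (fun v w => (vecMulVec v w - vecMulVec w v) * S)
    (fun v v' w => by simp only [add_vecMulVec, vecMulVec_add]; noncomm_ring)
    (fun c v w => by simp only [smul_vecMulVec, vecMulVec_smul, ← smul_sub, Matrix.smul_mul])
    (fun v w w' => by simp only [add_vecMulVec, vecMulVec_add]; noncomm_ring)
    (fun c v w => by simp only [smul_vecMulVec, vecMulVec_smul, ← smul_sub, Matrix.smul_mul])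

theorem wedge_apply (S : Matrix n n ℂ) (v w : n → ℂ) :
    wedge S v w = (vecMulVec v w - vecMulVec w v) * S := rfl

theorem wedge_swap (S : Matrix n n ℂ) (v w : n → ℂ) : wedge S w v = -wedge S v w := by
  rw [wedge_apply, wedge_apply, ← neg_mul, neg_sub]

theorem isSkew_wedge {S : Matrix n n ℂ} (hS : Sᵀ = S) (v w : n → ℂ) : IsSkew S (wedge S v w) := by
  rw [IsSkew, wedge_apply, transpose_mul, transpose_sub, transpose_vecMulVec, transpose_vecMulVec,
    hS]
  noncomm_ring

/-- Skewness moves `A` through `S` onto the vector on the other side. With `A` the dilation, the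
wedge of two vectors of its kernel lies in the complexification of `𝔪`. -/
theorem wedge_mul_eq_zero {S A : Matrix n n ℂ} (hA : IsSkew S A) {v w : n → ℂ}
    (hv : A *ᵥ v = 0) (hw : A *ᵥ w = 0) : wedge S v w * A = 0 := by
  have h : ∀ v, A *ᵥ v = 0 → v ᵥ* (S * A) = 0 := by
    intro v hv
    have h1 : S * A = -(Aᵀ * S) := by rw [hA.transpose_mul, neg_neg]
    rw [h1, vecMul_neg, ← vecMul_vecMul, vecMul_transpose, hv, zero_vecMul, neg_zero]
  rw [wedge_apply, Matrix.mul_assoc, sub_mul, vecMulVec_mul, vecMulVec_mul, h v hv, h w hw]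
  simp

/-- Of the pairings in the two products, orthogonality leaves only `u` with `u` and `v` with `w`;
the latter cancels by symmetry. For `u` a complementary coordinate vector and `v`, `w` in the model,
the commutator falls back into `so(4)`. -/
theorem wedge_commutator {S : Matrix n n ℂ} (hS : Sᵀ = S) {u v w : n → ℂ}
    (hv : u ⬝ᵥ (S *ᵥ v) = 0) (hw : u ⬝ᵥ (S *ᵥ w) = 0) :
    wedge S u v * wedge S u w - wedge S u w * wedge S u v
      = -(u ⬝ᵥ (S *ᵥ u)) • wedge S v w := by
  have key : ∀ a b c d : n → ℂ, vecMulVec a b * S * (vecMulVec c d * S)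
      = (b ⬝ᵥ (S *ᵥ c)) • (vecMulVec a d * S) := by
    intro a b c d
    rw [Matrix.mul_assoc, ← Matrix.mul_assoc S, ← Matrix.mul_assoc, mul_vecMulVec,
      vecMulVec_mul_vecMulVec, vecMulVec_smul, Matrix.smul_mul]
  have hv' : v ⬝ᵥ (S *ᵥ u) = 0 := by
    rw [dotProduct_mulVec, ← mulVec_transpose, hS, dotProduct_comm]; exact hv
  have hw' : w ⬝ᵥ (S *ᵥ u) = 0 := by
    rw [dotProduct_mulVec, ← mulVec_transpose, hS, dotProduct_comm]; exact hw
  have hvw : w ⬝ᵥ (S *ᵥ v) = v ⬝ᵥ (S *ᵥ w) := by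
    rw [dotProduct_mulVec, ← mulVec_transpose, hS, dotProduct_comm]
  simp only [wedge_apply, sub_mul, mul_sub, key, hv, hw, hv', hw', hvw, zero_smul, smul_sub]
  simp only [neg_smul]
  abel

theorem conj_wedge {S g gi : Matrix n n ℂ} (hg : gᵀ * S * g = S) (hgi : g * gi = 1)
    (v w : n → ℂ) : g * wedge S v w * gi = wedge S (g *ᵥ v) (g *ᵥ w) := by
  have h : S * gi = gᵀ * S := by
    calc S * gi = gᵀ * S * (g * gi) := by rw [← Matrix.mul_assoc, hg]
      _ = _ := by rw [hgi, mul_one]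
  simp only [wedge_apply]
  rw [Matrix.mul_assoc, Matrix.mul_assoc, h, ← Matrix.mul_assoc _ gᵀ, ← Matrix.mul_assoc g,
    sub_mul, mul_sub, ← vecMul_transpose, ← vecMul_transpose, vecMulVec_mul, vecMulVec_mul,
    mul_vecMulVec, mul_vecMulVec, vecMul_transpose, vecMul_transpose]

/-- The Casimir tensor `∑ᵢⱼ ηᵢ ηⱼ Fᵢⱼ ⊗ Fᵢⱼ`. -/
noncomputable def casimirTensor (S : Matrix n n ℂ)
    (D : Matrix n n ℂ →ₗ[ℂ] Matrix n n ℂ →ₗ[ℂ] ℂ) : ℂ :=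
  ∑ i, ∑ j, S i i * S j j * D (wedge S (Pi.single i 1) (Pi.single j 1))
    (wedge S (Pi.single i 1) (Pi.single j 1))

/-- The bilinear form `(v, v') ↦ D (v ∧ y) (v' ∧ y')`. -/
noncomputable def wedgeForm (S : Matrix n n ℂ) (D : Matrix n n ℂ →ₗ[ℂ] Matrix n n ℂ →ₗ[ℂ] ℂ)
    (y y' : n → ℂ) : (n → ℂ) →ₗ[ℂ] (n → ℂ) →ₗ[ℂ] ℂ :=
  D.compl₁₂ ((wedge S).flip y) ((wedge S).flip y')

theorem wedgeForm_apply (S : Matrix n n ℂ) (D : Matrix n n ℂ →ₗ[ℂ] Matrix n n ℂ →ₗ[ℂ] ℂ)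
    (y y' v v' : n → ℂ) : wedgeForm S D y y' v v' = D (wedge S v y) (wedge S v' y') := rfl

theorem wedgeForm_swap (S : Matrix n n ℂ) (D : Matrix n n ℂ →ₗ[ℂ] Matrix n n ℂ →ₗ[ℂ] ℂ)
    (y y' v v' : n → ℂ) : wedgeForm S D y y' v v' = wedgeForm S D v v' y y' := by
  simp only [wedgeForm_apply]
  rw [wedge_swap S y v, wedge_swap S y' v']
  simp

/-- The Casimir tensor can be computed from any decomposition of the inverse form. -/
theorem casimirTensor_eq {ι : Type*} [Fintype ι] {S : Matrix n n ℂ} (hd : S = diagonal (diag S))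
    (D : Matrix n n ℂ →ₗ[ℂ] Matrix n n ℂ →ₗ[ℂ] ℂ) {c : ι → ℂ} {v w : ι → n → ℂ}
    (h : S = ∑ a, c a • vecMulVec (v a) (w a)) :
    casimirTensor S D = ∑ a, ∑ b, c a * c b * D (wedge S (v a) (v b)) (wedge S (w a) (w b)) := by
  -- A bilinear form contracted with the tensor `S` does not depend on how `S` is written. The
  -- calculation below applies this once to each leg of the wedge.
  have key : ∀ B : (n → ℂ) →ₗ[ℂ] (n → ℂ) →ₗ[ℂ] ℂ,
      ∑ i, S i i * B (Pi.single i 1) (Pi.single i 1) = ∑ a, c a * B (v a) (w a) := by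
    intro B
    have h1 := tensorEval_diagonal B (diag S)
    rw [← hd] at h1
    have h2 : tensorEval B S = ∑ a, c a * B (v a) (w a) := by
      conv_lhs => rw [h]
      simp [tensorEval_vecMulVec]
    rw [← h2, h1]; rfl
  calc casimirTensor S D
      = ∑ j, S j j * ∑ i, S i i * wedgeForm S D (Pi.single j 1) (Pi.single j 1)
          (Pi.single i 1) (Pi.single i 1) := by
        rw [casimirTensor, Finset.sum_comm]
        simp only [Finset.mul_sum, wedgeForm_apply]
        exact Finset.sum_congr rfl fun _ _ => Finset.sum_congr rfl fun _ _ => by ring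
    _ = ∑ j, S j j * ∑ a, c a * wedgeForm S D (Pi.single j 1) (Pi.single j 1) (v a) (w a) := by
        simp only [key]
    _ = ∑ a, c a * ∑ j, S j j * wedgeForm S D (v a) (w a) (Pi.single j 1) (Pi.single j 1) := by
        simp only [Finset.mul_sum]
        rw [Finset.sum_comm]
        exact Finset.sum_congr rfl fun _ _ => Finset.sum_congr rfl fun _ _ => by
          rw [wedgeForm_swap]; ring
    _ = ∑ a, c a * ∑ b, c b * wedgeForm S D (v a) (w a) (v b) (w b) := by simp only [key]
    _ = _ := by
        simp only [Finset.mul_sum]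
        exact Finset.sum_congr rfl fun _ _ => Finset.sum_congr rfl fun _ _ => by
          rw [wedgeForm_swap, wedgeForm_apply]; ring

/-- The Casimir tensor is invariant under the orthogonal group. -/
theorem casimirTensor_conj {S g gi : Matrix n n ℂ} (hd : S = diagonal (diag S))
    (hg : gᵀ * S * g = S) (hg' : g * S * gᵀ = S) (hgi : g * gi = 1)
    (D D' : Matrix n n ℂ →ₗ[ℂ] Matrix n n ℂ →ₗ[ℂ] ℂ)
    (hD : ∀ A B, D' A B = D (g * A * gi) (g * B * gi)) :
    casimirTensor S D' = casimirTensor S D := by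
  -- Since `g * S * gᵀ = S`, the vectors `g e_i` decompose `S` as well as the `e_i` do, and wedges
  -- of the former are conjugates of wedges of the latter.
  have h : S = ∑ i, S i i • vecMulVec (g *ᵥ Pi.single i 1) (g *ᵥ Pi.single i 1) := by
    have h1 : ∀ i, vecMulVec (g *ᵥ Pi.single i 1) (g *ᵥ Pi.single i 1)
        = g * vecMulVec (Pi.single i 1) (Pi.single i 1) * gᵀ := by
      intro i; rw [mul_vecMulVec, vecMulVec_mul, vecMul_transpose]
    have h2 : ∑ i, S i i • vecMulVec (Pi.single i (1 : ℂ)) (Pi.single i 1) = S := by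
      conv_rhs => rw [hd]
      ext a b
      simp [Matrix.sum_apply, vecMulVec_apply, diagonal_apply, Pi.single_apply, eq_comm]
      split_ifs with hab
      · rw [hab]
      · rfl
    calc S = g * (∑ i, S i i • vecMulVec (Pi.single i (1 : ℂ)) (Pi.single i 1)) * gᵀ := by
          rw [h2, hg']
      _ = _ := by
          rw [Finset.mul_sum, Finset.sum_mul]
          exact Finset.sum_congr rfl fun i _ => by rw [h1, Matrix.mul_smul, Matrix.smul_mul]
  rw [casimirTensor_eq hd D h, casimirTensor]
  simp only [hD, conj_wedge hg hgi]

end Tensor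

end ConformalCasimir

namespace ConformalCasimir

open Matrix

section StandardModel

/-! ### The standard model of `so(4, ℂ) = sl(2, ℂ) ⊕ sl(2, ℂ)` on `ℂ² ⊗ ℂ²` -/

/-- The invariant form on `ℂ² ⊗ ℂ²`. -/
def stdJ : Matrix (Fin 4) (Fin 4) ℂ := !![0, 0, 0, 1; 0, 0, -1, 0; 0, -1, 0, 0; 1, 0, 0, 0]

/-- Half the Cartan elements. -/
noncomputable def stdH : Fin 2 → Matrix (Fin 4) (Fin 4) ℂ :=
  ![!![1 / 2, 0, 0, 0; 0, 1 / 2, 0, 0; 0, 0, -(1 / 2), 0; 0, 0, 0, -(1 / 2)],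
    !![1 / 2, 0, 0, 0; 0, -(1 / 2), 0, 0; 0, 0, 1 / 2, 0; 0, 0, 0, -(1 / 2)]]

/-- The components of the dilation in the two factors, rotated by the Cartan subgroup:
`y = 1` gives the dilation itself. -/
noncomputable def stdR : Fin 2 → ℂ → Matrix (Fin 4) (Fin 4) ℂ :=
  ![fun y => !![0, 0, y / 2, 0; 0, 0, 0, y / 2; y⁻¹ / 2, 0, 0, 0; 0, y⁻¹ / 2, 0, 0],
    fun y => !![0, y / 2, 0, 0; y⁻¹ / 2, 0, 0, 0; 0, 0, 0, y / 2; 0, 0, y⁻¹ / 2, 0]]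

/-- The third basis vector of each factor. -/
noncomputable def stdT' : Fin 2 → Matrix (Fin 4) (Fin 4) ℂ :=
  ![!![0, 0, 1 / 2, 0; 0, 0, 0, 1 / 2; -(1 / 2), 0, 0, 0; 0, -(1 / 2), 0, 0],
    !![0, 1 / 2, 0, 0; -(1 / 2), 0, 0, 0; 0, 0, 0, 1 / 2; 0, 0, -(1 / 2), 0]]

theorem stdR_eq (i : Fin 2) (y : ℂ) :
    stdR i y = ((y + y⁻¹) / 2) • stdR i 1 + ((y - y⁻¹) / 2) • stdT' i := by
  fin_cases i <;> ext a b <;> fin_cases a <;> fin_cases b <;>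
    simp [stdR, stdT'] <;> ring

theorem stdR_commutator (i : Fin 2) (y : ℂ) :
    stdR i y * stdR i 1 - stdR i 1 * stdR i y = ((y - y⁻¹) / 2) • stdH i := by
  fin_cases i <;> ext a b <;> fin_cases a <;> fin_cases b <;>
    simp [stdR, stdH] <;> ring

/-- The projection onto the kernel of `stdR 0 (-y₀) + stdR 1 (-y₁)` along the kernel of
`stdR 0 1 + stdR 1 1`. -/
noncomputable def stdP (y : Fin 2 → ℂ) : Matrix (Fin 4) (Fin 4) ℂ :=
  !![y 0 * y 1 / (y 0 * y 1 - 1), 0, 0, y 0 * y 1 / (y 0 * y 1 - 1);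
    0, y 0 / (y 0 - y 1), y 0 / (y 0 - y 1), 0;
    0, -y 1 / (y 0 - y 1), -y 1 / (y 0 - y 1), 0;
    -1 / (y 0 * y 1 - 1), 0, 0, -1 / (y 0 * y 1 - 1)]

variable {y : Fin 2 → ℂ}

/-- Together with `stdP_right` this splits a vector into a part killed by the dilation and a part
killed by the rotated dilation. For nonzero `y` the denominators of `stdP` vanish exactly when the
two kernels meet. -/
theorem stdP_left (hp : y 0 * y 1 ≠ 1) (hm : y 0 ≠ y 1) :
    (stdR 0 1 + stdR 1 1) * (1 - stdP y) = 0 := by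
  have h1 := sub_ne_zero.2 hp
  have h2 := sub_ne_zero.2 hm
  ext a b
  fin_cases a <;> fin_cases b <;>
    simp [stdR, stdP, Matrix.mul_apply, Fin.sum_univ_four] <;> field_simp <;> ring

theorem stdP_right (hy : ∀ i, y i ≠ 0) :
    (stdR 0 (-y 0) + stdR 1 (-y 1)) * stdP y = 0 := by
  have h3 := hy 0
  have h4 := hy 1
  ext a b
  fin_cases a <;> fin_cases b <;>
    simp [stdR, stdP, Matrix.mul_apply, Fin.sum_univ_four] <;> field_simp <;> ring

/-- `coth` of half the sum, resp. difference, of the logarithms. -/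
noncomputable def cothPlus (y : Fin 2 → ℂ) : ℂ := (y 0 * y 1 + 1) / (y 0 * y 1 - 1)

/-- See `cothPlus`. -/
noncomputable def cothMinus (y : Fin 2 → ℂ) : ℂ := (y 0 + y 1) / (y 0 - y 1)

/-- The difference of `stdP` and its adjoint for `J` lies in the Cartan subalgebra. This is where
the coefficients of the roots `ε_1 ± ε_2` come from. -/
theorem stdP_sub_adjoint :
    stdP y - stdJ * (stdP y)ᵀ * stdJ
      = cothPlus y • (stdH 0 + stdH 1) + cothMinus y • (stdH 0 - stdH 1) := by
  ext a b
  simp only [Matrix.sub_apply, Matrix.mul_apply, Fin.sum_univ_four, Matrix.transpose_apply,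
    Matrix.add_apply, Matrix.smul_apply]
  fin_cases a <;> fin_cases b <;> simp [stdH, stdP, stdJ, cothPlus, cothMinus] <;> ring

theorem stdJ_mul_stdJ : stdJ * stdJ = 1 := by
  ext a b
  fin_cases a <;> fin_cases b <;> simp [stdJ, Matrix.mul_apply, Fin.sum_univ_four]

theorem stdJ_transpose : stdJᵀ = stdJ := by
  ext a b
  fin_cases a <;> fin_cases b <;> simp [stdJ]

/-- The bar involution on indices with `J (bar a) a ≠ 0`. -/
def bar : Fin 4 → Fin 4 := ![3, 2, 1, 0]

/-- The signs of `J`. -/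
def sgn : Fin 4 → ℂ := ![1, -1, -1, 1]

theorem stdJ_eq : stdJ = ∑ a, sgn a • vecMulVec (Pi.single a 1) (Pi.single (bar a) 1) := by
  ext a b
  fin_cases a <;> fin_cases b <;>
    simp [stdJ, sgn, bar, Fin.sum_univ_four, vecMulVec_apply]

theorem stdJ_apply (a b : Fin 4) : stdJ a b = if b = bar a then sgn a else 0 := by
  fin_cases a <;> fin_cases b <;> simp [stdJ, sgn, bar]

/-- `(E_ab - E_ba) J`. -/
theorem std_wedge (a b : Fin 4) :
    wedge stdJ (Pi.single a 1) (Pi.single b 1)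
      = sgn b • single a (bar b) (1 : ℂ) - sgn a • single b (bar a) 1 := by
  ext i j
  simp only [wedge_apply, sub_mul, Matrix.sub_apply, vecMulVec_mul, vecMulVec_apply,
    Matrix.smul_apply, single_one_vecMul, Matrix.row, stdJ_apply, Matrix.single_apply, smul_eq_mul,
    Pi.single_apply]
  simp only [eq_comm (a := i), eq_comm (a := j)]
  split_ifs <;> simp_all

/-- The Casimir tensor of `so(4)` in terms of the two factors. -/
theorem std_casimir (D : Matrix (Fin 4) (Fin 4) ℂ →ₗ[ℂ] Matrix (Fin 4) (Fin 4) ℂ →ₗ[ℂ] ℂ) :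
    ∑ a, ∑ b, sgn a * sgn b * D (wedge stdJ (Pi.single a 1) (Pi.single b 1))
        (wedge stdJ (Pi.single (bar a) 1) (Pi.single (bar b) 1))
      = -4 * ∑ i, (D (stdH i) (stdH i) + D (stdR i 1) (stdR i 1) - D (stdT' i) (stdT' i)) := by
  have hH : ∀ i, stdH i = ![(1 / 2 : ℂ) • (single 0 0 1 + single 1 1 1 - single 2 2 1
        - single 3 3 1), (1 / 2 : ℂ) • (single 0 0 1 - single 1 1 1 + single 2 2 1
        - single 3 3 1)] i := by
    intro i
    fin_cases i <;> ext a b <;> fin_cases a <;> fin_cases b <;> simp [stdH]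
  have hT : ∀ i, stdR i 1 = ![(1 / 2 : ℂ) • (single 0 2 1 + single 1 3 1 + single 2 0 1
        + single 3 1 1), (1 / 2 : ℂ) • (single 0 1 1 + single 1 0 1 + single 2 3 1
        + single 3 2 1)] i := by
    intro i
    fin_cases i <;> ext a b <;> fin_cases a <;> fin_cases b <;> simp [stdR]
  have hT' : ∀ i, stdT' i = ![(1 / 2 : ℂ) • (single 0 2 1 + single 1 3 1 - single 2 0 1
        - single 3 1 1), (1 / 2 : ℂ) • (single 0 1 1 - single 1 0 1 + single 2 3 1
        - single 3 2 1)] i := by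
    intro i
    fin_cases i <;> ext a b <;> fin_cases a <;> fin_cases b <;> simp [stdT']
  simp only [hH, hT, hT', std_wedge, Fin.sum_univ_four, Fin.sum_univ_two]
  simp only [bar, sgn, Matrix.cons_val, map_add, map_sub, map_smul, LinearMap.add_apply,
    LinearMap.sub_apply, LinearMap.smul_apply, smul_eq_mul]
  ring

end StandardModel

end ConformalCasimir

namespace ConformalCasimir

open Matrix

/-- An embedding `K` of the standard model onto a nondegenerate subspace of `ℂ^{d+2}` that is
spanned by coordinate vectors, for which the dilation is the standard one. `L` is the projection,
and `U` the set of complementary coordinates. -/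
structure IsModel (p q : ℕ) (K : Matrix (Fin (p + q + 2)) (Fin 4) ℂ)
    (L : Matrix (Fin 4) (Fin (p + q + 2)) ℂ) (U : Finset (Fin (p + q + 2))) (μ : ℂ) : Prop where
  left_inv : L * K = 1
  ne_zero : μ ≠ 0
  form : Kᵀ * cx (metric p q) = μ • (stdJ * L)
  tensor : cx (metric p q) = μ⁻¹ • (K * stdJ * Kᵀ)
    + diagonal fun i : Fin (p + q + 2) => if i ∈ U then (eta p i : ℂ) else 0
  proj : ∀ u ∈ U, L *ᵥ Pi.single u 1 = 0
  card : U.card = p + q - 2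
  dil : cx (dilation p q) = K * (stdR 0 1 + stdR 1 1) * L

/-! ### Evaluation of the Casimir tensor in a model. -/

section Evaluation

variable {p q : ℕ}

theorem cx_metric_transpose : (cx (metric p q))ᵀ = cx (metric p q) := by
  rw [← cx_transpose, metric_transpose]

theorem cx_metric_eq_diagonal :
    cx (metric p q) = diagonal fun i : Fin (p + q + 2) => (eta p i : ℂ) := by
  simp [metric, Matrix.diagonal_map]

namespace IsModel

variable {K : Matrix (Fin (p + q + 2)) (Fin 4) ℂ} {L : Matrix (Fin 4) (Fin (p + q + 2)) ℂ}
  {U : Finset (Fin (p + q + 2))} {μ : ℂ} (hM : IsModel p q K L U μ)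

include hM

theorem isSkew_of_std {A : Matrix (Fin 4) (Fin 4) ℂ} (hA : IsSkew stdJ A) :
    IsSkew (cx (metric p q)) (K * A * L) := by
  have h2 : cx (metric p q) * K = μ • (Lᵀ * stdJ) := by
    have := congrArg Matrix.transpose hM.form
    rwa [transpose_mul, cx_metric_transpose, transpose_transpose, transpose_smul, transpose_mul,
      stdJ_transpose] at this
  rw [IsSkew]
  calc (K * A * L)ᵀ * cx (metric p q) + cx (metric p q) * (K * A * L)
      = Lᵀ * Aᵀ * (Kᵀ * cx (metric p q)) + cx (metric p q) * K * (A * L) := by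
        simp only [transpose_mul, Matrix.mul_assoc]
    _ = μ • (Lᵀ * (Aᵀ * stdJ + stdJ * A) * L) := by
        rw [hM.form, h2]
        simp only [Matrix.mul_smul, Matrix.smul_mul, Matrix.mul_add, Matrix.add_mul,
          Matrix.mul_assoc, smul_add]
    _ = 0 := by rw [show Aᵀ * stdJ + stdJ * A = 0 from hA]; simp

theorem wedge_std (v w : Fin 4 → ℂ) :
    wedge (cx (metric p q)) (K *ᵥ v) (K *ᵥ w) = μ • (K * wedge stdJ v w * L) := by
  have : vecMulVec (K *ᵥ v) (K *ᵥ w) - vecMulVec (K *ᵥ w) (K *ᵥ v)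
      = K * (vecMulVec v w - vecMulVec w v) * Kᵀ := by
    rw [Matrix.mul_sub, Matrix.sub_mul, mul_vecMulVec, mul_vecMulVec, vecMulVec_mul,
      vecMulVec_mul, vecMul_transpose, vecMul_transpose]
  rw [wedge_apply, wedge_apply, this, Matrix.mul_assoc, hM.form]
  simp only [Matrix.mul_smul, Matrix.mul_assoc]

theorem mul_mul (A B : Matrix (Fin 4) (Fin 4) ℂ) : K * A * L * (K * B * L) = K * (A * B) * L := by
  calc K * A * L * (K * B * L) = K * A * (L * K) * B * L := by simp only [Matrix.mul_assoc]
    _ = _ := by rw [hM.left_inv]; simp only [Matrix.mul_assoc, Matrix.mul_one]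

theorem mulVec_mulVec_K (A : Matrix (Fin 4) (Fin 4) ℂ) (v : Fin 4 → ℂ) :
    (K * A * L) *ᵥ (K *ᵥ v) = K *ᵥ (A *ᵥ v) := by
  rw [Matrix.mulVec_mulVec, Matrix.mul_assoc, hM.left_inv, Matrix.mul_one, Matrix.mulVec_mulVec]

theorem mulVec_single {u : Fin (p + q + 2)} (hu : u ∈ U) (A : Matrix (Fin 4) (Fin 4) ℂ) :
    (K * A * L) *ᵥ Pi.single u 1 = 0 := by
  rw [← Matrix.mulVec_mulVec, hM.proj u hu, Matrix.mulVec_zero]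

theorem single_dotProduct {u : Fin (p + q + 2)} (hu : u ∈ U) (v : Fin 4 → ℂ) :
    Pi.single u 1 ⬝ᵥ (cx (metric p q) *ᵥ (K *ᵥ v)) = 0 := by
  have h : K *ᵥ v = v ᵥ* Kᵀ := (vecMul_transpose K v).symm
  rw [h, dotProduct_comm, ← cx_metric_transpose, mulVec_transpose, vecMul_vecMul, hM.form,
    ← dotProduct_mulVec, smul_mulVec, ← Matrix.mulVec_mulVec, hM.proj u hu]
  simp

/-- The isotropic vectors of the model are paired by `bar`, and the remaining coordinates are paired
with themselves. This is the decomposition fed to `casimirTensor_eq`. -/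
theorem tensor_sum : cx (metric p q) = ∑ a : Fin 4 ⊕ U,
    Sum.elim (fun a => μ⁻¹ * sgn a) (fun u : U => (eta p (u : Fin (p + q + 2)) : ℂ)) a •
      vecMulVec (Sum.elim (fun a => K *ᵥ Pi.single a 1) (fun u : U => Pi.single (u : Fin _) 1) a)
        (Sum.elim (fun a => K *ᵥ Pi.single (bar a) 1) (fun u : U => Pi.single (u : Fin _) 1) a) := by
  rw [Fintype.sum_sum_type]
  simp only [Sum.elim_inl, Sum.elim_inr]
  conv_lhs => rw [hM.tensor]
  congr 1
  · rw [stdJ_eq, Matrix.mul_sum, Matrix.sum_mul, Finset.smul_sum]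
    refine Finset.sum_congr rfl fun a _ => ?_
    rw [Matrix.mul_smul, Matrix.smul_mul, mul_vecMulVec, vecMulVec_mul, vecMul_transpose, smul_smul]
  · rw [Finset.sum_coe_sort U fun u => (eta p u : ℂ) •
      vecMulVec (Pi.single u (1 : ℂ)) (Pi.single u 1)]
    ext i j
    simp only [Matrix.sum_apply, Matrix.smul_apply, vecMulVec_apply, Pi.single_apply,
      diagonal_apply, smul_eq_mul]
    by_cases hij : i = j
    · subst hij
      simp
    · rw [if_neg hij]
      symm
      refine Finset.sum_eq_zero fun u _ => ?_
      by_cases h : i = u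
      · simp [← h, Ne.symm hij]
      · simp [h]

end IsModel

variable {K : Matrix (Fin (p + q + 2)) (Fin 4) ℂ} {L : Matrix (Fin 4) (Fin (p + q + 2)) ℂ}
  {U : Finset (Fin (p + q + 2))} {μ : ℂ}

theorem isSkew_stdR (i : Fin 2) (y : ℂ) : IsSkew stdJ (stdR i y) := by
  rw [IsSkew]
  ext a b
  simp only [Matrix.add_apply, Matrix.mul_apply, Fin.sum_univ_four, Matrix.transpose_apply]
  fin_cases i <;> fin_cases a <;> fin_cases b <;> simp [stdR, stdJ]

theorem isSkew_stdH (i : Fin 2) : IsSkew stdJ (stdH i) := by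
  rw [IsSkew]
  ext a b
  simp only [Matrix.add_apply, Matrix.mul_apply, Fin.sum_univ_four, Matrix.transpose_apply]
  fin_cases i <;> fin_cases a <;> fin_cases b <;> simp [stdH, stdJ]

/-- The two summands commute and both have square `1 / 4`, so the difference of squares vanishes.
Hence `stdR 0 1 - stdR 1 1` lies in the complexification of `𝔪`. -/
theorem stdR_sub_mul_add : (stdR 0 1 - stdR 1 1) * (stdR 0 1 + stdR 1 1) = 0 := by
  ext a b
  simp only [Matrix.add_apply, Matrix.mul_apply, Fin.sum_univ_four, Matrix.sub_apply]
  fin_cases a <;> fin_cases b <;> simp [stdR]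

section

variable {α β : ℂ} {f : Matrix (Fin (p + q + 2)) (Fin (p + q + 2)) ℝ → ℂ} {x : Matrix _ _ ℝ}
  {D₁ : Matrix (Fin (p + q + 2)) (Fin (p + q + 2)) ℂ →ₗ[ℂ] ℂ}
  {D₂ : Matrix (Fin (p + q + 2)) (Fin (p + q + 2)) ℂ →ₗ[ℂ]
    Matrix (Fin (p + q + 2)) (Fin (p + q + 2)) ℂ →ₗ[ℂ] ℂ} {y : Fin 2 → ℂ}

theorem cx_mul_cx_inv (hx : x ∈ tildeG p q) : cx x * cx x⁻¹ = 1 := by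
  rw [← cx_mul, mul_inv_of_mem_tildeG hx, cx_one]

theorem cx_inv_mul_cx (hx : x ∈ tildeG p q) : cx x⁻¹ * cx x = 1 := by
  rw [← cx_mul, inv_mul_of_mem_tildeG hx, cx_one]

theorem cx_orthogonal (hx : x ∈ tildeG p q) :
    (cx x)ᵀ * cx (metric p q) * cx x = cx (metric p q) := by
  rw [← cx_transpose, ← cx_mul, ← cx_mul, (groupG_subset hx.1).1]

/-- Up to an element of `𝔪`, which acts by zero, `stdR i 1` is half the dilation, so each factor
carries half of `α`. -/
theorem left_value (hM : IsModel p q K L U μ) (hJ : IsJet p q α β f x D₁ D₂) (i : Fin 2) :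
    D₁ (K * stdR i 1 * L) = α / 2 * f x ∧ ∀ Y, IsSkew (cx (metric p q)) Y →
      D₂ (K * stdR i 1 * L) Y = α / 2 * D₁ Y := by
  have hM0 := hJ.m_left (K * (stdR 0 1 - stdR 1 1) * L)
    (hM.isSkew_of_std (by
      have := (isSkew_stdR 0 1).add ((isSkew_stdR 1 1).smul (-1))
      simpa [sub_eq_add_neg] using this))
    (by rw [hM.dil, hM.mul_mul, stdR_sub_mul_add]; simp)
  have hD0 := hJ.a_left
  have e : K * stdR i 1 * L = (1 / 2 : ℂ) • (cx (dilation p q)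
      + (![1, -1] i : ℂ) • (K * (stdR 0 1 - stdR 1 1) * L)) := by
    rw [hM.dil, ← Matrix.smul_mul, ← Matrix.mul_smul, ← Matrix.add_mul, ← Matrix.mul_add,
      ← Matrix.smul_mul, ← Matrix.mul_smul]
    congr 2
    fin_cases i
    · simp only [Fin.zero_eta, Matrix.cons_val_zero]; module
    · simp only [Fin.mk_one, Matrix.cons_val_one, Matrix.cons_val_fin_one]; module
  rw [e]
  refine ⟨?_, fun Y hY => ?_⟩
  · rw [map_smul, map_add, map_smul, hM0.1, hD0.1]; simp; ring
  · rw [map_smul, map_add, map_smul]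
    simp only [LinearMap.add_apply, LinearMap.smul_apply, hM0.2 Y hY, hD0.2 Y hY, smul_eq_mul]
    ring

/-- By `hR`, `stdR i (-y i)` is the conjugate of `stdR i 1` by `x`, so right equivariance applies to
it, with half of `β` for each factor. -/
theorem right_value (hM : IsModel p q K L U μ) (hx : x ∈ tildeG p q)
    (hJ : IsJet p q α β f x D₁ D₂)
    (hR : ∀ i, cx x * (K * stdR i 1 * L) = K * stdR i (-y i) * L * cx x) (i : Fin 2) :
    D₁ (K * stdR i (-y i) * L) = β / 2 * f x ∧ ∀ Y, IsSkew (cx (metric p q)) Y →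
      D₂ Y (K * stdR i (-y i) * L) = β / 2 * D₁ Y := by
  have hM0 := hJ.m_right (K * (stdR 0 1 - stdR 1 1) * L)
    (hM.isSkew_of_std (by
      have := (isSkew_stdR 0 1).add ((isSkew_stdR 1 1).smul (-1))
      simpa [sub_eq_add_neg] using this))
    (by rw [hM.dil, hM.mul_mul, stdR_sub_mul_add]; simp)
  have hD0 := hJ.a_right
  have e : K * stdR i (-y i) * L = (1 / 2 : ℂ) • (cx x * cx (dilation p q) * cx x⁻¹
      + (![1, -1] i : ℂ) • (cx x * (K * (stdR 0 1 - stdR 1 1) * L) * cx x⁻¹)) := by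
    have h1 : K * stdR i (-y i) * L = cx x * (K * stdR i 1 * L) * cx x⁻¹ := by
      rw [hR, Matrix.mul_assoc _ (cx x), cx_mul_cx_inv hx, Matrix.mul_one]
    rw [h1, hM.dil, ← Matrix.smul_mul, ← Matrix.mul_smul, ← Matrix.add_mul, ← Matrix.mul_add,
      ← Matrix.smul_mul, ← Matrix.mul_smul, ← Matrix.smul_mul, ← Matrix.mul_smul, ← Matrix.add_mul,
      ← Matrix.mul_add, ← Matrix.smul_mul, ← Matrix.mul_smul]
    congr 4
    fin_cases i
    · simp only [Fin.zero_eta, Matrix.cons_val_zero]; module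
    · simp only [Fin.mk_one, Matrix.cons_val_one, Matrix.cons_val_fin_one]; module
  rw [e]
  refine ⟨?_, fun Y hY => ?_⟩
  · rw [map_smul, map_add, map_smul, hM0.1, hD0.1]; simp; ring
  · simp only [map_smul, map_add, hM0.2 Y hY, hD0.2 Y hY, smul_eq_mul]
    ring

/-- The contribution of one factor of `so(4)`. -/
theorem factor_value (hM : IsModel p q K L U μ) (hx : x ∈ tildeG p q)
    (hJ : IsJet p q α β f x D₁ D₂) (hy : ∀ i, y i ≠ 0) (hy2 : ∀ i, y i ^ 2 ≠ 1)
    (hR : ∀ i, cx x * (K * stdR i 1 * L) = K * stdR i (-y i) * L * cx x) (i : Fin 2) :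
    D₂ (K * stdR i 1 * L) (K * stdR i 1 * L) - D₂ (K * stdT' i * L) (K * stdT' i * L)
      = (y i + (y i)⁻¹) / (y i - (y i)⁻¹) * D₁ (K * stdH i * L)
          - (α ^ 2 + β ^ 2 + α * β * (y i + (y i)⁻¹)) / (y i - (y i)⁻¹) ^ 2 * f x := by
  have hS : y i - (y i)⁻¹ ≠ 0 := by
    intro h
    apply hy2 i
    have := hy i
    field_simp at h
    linear_combination h
  have hl := left_value hM hJ i
  have hr := right_value hM hx hJ hR i
  have hTs := hM.isSkew_of_std (isSkew_stdR i 1)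
  have hRs := hM.isSkew_of_std (isSkew_stdR i (-y i))
  -- Solve `stdR_eq` for `stdT'`: it becomes a combination of `stdR i 1`, known in the first slot,
  -- and `stdR i (-y i)`, known in the second. This needs `y i ^ 2 ≠ 1`.
  have hT' : K * stdT' i * L = (-(2 / (y i - (y i)⁻¹))) • (K * stdR i (-y i) * L
      + ((y i + (y i)⁻¹) / 2) • (K * stdR i 1 * L)) := by
    rw [stdR_eq i (-y i), ← Matrix.smul_mul, ← Matrix.mul_smul, ← Matrix.add_mul, ← Matrix.mul_add,
      ← Matrix.smul_mul, ← Matrix.mul_smul]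
    congr 2
    rw [add_right_comm, ← add_smul, inv_neg,
      show (-y i + -(y i)⁻¹) / 2 + (y i + (y i)⁻¹) / 2 = 0 by ring, zero_smul, zero_add, smul_smul,
      show -(2 / (y i - (y i)⁻¹)) * ((-y i - -(y i)⁻¹) / 2)
        = (y i - (y i)⁻¹) / (y i - (y i)⁻¹) by ring, div_self hS, one_smul]
  -- Only the product with `stdR i (-y i)` in the first slot and `stdR i 1` in the second is in the
  -- wrong order. Swapping it costs a multiple of `stdH i`, the source of the first-order term.
  have hc := hJ.comm (K * stdR i (-y i) * L) (K * stdR i 1 * L)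
  rw [hM.mul_mul, hM.mul_mul, ← Matrix.sub_mul, ← Matrix.mul_sub, stdR_commutator,
    Matrix.mul_smul, Matrix.smul_mul, map_smul, smul_eq_mul, inv_neg] at hc
  rw [show (-y i - -(y i)⁻¹) / 2 = -(y i - (y i)⁻¹) / 2 by ring] at hc
  rw [hT']
  simp only [map_smul, map_add, LinearMap.add_apply, LinearMap.smul_apply, smul_eq_mul]
  rw [eq_add_of_sub_eq hc, hl.2 _ hTs, hl.2 _ hRs, hr.2 _ hRs, hl.1, hr.1]
  have hcs : (y i + (y i)⁻¹) ^ 2 = (y i - (y i)⁻¹) ^ 2 + 4 := by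
    linear_combination 4 * mul_inv_cancel₀ (hy i)
  generalize y i + (y i)⁻¹ = c at hcs ⊢
  generalize y i - (y i)⁻¹ = s at hS hcs ⊢
  field_simp
  linear_combination (-(α ^ 2 * f x)) * hcs

/-- The contribution of the root spaces outside `so(4)`. -/
theorem cross_value (hM : IsModel p q K L U μ) (hx : x ∈ tildeG p q)
    (hJ : IsJet p q α β f x D₁ D₂) (hy : ∀ i, y i ≠ 0)
    (hp : y 0 * y 1 ≠ 1) (hm : y 0 ≠ y 1)
    (hR : ∀ i, cx x * (K * stdR i 1 * L) = K * stdR i (-y i) * L * cx x)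
    {u : Fin (p + q + 2)} (hu : u ∈ U) :
    ∑ a, sgn a * D₂ (wedge (cx (metric p q)) (Pi.single u 1) (K *ᵥ Pi.single a 1))
        (wedge (cx (metric p q)) (Pi.single u 1) (K *ᵥ Pi.single (bar a) 1))
      = -(eta p u * μ) * D₁ (K * (stdP y - stdJ * (stdP y)ᵀ * stdJ) * L) := by
  set S := cx (metric p q) with hS
  have hSt : Sᵀ = S := cx_metric_transpose
  set e : Fin (p + q + 2) → ℂ := Pi.single u 1
  have hDs : IsSkew S (cx (dilation p q)) := isSkew_dilation.cx
  have hDe : cx (dilation p q) *ᵥ e = 0 := by rw [hM.dil]; exact hM.mulVec_single hu _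
  have heta : e ⬝ᵥ (S *ᵥ e) = eta p u := by
    rw [hS, cx_metric_eq_diagonal]; simp [e]
  have hterm : ∀ a, D₂ (wedge S e (K *ᵥ Pi.single a 1)) (wedge S e (K *ᵥ Pi.single (bar a) 1))
      = -(eta p u * μ) *
        D₁ (K * wedge stdJ (stdP y *ᵥ Pi.single a 1) (Pi.single (bar a) 1) * L) := by
    intro a
    set v := Pi.single (M := fun _ => ℂ) a (1 : ℂ)
    set w := Pi.single (M := fun _ => ℂ) (bar a) (1 : ℂ)
    -- Both `e` and `(1 - P) v` are killed by the dilation, so their wedge lies in `𝔪` and vanishes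
    -- in the first slot.
    have hl := hJ.m_left (wedge S e (K *ᵥ ((1 - stdP y) *ᵥ v))) (isSkew_wedge hSt _ _)
      (wedge_mul_eq_zero hDs hDe (by
        rw [hM.dil, hM.mulVec_mulVec_K, Matrix.mulVec_mulVec v, stdP_left hp hm]; simp))
    have hxD : cx x * cx (dilation p q) = K * (stdR 0 (-y 0) + stdR 1 (-y 1)) * L * cx x := by
      rw [hM.dil, Matrix.mul_add, Matrix.add_mul, Matrix.mul_add, hR, hR, Matrix.mul_add,
        Matrix.add_mul, Matrix.add_mul]
    have hker : ∀ z, (K * (stdR 0 (-y 0) + stdR 1 (-y 1)) * L) *ᵥ z = 0 →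
        cx (dilation p q) *ᵥ (cx x⁻¹ *ᵥ z) = 0 := by
      intro z hz
      have h1 : cx x *ᵥ (cx (dilation p q) *ᵥ (cx x⁻¹ *ᵥ z)) = 0 := by
        rw [Matrix.mulVec_mulVec, hxD, ← Matrix.mulVec_mulVec, Matrix.mulVec_mulVec _ (cx x),
          cx_mul_cx_inv hx, Matrix.one_mulVec, hz]
      have h2 := congrArg (fun z => cx x⁻¹ *ᵥ z) h1
      simpa [Matrix.mulVec_mulVec, cx_inv_mul_cx hx, ← Matrix.mul_assoc] using h2
    -- Pulled back by `x⁻¹`, both `e` and `P v` are killed by the dilation, so their wedge lies in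
    -- the conjugate of `𝔪` and vanishes in the second slot.
    have hr := hJ.m_right (wedge S (cx x⁻¹ *ᵥ e) (cx x⁻¹ *ᵥ (K *ᵥ (stdP y *ᵥ v))))
      (isSkew_wedge hSt _ _) (wedge_mul_eq_zero hDs (hker _ (hM.mulVec_single hu _)) (hker _ (by
        rw [hM.mulVec_mulVec_K, Matrix.mulVec_mulVec v, stdP_right hy]; simp)))
    rw [conj_wedge (cx_orthogonal hx) (cx_mul_cx_inv hx), Matrix.mulVec_mulVec,
      Matrix.mulVec_mulVec, cx_mul_cx_inv hx, Matrix.one_mulVec, Matrix.one_mulVec] at hr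
    have hdec : wedge S e (K *ᵥ v) = wedge S e (K *ᵥ ((1 - stdP y) *ᵥ v))
        + wedge S e (K *ᵥ (stdP y *ᵥ v)) := by
      rw [← map_add, ← Matrix.mulVec_add, ← Matrix.add_mulVec, sub_add_cancel, Matrix.one_mulVec]
    -- After the slots are exchanged one product is zero, and what remains is `D₁` of a commutator
    -- inside `so(4)`.
    have hc := hJ.comm (wedge S e (K *ᵥ (stdP y *ᵥ v))) (wedge S e (K *ᵥ w))
    rw [hr.2 _ (isSkew_wedge hSt _ _), sub_zero, wedge_commutator hSt (hM.single_dotProduct hu _)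
      (hM.single_dotProduct hu _), heta, hM.wedge_std, map_smul, map_smul] at hc
    rw [hdec, map_add, LinearMap.add_apply, hl.2 _ (isSkew_wedge hSt _ _), hc, smul_eq_mul,
      smul_eq_mul]
    ring
  -- Contraction over the pairs `a`, `bar a` reassembles the commutators into `stdP` minus its
  -- adjoint.
  have hsum : stdP y - stdJ * (stdP y)ᵀ * stdJ
      = ∑ a, sgn a • wedge stdJ (stdP y *ᵥ Pi.single a 1) (Pi.single (bar a) 1) := by
    have h1 : ∑ a, sgn a • vecMulVec (stdP y *ᵥ Pi.single a 1) (Pi.single (bar a) 1)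
        = stdP y * stdJ := by
      rw [stdJ_eq, Finset.mul_sum]
      exact Finset.sum_congr rfl fun a _ => by rw [Matrix.mul_smul, mul_vecMulVec]
    have h2 : ∑ a, sgn a • vecMulVec (Pi.single (bar a) 1) (stdP y *ᵥ Pi.single a 1)
        = (stdP y * stdJ)ᵀ := by
      rw [← h1, Matrix.transpose_sum]
      exact Finset.sum_congr rfl fun a _ => by rw [transpose_smul, transpose_vecMulVec]
    simp only [wedge_apply, ← Matrix.smul_mul, smul_sub]
    rw [← Finset.sum_mul, Finset.sum_sub_distrib, h1, h2, Matrix.sub_mul, Matrix.mul_assoc (stdP y),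
      stdJ_mul_stdJ, Matrix.mul_one, transpose_mul, stdJ_transpose]
  rw [hsum, Matrix.mul_sum, Matrix.sum_mul, map_sum, Finset.mul_sum]
  refine Finset.sum_congr rfl fun a _ => ?_
  rw [hterm, Matrix.mul_smul, Matrix.smul_mul, map_smul, smul_eq_mul]
  ring

end

/-- The radial part of the Casimir element at a point where the dilation is rotated by the Cartan
subgroup to parameters `y`. -/
theorem casimirTensor_eq_radial (hd : 2 ≤ p + q) (hM : IsModel p q K L U μ) {α β : ℂ}
    {f : Matrix (Fin (p + q + 2)) (Fin (p + q + 2)) ℝ → ℂ} {x : Matrix _ _ ℝ}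
    (hx : x ∈ tildeG p q)
    {D₁ : Matrix (Fin (p + q + 2)) (Fin (p + q + 2)) ℂ →ₗ[ℂ] ℂ}
    {D₂ : Matrix (Fin (p + q + 2)) (Fin (p + q + 2)) ℂ →ₗ[ℂ]
      Matrix (Fin (p + q + 2)) (Fin (p + q + 2)) ℂ →ₗ[ℂ] ℂ}
    (hJ : IsJet p q α β f x D₁ D₂) {y : Fin 2 → ℂ} (hy : ∀ i, y i ≠ 0) (hy2 : ∀ i, y i ^ 2 ≠ 1)
    (hp : y 0 * y 1 ≠ 1) (hm : y 0 ≠ y 1)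
    (hR : ∀ i, cx x * (K * stdR i 1 * L) = K * stdR i (-y i) * L * cx x) :
    -(1 / 4 : ℂ) * casimirTensor (cx (metric p q)) D₂
      = ∑ i, (D₂ (K * stdH i * L) (K * stdH i * L)
          + (y i + (y i)⁻¹) / (y i - (y i)⁻¹) * D₁ (K * stdH i * L)
          - (α ^ 2 + β ^ 2 + α * β * (y i + (y i)⁻¹)) / (y i - (y i)⁻¹) ^ 2 * f x)
        + ((p + q : ℂ) - 2) / 2 *
          (cothPlus y * (D₁ (K * stdH 0 * L) + D₁ (K * stdH 1 * L))
            + cothMinus y * (D₁ (K * stdH 0 * L) - D₁ (K * stdH 1 * L))) := by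
  set S := cx (metric p q) with hS
  have hSt : Sᵀ = S := cx_metric_transpose
  have hSd : S = diagonal (diag S) := by rw [hS, cx_metric_eq_diagonal]; simp
  have hDs : IsSkew S (cx (dilation p q)) := isSkew_dilation.cx
  -- The dilation kills every coordinate in `U`, so these wedges lie in `𝔪`.
  have hUU : ∀ u ∈ U, ∀ u' ∈ U, ∀ Y, IsSkew S Y →
      D₂ (wedge S (Pi.single u 1) (Pi.single u' 1)) Y = 0 := by
    intro u hu u' hu' Y hY
    refine (hJ.m_left _ (isSkew_wedge hSt _ _) (wedge_mul_eq_zero hDs ?_ ?_)).2 Y hY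
    · rw [hM.dil]; exact hM.mulVec_single hu _
    · rw [hM.dil]; exact hM.mulVec_single hu' _
  have h4 : ∑ a, ∑ b, μ⁻¹ * sgn a * (μ⁻¹ * sgn b) *
      D₂ (wedge S (K *ᵥ Pi.single a 1) (K *ᵥ Pi.single b 1))
        (wedge S (K *ᵥ Pi.single (bar a) 1) (K *ᵥ Pi.single (bar b) 1))
      = -4 * ∑ i, (D₂ (K * stdH i * L) (K * stdH i * L)
        + D₂ (K * stdR i 1 * L) (K * stdR i 1 * L) - D₂ (K * stdT' i * L) (K * stdT' i * L)) := by
    let φ : Matrix (Fin 4) (Fin 4) ℂ →ₗ[ℂ] Matrix (Fin (p + q + 2)) (Fin (p + q + 2)) ℂ :=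
      { toFun := fun A => K * A * L
        map_add' := fun A B => by rw [Matrix.mul_add, Matrix.add_mul]
        map_smul' := fun c A => by rw [Matrix.mul_smul, Matrix.smul_mul]; rfl }
    have h := std_casimir (D₂.compl₁₂ φ φ)
    have hφ : ∀ A, φ A = K * A * L := fun _ => rfl
    simp only [LinearMap.compl₁₂_apply, hφ] at h
    rw [← h]
    refine Finset.sum_congr rfl fun a _ => Finset.sum_congr rfl fun b _ => ?_
    rw [hM.wedge_std, hM.wedge_std, map_smul, map_smul, LinearMap.smul_apply, smul_eq_mul,
      smul_eq_mul]
    have := hM.ne_zero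
    field_simp
  have hcross := fun u hu => cross_value hM hx hJ hy hp hm hR (u := u) hu
  have hcard : (Fintype.card U : ℂ) = (p + q : ℂ) - 2 := by
    rw [Fintype.card_coe, hM.card, Nat.cast_sub hd]; push_cast; ring
  have hsum : casimirTensor S D₂ = -4 * ∑ i, (D₂ (K * stdH i * L) (K * stdH i * L)
        + D₂ (K * stdR i 1 * L) (K * stdR i 1 * L) - D₂ (K * stdT' i * L) (K * stdT' i * L))
      - 2 * ((p + q : ℂ) - 2) * D₁ (K * (stdP y - stdJ * (stdP y)ᵀ * stdJ) * L) := by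
    rw [casimirTensor_eq hSd D₂ hM.tensor_sum]
    simp only [Fintype.sum_sum_type, Sum.elim_inl, Sum.elim_inr, Finset.sum_add_distrib]
    rw [h4]
    have hz : ∑ u : U, ∑ u' : U, (eta p (u : Fin (p + q + 2)) : ℂ) *
        (eta p (u' : Fin (p + q + 2)) : ℂ) *
        D₂ (wedge S (Pi.single (u : Fin (p + q + 2)) 1) (Pi.single (u' : Fin (p + q + 2)) 1))
          (wedge S (Pi.single (u : Fin (p + q + 2)) 1) (Pi.single (u' : Fin (p + q + 2)) 1))
        = 0 := by
      refine Finset.sum_eq_zero fun u _ => Finset.sum_eq_zero fun u' _ => ?_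
      rw [hUU u u.2 u' u'.2 _ (isSkew_wedge hSt _ _), mul_zero]
    have hη : ∀ n, (eta p n : ℂ) * eta p n = 1 := by
      intro n; exact_mod_cast eta_mul_self p n
    have h1 : ∑ u : U, ∑ a : Fin 4, (eta p (u : Fin (p + q + 2)) : ℂ) * (μ⁻¹ * sgn a) *
        D₂ (wedge S (Pi.single (u : Fin (p + q + 2)) 1) (K *ᵥ Pi.single a 1))
          (wedge S (Pi.single (u : Fin (p + q + 2)) 1) (K *ᵥ Pi.single (bar a) 1))
        = -((p + q : ℂ) - 2) * D₁ (K * (stdP y - stdJ * (stdP y)ᵀ * stdJ) * L) := by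
      rw [← hcard]
      have : ∀ u : U, ∑ a : Fin 4, (eta p (u : Fin (p + q + 2)) : ℂ) * (μ⁻¹ * sgn a) *
        D₂ (wedge S (Pi.single (u : Fin (p + q + 2)) 1) (K *ᵥ Pi.single a 1))
          (wedge S (Pi.single (u : Fin (p + q + 2)) 1) (K *ᵥ Pi.single (bar a) 1))
        = -D₁ (K * (stdP y - stdJ * (stdP y)ᵀ * stdJ) * L) := by
        intro u
        have h := congrArg (fun z => (eta p (u : Fin (p + q + 2)) : ℂ) * μ⁻¹ * z)
          (hcross u u.2)
        simp only [Finset.mul_sum] at h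
        rw [show ∀ X : ℂ, -X = (eta p (u : Fin (p + q + 2)) : ℂ) * μ⁻¹ *
          (-((eta p (u : Fin (p + q + 2)) : ℂ) * μ) * X) by
            intro X
            have := hM.ne_zero
            field_simp
            linear_combination X * hη u]
        rw [← h]
        exact Finset.sum_congr rfl fun a _ => by ring
      simp only [this, Finset.sum_const, Finset.card_univ, nsmul_eq_mul]
      ring
    have h2 : ∑ a : Fin 4, ∑ u : U, (μ⁻¹ * sgn a) * (eta p (u : Fin (p + q + 2)) : ℂ) *
        D₂ (wedge S (K *ᵥ Pi.single a 1) (Pi.single (u : Fin (p + q + 2)) 1))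
          (wedge S (K *ᵥ Pi.single (bar a) 1) (Pi.single (u : Fin (p + q + 2)) 1))
        = -((p + q : ℂ) - 2) * D₁ (K * (stdP y - stdJ * (stdP y)ᵀ * stdJ) * L) := by
      rw [← h1, Finset.sum_comm]
      refine Finset.sum_congr rfl fun u _ => Finset.sum_congr rfl fun a _ => ?_
      rw [wedge_swap S (Pi.single _ _) (K *ᵥ Pi.single a 1),
        wedge_swap S (Pi.single _ _) (K *ᵥ Pi.single (bar a) 1)]
      simp only [map_neg, LinearMap.neg_apply, neg_neg]
      ring
    rw [hz, h1, h2]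
    ring
  rw [hsum, stdP_sub_adjoint]
  simp only [Fin.sum_univ_two, Matrix.mul_add, Matrix.add_mul, Matrix.mul_sub, Matrix.sub_mul,
    Matrix.mul_smul, Matrix.smul_mul, map_add, map_sub, map_smul, smul_eq_mul]
  have f0 := factor_value hM hx hJ hy hy2 hR 0
  have f1 := factor_value hM hx hJ hy hy2 hR 1
  linear_combination f0 + f1

end Evaluation

end ConformalCasimir

namespace ConformalCasimir

open Matrix Filter Topology

/-! ### The left and right Casimir actions as one tensor. -/

section CasimirSums

variable {p q : ℕ}

theorem sum_range_range_eq (G : ℕ → ℕ → ℂ) (hs : ∀ i j, G i j = G j i) (h0 : ∀ i, G i i = 0)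
    (n : ℕ) : ∑ ν ∈ Finset.range n, ∑ μ ∈ Finset.range ν, G μ ν
      = 1 / 2 * ∑ i : Fin n, ∑ j : Fin n, G i j := by
  have h : ∀ n : ℕ, ∑ i : Fin n, ∑ j : Fin n, G i j
      = ∑ i ∈ Finset.range n, ∑ j ∈ Finset.range n, G i j := by
    intro n
    rw [← Fin.sum_univ_eq_sum_range (fun i => ∑ j ∈ Finset.range n, G i j) n]
    exact Finset.sum_congr rfl fun i _ => Fin.sum_univ_eq_sum_range (fun j => G i j) n
  rw [h]
  induction n with
  | zero => simp
  | succ n ih =>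
    simp only [Finset.sum_range_succ, Finset.sum_add_distrib, ih, h0]
    rw [Finset.sum_congr rfl fun j _ => hs n j]
    ring

theorem cx_genF (i j : Fin (p + q + 2)) :
    cx (genF p q i j) = wedge (cx (metric p q)) (Pi.single i 1) (Pi.single j 1) := by
  rw [cx_metric_eq_diagonal, wedge_apply]
  ext a b
  simp only [Matrix.map_apply, genF, Matrix.of_apply, Matrix.mul_diagonal, Matrix.sub_apply,
    vecMulVec_apply, Pi.single_apply, Fin.ext_iff, Complex.coe_algebraMap]
  by_cases h1 : (a : ℕ) = i <;> by_cases h2 : (b : ℕ) = j <;> by_cases h3 : (a : ℕ) = j <;>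
    by_cases h4 : (b : ℕ) = i <;> simp [h1, h2, h3, h4] <;> simp_all

/-- One factor `1 / 2` and the sign come from the dual basis; the other `1 / 2` from replacing pairs
`μ < ν` by all ordered pairs. -/
theorem sum_genF_eq_casimirTensor
    (D : Matrix (Fin (p + q + 2)) (Fin (p + q + 2)) ℂ →ₗ[ℂ]
      Matrix (Fin (p + q + 2)) (Fin (p + q + 2)) ℂ →ₗ[ℂ] ℂ) :
    ∑ ν ∈ Finset.range (p + q + 2), ∑ μ ∈ Finset.range ν,
      (-(1 / 2) * (eta p μ : ℂ) * eta p ν) * D (cx (genF p q μ ν)) (cx (genF p q μ ν))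
      = -(1 / 4) * casimirTensor (cx (metric p q)) D := by
  have hF : ∀ μ ν, genF p q μ ν = -genF p q ν μ := by
    intro μ ν
    ext i j
    simp [genF]
  rw [sum_range_range_eq (fun μ ν => (-(1 / 2) * (eta p μ : ℂ) * eta p ν) *
    D (cx (genF p q μ ν)) (cx (genF p q μ ν)))]
  · rw [casimirTensor]
    simp only [Finset.mul_sum]
    refine Finset.sum_congr rfl fun i _ => Finset.sum_congr rfl fun j _ => ?_
    rw [cx_genF, cx_metric_eq_diagonal]
    simp only [diagonal_apply_eq]
    ring
  · intro i j
    rw [hF i j, cx_neg]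
    simp only [map_neg, LinearMap.neg_apply, neg_neg]
    ring
  · intro i
    have : genF p q i i = 0 := by ext; simp [genF]
    rw [this, cx_zero]; simp

variable {α β : ℂ} {f : Matrix (Fin (p + q + 2)) (Fin (p + q + 2)) ℝ → ℂ}
  {x : Matrix (Fin (p + q + 2)) (Fin (p + q + 2)) ℝ}
  {D₁ : Matrix (Fin (p + q + 2)) (Fin (p + q + 2)) ℂ →ₗ[ℂ] ℂ}
  {D₂ : Matrix (Fin (p + q + 2)) (Fin (p + q + 2)) ℂ →ₗ[ℂ]
    Matrix (Fin (p + q + 2)) (Fin (p + q + 2)) ℂ →ₗ[ℂ] ℂ}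

theorem casimirRight_eq (hJ : IsJet p q α β f x D₁ D₂) :
    casimirRight p q f x = -(1 / 4) * casimirTensor (cx (metric p q)) D₂ := by
  rw [← sum_genF_eq_casimirTensor, casimirRight]
  refine Finset.sum_congr rfl fun ν _ => Finset.sum_congr rfl fun μ _ => ?_
  refine (hJ.right_two _ _ isSkew_genF (isSkew_genF.smul _)).deriv.trans ?_
  rw [cx_smul, map_smul, smul_eq_mul]
  push_cast
  rfl

/-- Left-invariant derivatives are `D₂` on conjugates by `x`, and the Casimir tensor is conjugation
invariant. This is the form in which centrality of the Casimir element is used. -/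
theorem casimirLeft_eq (hx : x ∈ tildeG p q) (hJ : IsJet p q α β f x D₁ D₂) :
    casimirLeft p q f x = -(1 / 4) * casimirTensor (cx (metric p q)) D₂ := by
  obtain ⟨φ, hφ⟩ : ∃ φ : Matrix (Fin (p + q + 2)) (Fin (p + q + 2)) ℂ →ₗ[ℂ]
      Matrix (Fin (p + q + 2)) (Fin (p + q + 2)) ℂ, ∀ A, φ A = cx x * A * cx x⁻¹ :=
    ⟨{ toFun := fun A => cx x * A * cx x⁻¹
       map_add' := fun A B => by rw [Matrix.mul_add, Matrix.add_mul]
       map_smul' := fun c A => by rw [Matrix.mul_smul, Matrix.smul_mul]; rfl }, fun _ => rfl⟩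
  have hd : cx (metric p q) = diagonal (diag (cx (metric p q))) := by
    rw [cx_metric_eq_diagonal]; simp
  have hD : ∀ A B, D₂.compl₁₂ φ φ A B = D₂ (cx x * A * cx x⁻¹) (cx x * B * cx x⁻¹) := by
    intro A B
    rw [LinearMap.compl₁₂_apply, hφ, hφ]
  have hg' : cx x * cx (metric p q) * (cx x)ᵀ = cx (metric p q) := by
    have h1 := mul_eq_one_comm.1 (inv_eq_of_mem (groupG_subset hx.1))
    have h2 : x * metric p q * xᵀ = metric p q := by
      calc x * metric p q * xᵀ = x * (metric p q * xᵀ * metric p q) * metric p q := by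
            simp only [Matrix.mul_assoc, metric_mul_self, Matrix.mul_one]
        _ = _ := by rw [h1, Matrix.one_mul]
    rw [← cx_transpose, ← cx_mul, ← cx_mul, h2]
  have hT : casimirTensor (cx (metric p q)) (D₂.compl₁₂ φ φ)
      = casimirTensor (cx (metric p q)) D₂ :=
    casimirTensor_conj hd (cx_orthogonal hx) hg' (cx_mul_cx_inv hx) D₂ _ hD
  rw [← hT, ← sum_genF_eq_casimirTensor, casimirLeft]
  refine Finset.sum_congr rfl fun ν _ => Finset.sum_congr rfl fun μ _ => ?_
  have h := hJ.left_two (genF p q μ ν) (genFDual p q μ ν) isSkew_genF (isSkew_genF.smul _)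
  rw [h, hD, genFDual, cx_smul, Matrix.mul_smul, Matrix.smul_mul, map_smul, smul_eq_mul]
  push_cast
  ring

end CasimirSums

/-! ### Derivatives on `Y_I` as derivatives along `𝔠_I`. -/

section Parametrisation

attribute [local instance] Matrix.linftyOpNormedRing Matrix.linftyOpNormedAlgebra

variable {p q : ℕ} {I : CartanLabel}

theorem isSkew_cartanGen (j : Fin 2) : IsSkew (metric p q) (cartanGen p q I j) := by
  have h : ∀ {X Y : Matrix (Fin (p + q + 2)) (Fin (p + q + 2)) ℝ}, IsSkew (metric p q) X →
      IsSkew (metric p q) Y → IsSkew (metric p q) (X - Y) := by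
    intro X Y hX hY
    simpa [sub_eq_add_neg] using hX.add (hY.smul (-1))
  have hv : ∀ {X Y : Matrix (Fin (p + q + 2)) (Fin (p + q + 2)) ℝ}, IsSkew (metric p q) X →
      IsSkew (metric p q) Y → IsSkew (metric p q) (![X, Y] j) := by
    intro X Y hX hY
    revert j
    exact Fin.forall_fin_two.2 ⟨hX, hY⟩
  have hF : ∀ μ ν, IsSkew (metric p q) (genF p q μ ν) := fun _ _ => isSkew_genF
  cases I
  case s0 => exact hv ((hF _ _).add (hF _ _)) (h (hF _ _) (hF _ _))
  case s2 => exact hv ((hF _ _).add (hF _ _)) (h (hF _ _) (hF _ _))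
  all_goals exact hv (hF _ _) (hF _ _)

theorem cartanTwist_mem_groupG : cartanTwist p q I ∈ groupG p q := by
  cases I
  case s2 => exact exp_mem_groupG (isSkew_genF.smul _)
  case s12 => exact exp_mem_groupG (isSkew_genF.smul _)
  case s02 => exact exp_mem_groupG ((isSkew_genF.smul _).add (isSkew_genF.smul _))
  all_goals exact one_mem_groupG

theorem param_mem_groupG (χ : Fin 2 → ℂ) : param p q I χ ∈ groupG p q := by
  refine mul_mem_groupG (exp_mem_groupG ?_) cartanTwist_mem_groupG
  rw [Fin.sum_univ_two]
  exact ((isSkew_cartanGen 0).smul _).add ((isSkew_cartanGen 1).smul _)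

/-- The parametrisations are normalised so that motion along the row `v_j` raises the coefficient of
`X_j` at unit speed and fixes the other one. -/
theorem cartanCoord_add (χ : Fin 2 → ℂ) (s : ℝ) (j k : Fin 2) :
    cartanCoord I (χ + s • cartanEps I j) k = cartanCoord I χ k + if k = j then s else 0 := by
  cases I <;> fin_cases j <;> fin_cases k <;>
    simp [cartanCoord, cartanEps, Complex.div_re, Complex.normSq] <;> ring

theorem contDiff_cartanCoord (k : Fin 2) : ContDiff ℝ ∞ fun χ => cartanCoord I χ k := by
  have hre : ContDiff ℝ ∞ Complex.re := Complex.reCLM.contDiff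
  have h0 : ContDiff ℝ ∞ fun χ : Fin 2 → ℂ => χ 0 := contDiff_apply ..
  have h1 : ContDiff ℝ ∞ fun χ : Fin 2 → ℂ => χ 1 := contDiff_apply ..
  cases I <;> fin_cases k <;> simp only [cartanCoord, Fin.zero_eta, Fin.mk_one,
    Matrix.cons_val_zero, Matrix.cons_val_one, Matrix.cons_val_fin_one] <;>
    fun_prop

theorem contDiff_exp {𝔸 : Type*} [NormedRing 𝔸] [NormedAlgebra ℝ 𝔸] [CompleteSpace 𝔸] :
    ContDiff ℝ ∞ (NormedSpace.exp : 𝔸 → 𝔸) :=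
  contDiff_iff_contDiffAt.2 fun x => (NormedSpace.exp_analytic (𝕂 := ℝ) x).contDiffAt

theorem contDiff_param : ContDiff ℝ ∞ (param p q I) := by
  refine ContDiff.mul (contDiff_exp.comp ?_) contDiff_const
  exact ContDiff.sum fun j _ => (contDiff_cartanCoord j).smul contDiff_const

variable (hc : Commute (cartanGen p q I 0) (cartanGen p q I 1))

include hc

/-- Commutativity of `𝔠_I` splits the increment off as a factor on the left, so directional
derivatives on `Y_I` become `rightAct` by the `X_j`. -/
theorem param_add (χ : Fin 2 → ℂ) (s : ℝ) (j : Fin 2) :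
    param p q I (χ + s • cartanEps I j)
      = NormedSpace.exp (s • cartanGen p q I j) * param p q I χ := by
  have hcomm : ∀ k l : Fin 2, Commute (cartanGen p q I k) (cartanGen p q I l) := by
    intro k l
    fin_cases k <;> fin_cases l
    · exact Commute.refl _
    · exact hc
    · exact hc.symm
    · exact Commute.refl _
  rw [param, param, ← mul_assoc, ← Matrix.exp_add_of_commute]
  · congr 2
    simp only [cartanCoord_add, add_smul, Finset.sum_add_distrib, ite_smul, zero_smul,
      Finset.sum_ite_eq', Finset.mem_univ, if_true]
    exact add_comm _ _
  · exact Commute.sum_right _ _ _ fun k _ => ((hcomm j k).smul_left _).smul_right _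

theorem partialChi_restrict (f : Matrix (Fin (p + q + 2)) (Fin (p + q + 2)) ℝ → ℂ) (i : Fin 2) :
    partialChi I i (restrict p q I f)
      = restrict p q I fun x => ∑ j, (cartanEps I)⁻¹ i j * rightAct f (cartanGen p q I j) x := by
  ext χ
  simp only [partialChi, restrict, param_add hc]
  rfl

end Parametrisation

end ConformalCasimir

namespace ConformalCasimir

open Matrix Filter Topology

section Regions

/-! ### The parameter regions -/

/-- The part of the strip `0 ≤ Im z ≤ π` on which `cosh` is injective and misses `±1`. -/
def coshStrip : Set ℂ :=
  {z | 0 ≤ z.im ∧ z.im ≤ Real.pi ∧ (z.im = 0 ∨ z.im = Real.pi → 0 < z.re)}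

/-- Regularity and all questions about branches of powers use only these properties, so the labels
need not be separated there. -/
theorem region_subset (I : CartanLabel) {χ : Fin 2 → ℂ} (h : χ ∈ region I) :
    (∀ i, χ i ∈ coshStrip) ∧ χ 0 ≠ χ 1 := by
  have hpi := Real.pi_pos
  rw [Fin.forall_fin_two]
  have hne : ∀ {z w : ℂ}, (z.re ≠ w.re ∨ z.im ≠ w.im) → z ≠ w := by
    rintro z w (h | h) rfl <;> exact h rfl
  cases I <;> simp only [region, Set.mem_ofPred_eq] at h
  case s0 =>
    obtain ⟨h1, h2, h3, h4, h5⟩ := h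
    exact ⟨⟨⟨by linarith, by linarith, by rintro (h | h) <;> linarith⟩,
      ⟨by linarith, by linarith, by rintro (h | h) <;> linarith⟩⟩, hne (Or.inr (by linarith))⟩
  case s2 =>
    obtain ⟨h1, h2, h3, h4, h5⟩ := h
    exact ⟨⟨⟨by linarith, by linarith, by rintro (h | h) <;> linarith⟩,
      ⟨by linarith, by linarith, by rintro (h | h) <;> linarith⟩⟩, hne (Or.inr (by linarith))⟩
  case empty =>
    obtain ⟨h1, h2, h3, h4, h5⟩ := h
    exact ⟨⟨⟨by linarith, by linarith, by rintro (h | h) <;> linarith⟩,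
      ⟨by linarith, by linarith, by rintro (h | h) <;> linarith⟩⟩, hne (Or.inr (by linarith))⟩
  case s01 =>
    obtain ⟨h1, h2, h3, h4⟩ := h
    exact ⟨⟨⟨by linarith, by linarith, by rintro (h | h) <;> linarith⟩,
      ⟨by linarith, by linarith, by rintro (h | h) <;> linarith⟩⟩, hne (Or.inl (by linarith))⟩
  case s02 =>
    obtain ⟨h1, h2, h3, h4⟩ := h
    exact ⟨⟨⟨by linarith, by linarith, by rintro (h | h) <;> linarith⟩,
      ⟨by linarith, by linarith, by rintro (h | h) <;> linarith⟩⟩, hne (Or.inr (by linarith))⟩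
  case s12 =>
    obtain ⟨h1, h2, h3, h4⟩ := h
    exact ⟨⟨⟨by linarith, by linarith, by rintro (h | h) <;> linarith⟩,
      ⟨by linarith, by linarith, by rintro (h | h) <;> linarith⟩⟩, hne (Or.inl (by linarith))⟩
  all_goals
    obtain ⟨h1, h2, h3, h4, h5⟩ := h
    exact ⟨⟨⟨by linarith, by linarith, by rintro (h | h) <;> linarith⟩,
      ⟨by linarith, by linarith, by rintro (h | h) <;> linarith⟩⟩, hne (Or.inl (by linarith))⟩

/-- Equality would force `z ∈ πiℤ`, which within the strip leaves `0` and `πi`. Both lie on an edge,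
where the real part is positive. -/
theorem exp_sq_ne_one {z : ℂ} (hz : z ∈ coshStrip) : Complex.exp z ^ 2 ≠ 1 := by
  obtain ⟨h1, h2, h3⟩ := hz
  have hpi := Real.pi_pos
  rw [← Complex.exp_nat_mul, Ne, Complex.exp_eq_one_iff]
  rintro ⟨n, hn⟩
  have hre := congrArg Complex.re hn
  have him := congrArg Complex.im hn
  simp at hre him
  have hn0 : z.im = n * Real.pi := by linarith
  have : 0 ≤ n := by
    by_contra h
    have : (n : ℝ) ≤ -1 := by exact_mod_cast (by omega : n ≤ -1)
    nlinarith
  have : n ≤ 1 := by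
    by_contra h
    have : (2 : ℝ) ≤ n := by exact_mod_cast (by omega : 2 ≤ n)
    nlinarith
  have : 0 < z.re := by
    apply h3
    interval_cases n
    · left; simpa using hn0
    · right; simpa using hn0
  linarith

/-- Equality would give real parts with sum zero and imaginary parts with sum `0` or `2π`. Then both
points lie on one edge of the strip, where real parts are positive. -/
theorem exp_mul_exp_ne_one {z w : ℂ} (hz : z ∈ coshStrip) (hw : w ∈ coshStrip) :
    Complex.exp z * Complex.exp w ≠ 1 := by
  obtain ⟨h1, h2, h3⟩ := hz
  obtain ⟨k1, k2, k3⟩ := hw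
  have hpi := Real.pi_pos
  rw [← Complex.exp_add, Ne, Complex.exp_eq_one_iff]
  rintro ⟨n, hn⟩
  have hre := congrArg Complex.re hn
  have him := congrArg Complex.im hn
  simp at hre him
  have : 0 ≤ n := by
    by_contra h
    have : (n : ℝ) ≤ -1 := by exact_mod_cast (by omega : n ≤ -1)
    nlinarith
  have : n ≤ 1 := by
    by_contra h
    have : (2 : ℝ) ≤ n := by exact_mod_cast (by omega : 2 ≤ n)
    nlinarith
  interval_cases n
  · simp at him
    linarith [h3 (Or.inl (by linarith)), k3 (Or.inl (by linarith))]
  · simp at him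
    linarith [h3 (Or.inr (by linarith)), k3 (Or.inr (by linarith))]

theorem exp_ne_exp {z w : ℂ} (hz : z ∈ coshStrip) (hw : w ∈ coshStrip) (h : z ≠ w) :
    Complex.exp z ≠ Complex.exp w := by
  obtain ⟨h1, h2, h3⟩ := hz
  obtain ⟨k1, k2, k3⟩ := hw
  have hpi := Real.pi_pos
  intro he
  obtain ⟨n, hn⟩ := Complex.exp_eq_exp_iff_exists_int.1 he
  have hre := congrArg Complex.re hn
  have him := congrArg Complex.im hn
  simp at hre him
  have : -1 < n := by
    by_contra h
    have : (n : ℝ) ≤ -1 := by exact_mod_cast (by omega : n ≤ -1)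
    nlinarith
  have : n < 1 := by
    by_contra h
    have : (1 : ℝ) ≤ n := by exact_mod_cast (by omega : 1 ≤ n)
    nlinarith
  obtain rfl : n = 0 := by omega
  exact h (by simpa using hn)

/-- The signs by which the twist `t_I` changes the two components of the dilation. -/
def twistSign : CartanLabel → Fin 2 → ℂ
  | .s2 => ![-1, -1]
  | .s12 => ![-1, -1]
  | .s02 => ![-1, 1]
  | _ => ![1, 1]

/-- The values of `ε_1, ε_2` on the element of `𝔠_I` with parameters `χ`. -/
noncomputable def cartanValue (I : CartanLabel) (χ : Fin 2 → ℂ) (i : Fin 2) : ℂ :=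
  ∑ j, (cartanCoord I χ j : ℂ) * cartanEps I j i

/-- Where the twist sign is `1`, the value of `ε_i` is `χ_i - πi`; where it is `-1`, the value is
`χ_i`. Either way the effective parameter is `-exp (χ i)`. -/
theorem exp_cartanValue {I : CartanLabel} {χ : Fin 2 → ℂ} (h : χ ∈ region I) (i : Fin 2) :
    Complex.exp (cartanValue I χ i) * twistSign I i = -Complex.exp (χ i) := by
  have key : ∀ {z w c : ℂ}, z = w - Real.pi * Complex.I → c = 1 →
      Complex.exp z * c = -Complex.exp w := by
    rintro z w c rfl rfl
    rw [Complex.exp_sub, Complex.exp_pi_mul_I, div_neg, div_one, mul_one]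
  have key' : ∀ {z w c : ℂ}, z = w → c = -1 → Complex.exp z * c = -Complex.exp w := by
    rintro z w c rfl rfl
    rw [mul_neg_one]
  have hre : ∀ z : ℂ, (z / (2 * Complex.I)).re = z.im / 2 := by
    intro z
    rw [show z / (2 * Complex.I) = -(z * Complex.I) / 2 by
      field_simp; linear_combination z * Complex.I_sq]
    simp
  revert i
  rw [Fin.forall_fin_two]
  cases I <;> simp only [region, Set.mem_ofPred_eq] at h
  case s2 =>
    refine ⟨key' ?_ rfl, key' ?_ rfl⟩ <;>
      apply Complex.ext <;>
      simp [cartanValue, cartanCoord, cartanEps, hre] <;> linarith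
  case s12 =>
    refine ⟨key' ?_ rfl, key' ?_ rfl⟩ <;>
      apply Complex.ext <;>
      simp [cartanValue, cartanCoord, cartanEps] <;> linarith
  case s02 =>
    refine ⟨key' ?_ rfl, key ?_ rfl⟩ <;>
      apply Complex.ext <;>
      simp [cartanValue, cartanCoord, cartanEps] <;> linarith
  all_goals
    refine ⟨key ?_ rfl, key ?_ rfl⟩ <;>
      apply Complex.ext <;>
      simp [cartanValue, cartanCoord, cartanEps, hre] <;> linarith

end Regions

/-! ### Models adapted to a Cartan subset. -/

section CartanModel

variable {p q : ℕ}

/-- A model in which the Cartan subset `C_I` is diagonal up to the twist `T`. -/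
structure IsCartanModel (p q : ℕ) (I : CartanLabel) (K : Matrix (Fin (p + q + 2)) (Fin 4) ℂ)
    (L : Matrix (Fin 4) (Fin (p + q + 2)) ℂ) (U : Finset (Fin (p + q + 2))) (μ : ℂ)
    (T : Matrix (Fin 4) (Fin 4) ℂ) : Prop extends IsModel p q K L U μ where
  gen : ∀ j, cx (cartanGen p q I j) = ∑ i, cartanEps I j i • (K * stdH i * L)
  twist_mul : cx (cartanTwist p q I) * K = K * T
  mul_twist : L * cx (cartanTwist p q I) = T * L
  twist_stdR : ∀ i, T * stdR i 1 = stdR i (twistSign I i) * T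

/-- The exponential of `c₀ • stdH 0 + c₁ • stdH 1`. -/
noncomputable def expH (c : Fin 2 → ℂ) : Matrix (Fin 4) (Fin 4) ℂ :=
  diagonal ![Complex.exp ((c 0 + c 1) / 2), Complex.exp ((c 0 - c 1) / 2),
    Complex.exp ((-c 0 + c 1) / 2), Complex.exp ((-c 0 - c 1) / 2)]

section

attribute [local instance] Matrix.linftyOpNormedRing Matrix.linftyOpNormedAlgebra

theorem cx_exp {n : Type*} [Fintype n] [DecidableEq n] (X : Matrix n n ℝ) :
    cx (NormedSpace.exp X) = NormedSpace.exp (cx X) :=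
  NormedSpace.map_exp (algebraMap ℝ ℂ).mapMatrix
    (continuous_id.matrix_map Complex.continuous_ofReal) X

end

theorem exp_stdH (c : Fin 2 → ℂ) : NormedSpace.exp (∑ i, c i • stdH i) = expH c := by
  have h : ∑ i, c i • stdH i = diagonal ![(c 0 + c 1) / 2, (c 0 - c 1) / 2,
      (-c 0 + c 1) / 2, (-c 0 - c 1) / 2] := by
    ext a b
    fin_cases a <;> fin_cases b <;> simp [stdH, Fin.sum_univ_two] <;> ring
  rw [h, Matrix.exp_diagonal, expH]
  congr 1
  ext a
  rw [Pi.coe_exp]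
  fin_cases a <;> simp [Complex.exp_eq_exp_ℂ]

/-- Conjugation by the torus scales the two off-diagonal parts of factor `i` by `e^{c_i}` and
`e^{-c_i}`; the other factor is not affected. -/
theorem expH_mul_stdR (c : Fin 2 → ℂ) (i : Fin 2) (y : ℂ) :
    expH c * stdR i y = stdR i (Complex.exp (c i) * y) * expH c := by
  have h1 : Complex.exp ((c 0 + c 1) / 2) = Complex.exp (c 0) * Complex.exp ((-c 0 + c 1) / 2) := by
    rw [← Complex.exp_add]; ring_nf
  have h2 : Complex.exp ((c 0 - c 1) / 2) = Complex.exp (c 0) * Complex.exp ((-c 0 - c 1) / 2) := by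
    rw [← Complex.exp_add]; ring_nf
  have h3 : Complex.exp ((c 0 + c 1) / 2) = Complex.exp (c 1) * Complex.exp ((c 0 - c 1) / 2) := by
    rw [← Complex.exp_add]; ring_nf
  have h4 : Complex.exp ((-c 0 + c 1) / 2) = Complex.exp (c 1) * Complex.exp ((-c 0 - c 1) / 2) := by
    rw [← Complex.exp_add]; ring_nf
  have e0 := Complex.exp_ne_zero (c 0)
  have e1 := Complex.exp_ne_zero (c 1)
  revert i
  rw [Fin.forall_fin_two]
  constructor
  · ext a b
    fin_cases a <;> fin_cases b <;> simp [expH, stdR, h1, h2, Matrix.diagonal_mul,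
      Matrix.mul_diagonal] <;> field_simp
  · ext a b
    fin_cases a <;> fin_cases b <;> simp [expH, stdR, h3, h4, Matrix.diagonal_mul,
      Matrix.mul_diagonal] <;> field_simp

namespace IsCartanModel

variable {I : CartanLabel} {K : Matrix (Fin (p + q + 2)) (Fin 4) ℂ}
  {L : Matrix (Fin 4) (Fin (p + q + 2)) ℂ} {U : Finset (Fin (p + q + 2))} {μ : ℂ}
  {T : Matrix (Fin 4) (Fin 4) ℂ} (hM : IsCartanModel p q I K L U μ T)

include hM

theorem commute : Commute (cartanGen p q I 0) (cartanGen p q I 1) := by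
  apply Matrix.map_injective (f := algebraMap ℝ ℂ) Complex.ofReal_injective
  have hH : stdH 0 * stdH 1 = stdH 1 * stdH 0 := by
    ext a b
    fin_cases a <;> fin_cases b <;> simp [stdH]
  change cx (_ * _) = cx (_ * _)
  rw [cx_mul, cx_mul, hM.gen, hM.gen]
  simp only [Fin.sum_univ_two, Matrix.add_mul, Matrix.mul_add, Matrix.smul_mul, Matrix.mul_smul,
    hM.mul_mul, hH]
  module

theorem cx_sum_gen (χ : Fin 2 → ℂ) :
    cx (∑ j, cartanCoord I χ j • cartanGen p q I j)
      = K * (∑ i, cartanValue I χ i • stdH i) * L := by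
  simp only [cartanValue, Fin.sum_univ_two, cx_add, cx_smul, hM.gen, Matrix.mul_add,
    Matrix.add_mul, Matrix.mul_smul, Matrix.smul_mul, smul_add, smul_smul, add_smul]
  abel

theorem cx_param_mul (χ : Fin 2 → ℂ) :
    cx (param p q I χ) * K = K * (expH (cartanValue I χ) * T) := by
  have h : cx (∑ j, cartanCoord I χ j • cartanGen p q I j) * K
      = K * (∑ i, cartanValue I χ i • stdH i) := by
    rw [hM.cx_sum_gen, Matrix.mul_assoc, hM.left_inv, Matrix.mul_one]
  rw [param, cx_mul, Matrix.mul_assoc, hM.twist_mul, ← Matrix.mul_assoc, cx_exp,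
    exp_mul_eq_mul_exp h, exp_stdH, Matrix.mul_assoc]

theorem mul_cx_param (χ : Fin 2 → ℂ) :
    L * cx (param p q I χ) = expH (cartanValue I χ) * T * L := by
  have h : (∑ i, cartanValue I χ i • stdH i) * L
      = L * cx (∑ j, cartanCoord I χ j • cartanGen p q I j) := by
    rw [hM.cx_sum_gen, ← Matrix.mul_assoc, ← Matrix.mul_assoc, hM.left_inv, Matrix.one_mul]
  rw [param, cx_mul, ← Matrix.mul_assoc, cx_exp, ← exp_mul_eq_mul_exp h, exp_stdH,
    Matrix.mul_assoc, hM.mul_twist, ← Matrix.mul_assoc]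

/-- The twist supplies the sign and the torus the exponential. Apart from group membership this is
all that the general-position and radial computations need to know about the point. -/
theorem param_stdR {χ : Fin 2 → ℂ} (hχ : χ ∈ region I) (i : Fin 2) :
    cx (param p q I χ) * (K * stdR i 1 * L)
      = K * stdR i (-Complex.exp (χ i)) * L * cx (param p q I χ) := by
  calc cx (param p q I χ) * (K * stdR i 1 * L)
      = cx (param p q I χ) * K * (stdR i 1 * L) := by simp only [Matrix.mul_assoc]
    _ = K * (expH (cartanValue I χ) * (T * stdR i 1)) * L := by
        rw [hM.cx_param_mul]; simp only [Matrix.mul_assoc]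
    _ = K * (expH (cartanValue I χ) * stdR i (twistSign I i) * T) * L := by
        rw [hM.twist_stdR, Matrix.mul_assoc (expH _)]
    _ = K * stdR i (-Complex.exp (χ i)) * (expH (cartanValue I χ) * T * L) := by
        rw [expH_mul_stdR, exp_cartanValue hχ]; simp only [Matrix.mul_assoc]
    _ = _ := by rw [← hM.mul_cx_param]; simp only [Matrix.mul_assoc]

end IsCartanModel

end CartanModel

end ConformalCasimir

namespace ConformalCasimir

open Matrix Filter Topology

/-! ### The four points as pure tensors. -/

section GeneralPosition

variable {p q : ℕ}

/-- The summands act on separate tensor factors with eigenvalues `±1/2`, so the eigenvalue `ε = ±1`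
requires `ε/2` in both. The eigenline is spanned by `(a, ε) ⊗ (b, ε)`. -/
theorem stdR_add_eigenvector {a b ε : ℂ} (ha : a ≠ 0) (hb : b ≠ 0) (hε : ε * ε = 1)
    {v : Fin 4 → ℂ} (hv : (stdR 0 a + stdR 1 b) *ᵥ v = ε • v) :
    v = v 3 • ![a * b, ε * a, ε * b, 1] := by
  have h0 := congrFun hv 0
  have h1 := congrFun hv 1
  have h2 := congrFun hv 2
  have h3 := congrFun hv 3
  simp [stdR, Matrix.mulVec, dotProduct, Fin.sum_univ_four] at h0 h1 h2 h3
  field_simp at h0 h1 h2 h3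
  have e0 : v 0 = a * b * v 3 := by
    linear_combination (a * b * v 3 - v 0) * hε + ε / 2 * (h3 - h0)
  have e1 : v 1 = ε * a * v 3 := mul_left_cancel₀ hb (by
    linear_combination (-(b * v 1)) * hε - ε / 2 * h1 + ε / 2 * e0)
  have e2 : v 2 = ε * b * v 3 := mul_left_cancel₀ ha (by
    linear_combination (-(a * v 2)) * hε - ε / 2 * h2 + ε / 2 * e0)
  ext i
  fin_cases i <;> simp [e0, e1, e2] <;> ring

namespace IsModel

variable {K : Matrix (Fin (p + q + 2)) (Fin 4) ℂ} {L : Matrix (Fin 4) (Fin (p + q + 2)) ℂ}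
  {U : Finset (Fin (p + q + 2))} {μ : ℂ} (hM : IsModel p q K L U μ)

include hM

/-- An eigenvector with nonzero eigenvalue lies in the image of the operator, hence in the range of
`K`, and the four-dimensional statement applies. -/
theorem exists_eigenvector {a b ε : ℂ} (ha : a ≠ 0) (hb : b ≠ 0) (hε : ε * ε = 1)
    {z : Fin (p + q + 2) → ℂ} (hz : (K * (stdR 0 a + stdR 1 b) * L) *ᵥ z = ε • z) (hz0 : z ≠ 0) :
    ∃ κ : ℂ, κ ≠ 0 ∧ z = κ • K *ᵥ ![a * b, ε * a, ε * b, 1] := by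
  have h1 : z = K *ᵥ (ε • (stdR 0 a + stdR 1 b) *ᵥ (L *ᵥ z)) := by
    rw [Matrix.mulVec_smul, Matrix.mulVec_mulVec, Matrix.mulVec_mulVec, hz, smul_smul, hε,
      one_smul]
  have h2 : L *ᵥ z = ε • (stdR 0 a + stdR 1 b) *ᵥ (L *ᵥ z) := by
    conv_lhs => rw [h1, Matrix.mulVec_mulVec, hM.left_inv, Matrix.one_mulVec]
  have h3 : (stdR 0 a + stdR 1 b) *ᵥ (L *ᵥ z) = ε • (L *ᵥ z) := by
    conv_rhs => rw [h2, smul_smul, hε, one_smul]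
  have h4 : z = (L *ᵥ z) 3 • K *ᵥ ![a * b, ε * a, ε * b, 1] := by
    rw [← h2, stdR_add_eigenvector ha hb hε h3, Matrix.mulVec_smul] at h1
    exact h1
  refine ⟨_, fun h => hz0 ?_, h4⟩
  rw [h4, h, zero_smul]

theorem dotProduct_mulVec_K (v w : Fin 4 → ℂ) :
    (K *ᵥ v) ⬝ᵥ (cx (metric p q) *ᵥ (K *ᵥ w)) = μ * (v ⬝ᵥ (stdJ *ᵥ w)) := by
  rw [← Matrix.vecMul_transpose, ← Matrix.dotProduct_mulVec, Matrix.mulVec_mulVec, hM.form,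
    Matrix.smul_mulVec, Matrix.mulVec_mulVec, Matrix.mul_assoc, hM.left_inv, Matrix.mul_one,
    dotProduct_smul, smul_eq_mul]

/-- The vectors `e_0 ± e_{d+1}` are eigenvectors of the dilation for `±1`, and their images under
`x` are eigenvectors of its conjugate, so all four points are explicit pure tensors up to scalars.
Up to order and those scalars their pairings are multiples of `4`, `4 y₀ y₁`, `(1 + y₀)(1 + y₁)` and
`(1 - y₀)(1 - y₁)`; independence comes from `y₀ y₁ ≠ 1` and `y₀ ≠ y₁`. -/
theorem mem_tildeG {x : Matrix (Fin (p + q + 2)) (Fin (p + q + 2)) ℝ} (hx : x ∈ groupG p q)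
    {y : Fin 2 → ℂ} (hy : ∀ i, y i ≠ 0) (hy2 : ∀ i, y i ^ 2 ≠ 1)
    (hp : y 0 * y 1 ≠ 1) (hm : y 0 ≠ y 1)
    (hR : ∀ i, cx x * (K * stdR i 1 * L) = K * stdR i (-y i) * L * cx x) : x ∈ tildeG p q := by
  have hp1 : ∀ i, 1 + y i ≠ 0 := fun i h => hy2 i (by linear_combination (y i - 1) * h)
  have hm1 : ∀ i, 1 - y i ≠ 0 := fun i h => hy2 i (by linear_combination (-y i - 1) * h)
  have hxD : cx x * cx (dilation p q) = K * (stdR 0 (-y 0) + stdR 1 (-y 1)) * L * cx x := by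
    rw [hM.dil, Matrix.mul_add, Matrix.add_mul, Matrix.mul_add, hR, hR, Matrix.mul_add,
      Matrix.add_mul, Matrix.add_mul]
  let o : ℝ → Fin (p + q + 2) → ℝ := fun ε => stdVec p q 0 + ε • stdVec p q (p + q + 1)
  have ho : ∀ ε, dilation p q *ᵥ o ε = stdVec p q (p + q + 1) + ε • stdVec p q 0 := by
    intro ε
    rw [Matrix.mulVec_add, Matrix.mulVec_smul, dilation_mulVec_zero, dilation_mulVec_last]
  have ho' : ∀ ε, ε * ε = 1 → dilation p q *ᵥ o ε = ε • o ε := by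
    intro ε hε
    rw [ho, smul_add, smul_smul, hε, one_smul]
    exact add_comm _ _
  have ho0 : ∀ ε, o ε ≠ 0 := by
    intro ε h
    have := congrFun h 0
    simp [o, stdVec] at this
  let c : (Fin (p + q + 2) → ℝ) → Fin (p + q + 2) → ℂ := fun v i => (v i : ℂ)
  have hc0 : ∀ v, v ≠ 0 → c v ≠ 0 := by
    intro v hv h
    apply hv
    ext i
    simpa [c] using congrFun h i
  have hcm : ∀ (A : Matrix (Fin (p + q + 2)) (Fin (p + q + 2)) ℝ) v, c (A *ᵥ v) = cx A *ᵥ c v := by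
    intro A v
    ext i
    simp [c, Matrix.mulVec, dotProduct]
  have hcs : ∀ (r : ℝ) v, c (r • v) = (r : ℂ) • c v := by
    intro r v; ext i; simp [c]
  have hform : ∀ v w, ((ConformalCasimir.form p q v w : ℝ) : ℂ)
      = c v ⬝ᵥ (cx (metric p q) *ᵥ c w) := by
    intro v w
    rw [← hcm, ConformalCasimir.form]
    simp [c, dotProduct]
  have h1 : ∀ ε : ℝ, ε * ε = 1 → ∃ κ : ℂ, κ ≠ 0 ∧ c (o ε) = κ • K *ᵥ ![1, ε, ε, 1] := by
    intro ε hε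
    have := hM.exists_eigenvector (a := 1) (b := 1) (ε := ε) (z := c (o ε)) one_ne_zero
      one_ne_zero (by exact_mod_cast hε) (by rw [← hM.dil, ← hcm, ho' ε hε, hcs]) (hc0 _ (ho0 ε))
    simpa using this
  have h2 : ∀ ε : ℝ, ε * ε = 1 → ∃ κ : ℂ, κ ≠ 0 ∧
      c (x *ᵥ o ε) = κ • K *ᵥ ![y 0 * y 1, -(ε * y 0), -(ε * y 1), 1] := by
    intro ε hε
    have hx0 : x *ᵥ o ε ≠ 0 := by
      intro h
      have h' := congrArg (fun v => (metric p q * xᵀ * metric p q) *ᵥ v) h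
      simp only [Matrix.mulVec_mulVec, inv_eq_of_mem (groupG_subset hx), Matrix.one_mulVec,
        Matrix.mulVec_zero] at h'
      exact ho0 ε h'
    have := hM.exists_eigenvector (a := -y 0) (b := -y 1) (ε := ε) (z := c (x *ᵥ o ε))
      (neg_ne_zero.2 (hy 0)) (neg_ne_zero.2 (hy 1)) (by exact_mod_cast hε)
      (by rw [hcm, Matrix.mulVec_mulVec, ← hxD, ← Matrix.mulVec_mulVec, ← hcm, ho' ε hε, hcs,
        Matrix.mulVec_smul]) (hc0 _ hx0)
    simpa using this
  obtain ⟨κ₀, hκ₀, e₀⟩ := h1 1 (by norm_num)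
  obtain ⟨κ₁, hκ₁, e₁⟩ := h1 (-1) (by norm_num)
  obtain ⟨κ₂, hκ₂, e₂⟩ := h2 1 (by norm_num)
  obtain ⟨κ₃, hκ₃, e₃⟩ := h2 (-1) (by norm_num)
  let κ : Fin 4 → ℂ := ![κ₀, κ₁, κ₂, κ₃]
  let w : Fin 4 → Fin 4 → ℂ := ![![1, 1, 1, 1], ![1, -1, -1, 1], ![y 0 * y 1, -y 0, -y 1, 1],
    ![y 0 * y 1, y 0, y 1, 1]]
  have hκ : ∀ i, κ i ≠ 0 := by
    intro i; fin_cases i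
    exacts [hκ₀, hκ₁, hκ₂, hκ₃]
  have hF : ∀ i, c (fourPoints p q x i) = κ i • K *ᵥ w i := by
    intro i; fin_cases i
    · simpa [o, fourPoints, κ, w] using e₀
    · simpa [o, fourPoints, κ, w, sub_eq_add_neg] using e₁
    · simpa [o, fourPoints, κ, w] using e₂
    · simpa [o, fourPoints, κ, w, sub_eq_add_neg] using e₃
  refine ⟨hx, ?_, ?_⟩
  · rw [Fintype.linearIndependent_iff]
    intro g hg
    have hg1 : ∑ i, ((g i : ℂ) * κ i) • w i = 0 := by
      have h3 : ∑ i, ((g i : ℂ) * κ i) • K *ᵥ w i = 0 := by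
        have : c (∑ i, g i • fourPoints p q x i) = 0 := by rw [hg]; ext; simp [c]
        rw [← this]
        ext j
        have hj : ∀ i, (fourPoints p q x i j : ℂ) = κ i * (K *ᵥ w i) j :=
          fun i => congrFun (hF i) j
        simp [c, hj, mul_assoc]
      have h4 := congrArg (fun z => L *ᵥ z) h3
      simpa [Matrix.mulVec_sum, Matrix.mulVec_smul, Matrix.mulVec_mulVec, hM.left_inv,
        Matrix.mulVec_add] using h4
    have k0 := congrFun hg1 0
    have k1 := congrFun hg1 1
    have k2 := congrFun hg1 2
    have k3 := congrFun hg1 3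
    simp [Fin.sum_univ_four, w] at k0 k1 k2 k3
    have a1 : (g 2 : ℂ) * κ 2 + g 3 * κ 3 = 0 :=
      mul_left_cancel₀ (sub_ne_zero.2 hp) (by linear_combination k0 - k3)
    have a2 : (g 2 : ℂ) * κ 2 - g 3 * κ 3 = 0 :=
      mul_left_cancel₀ (sub_ne_zero.2 hm) (by linear_combination k2 - k1)
    have b3 : (g 3 : ℂ) * κ 3 = 0 := by linear_combination (a1 - a2) / 2
    have b2 : (g 2 : ℂ) * κ 2 = 0 := by linear_combination (a1 + a2) / 2
    have b1 : (g 1 : ℂ) * κ 1 = 0 := by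
      linear_combination (k3 - k1) / 2 - (1 + y 0) / 2 * b2 - (1 - y 0) / 2 * b3
    have b0 : (g 0 : ℂ) * κ 0 = 0 := by linear_combination k3 - b1 - b2 - b3
    intro i
    have : (g i : ℂ) * κ i = 0 := by
      fin_cases i
      exacts [b0, b1, b2, b3]
    exact_mod_cast (mul_eq_zero.1 this).resolve_right (hκ i)
  · intro i j hij h
    have h' := congrArg (fun r : ℝ => (r : ℂ)) h
    simp only [hform, hF, Matrix.mulVec_smul, dotProduct_smul, smul_dotProduct,
      hM.dotProduct_mulVec_K, smul_eq_mul, Complex.ofReal_zero] at h'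
    have h3 : w i ⬝ᵥ (stdJ *ᵥ w j) = 0 := by
      rcases mul_eq_zero.1 h' with h | h
      · exact absurd h (hκ j)
      rcases mul_eq_zero.1 h with h | h
      · exact absurd h (hκ i)
      exact (mul_eq_zero.1 h).resolve_left hM.ne_zero
    have p0 := hp1 0
    have p1 := hp1 1
    have m0 := hm1 0
    have m1 := hm1 1
    have hpp := mul_ne_zero p0 p1
    have hmm := mul_ne_zero m0 m1
    have hyy := mul_ne_zero (hy 0) (hy 1)
    have h4 : ∀ a b : Fin 4 → ℂ, a ⬝ᵥ (stdJ *ᵥ b) = a 0 * b 3 - a 1 * b 2 - a 2 * b 1 + a 3 * b 0 := by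
      intro a b
      simp [stdJ, dotProduct, Matrix.mulVec, Fin.sum_univ_four]
      ring
    rw [h4] at h3
    fin_cases i <;> fin_cases j <;> simp [w] at h3 hij <;>
      first
        | (norm_num at h3; done)
        | exact hpp (by linear_combination h3)
        | exact hmm (by linear_combination h3)
        | exact hyy (by linear_combination h3 / 4)

end IsModel

end GeneralPosition

/-! ### The radial part in the coordinates of `Y_I`. -/

section RadialPart

variable {p q : ℕ} {I : CartanLabel} {K : Matrix (Fin (p + q + 2)) (Fin 4) ℂ}
  {L : Matrix (Fin 4) (Fin (p + q + 2)) ℂ} {U : Finset (Fin (p + q + 2))} {μ : ℂ}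
  {T : Matrix (Fin 4) (Fin 4) ℂ} {α β : ℂ}
  {f : Matrix (Fin (p + q + 2)) (Fin (p + q + 2)) ℝ → ℂ}

theorem sum_posRoots {M : Type*} [AddCommMonoid M] (g : (Fin 2 → ℤ) → M) :
    ∑ γ ∈ posRoots, g γ = g ![1, 0] + (g ![0, 1] + (g ![1, 1] + (g ![1, -1]
      + (g ![2, 0] + g ![0, 2])))) := by
  rw [posRoots, Finset.sum_insert (by decide), Finset.sum_insert (by decide),
    Finset.sum_insert (by decide), Finset.sum_insert (by decide), Finset.sum_insert (by decide),
    Finset.sum_singleton]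

theorem invariantFun_posRoots (a b c : ℂ) :
    invariantFun a b c ![1, 0] = a ∧ invariantFun a b c ![0, 1] = a ∧
    invariantFun a b c ![1, 1] = b ∧ invariantFun a b c ![1, -1] = b ∧
    invariantFun a b c ![2, 0] = c ∧ invariantFun a b c ![0, 2] = c := by
  simp [invariantFun, rootNormSq]

/-- The operator `L(κ)` in terms of the exponentials of the coordinates. -/
theorem laplacian_eq (a b c : ℂ) (F : (Fin 2 → ℂ) → ℂ)
    (χ : Fin 2 → ℂ) :
    laplacian I (invariantFun a b c) F χ
      = ∑ i, (partialChi I i (partialChi I i F) χ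
          + (a * ((Complex.exp (χ i) + 1) / (Complex.exp (χ i) - 1))
            + 2 * c * ((Complex.exp (χ i) + (Complex.exp (χ i))⁻¹)
              / (Complex.exp (χ i) - (Complex.exp (χ i))⁻¹))) * partialChi I i F χ)
        + b * (cothPlus (fun i => Complex.exp (χ i)) * (partialChi I 0 F χ + partialChi I 1 F χ)
          + cothMinus (fun i => Complex.exp (χ i)) * (partialChi I 0 F χ - partialChi I 1 F χ)) := by
  obtain ⟨k1, k2, k3, k4, k5, k6⟩ := invariantFun_posRoots a b c
  have e0 := Complex.exp_ne_zero (χ 0)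
  have e1 := Complex.exp_ne_zero (χ 1)
  have r1 : rootExp (-1) ![1, 0] χ = (Complex.exp (χ 0))⁻¹ := by
    rw [rootExp, ← Complex.exp_neg]; simp
  have r2 : rootExp (-1) ![0, 1] χ = (Complex.exp (χ 1))⁻¹ := by
    rw [rootExp, ← Complex.exp_neg]; simp
  have r3 : rootExp (-1) ![1, 1] χ = (Complex.exp (χ 0) * Complex.exp (χ 1))⁻¹ := by
    rw [rootExp, ← Complex.exp_add, ← Complex.exp_neg]; simp
  have r4 : rootExp (-1) ![1, -1] χ = Complex.exp (χ 1) / Complex.exp (χ 0) := by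
    rw [rootExp, ← Complex.exp_sub]
    congr 1
    simp; ring
  have r5 : rootExp (-1) ![2, 0] χ = (Complex.exp (χ 0) * Complex.exp (χ 0))⁻¹ := by
    rw [rootExp, ← Complex.exp_add, ← Complex.exp_neg]
    congr 1
    simp; ring
  have r6 : rootExp (-1) ![0, 2] χ = (Complex.exp (χ 1) * Complex.exp (χ 1))⁻¹ := by
    rw [rootExp, ← Complex.exp_add, ← Complex.exp_neg]
    congr 1
    simp; ring
  have q1 : ∀ y : ℂ, y ≠ 0 → (1 + y⁻¹) / (1 - y⁻¹) = (y + 1) / (y - 1) := by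
    intro y hy
    rw [← mul_div_mul_left (1 + y⁻¹) (1 - y⁻¹) hy, mul_add, mul_sub, mul_inv_cancel₀ hy, mul_one]
  have q2 : ∀ y : ℂ, y ≠ 0 → (y * y + 1) / (y * y - 1) = (y + y⁻¹) / (y - y⁻¹) := by
    intro y hy
    rw [← mul_div_mul_left (y + y⁻¹) (y - y⁻¹) hy, mul_add, mul_sub, mul_inv_cancel₀ hy]
  have q3 : ∀ y z : ℂ, y ≠ 0 → (1 + z / y) / (1 - z / y) = (y + z) / (y - z) := by
    intro y z hy
    rw [← mul_div_mul_left (1 + z / y) (1 - z / y) hy, mul_add, mul_sub, mul_div_cancel₀ _ hy,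
      mul_one]
  rw [laplacian, sum_posRoots]
  simp only [k1, k2, k3, k4, k5, k6, r1, r2, r3, r4, r5, r6, q1 _ e0, q1 _ e1,
    q1 _ (mul_ne_zero e0 e1), q1 _ (mul_ne_zero e0 e0), q1 _ (mul_ne_zero e1 e1), q2 _ e0, q2 _ e1,
    q3 _ _ e0, cothPlus, cothMinus, Fin.sum_univ_two]
  simp
  ring

/-- The roots `ε_1 ± ε_2` carry coefficient zero, so the potential separates. For each coordinate
the terms of `ε_i` and `2ε_i` combine over a common denominator in the variable `e^{z/2}`. -/
theorem potential_eq (α β : ℂ) {χ : Fin 2 → ℂ} (hy2 : ∀ i, Complex.exp (χ i) ^ 2 ≠ 1) :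
    potential α β χ = -∑ i, (α ^ 2 + β ^ 2 + α * β * (Complex.exp (χ i) + (Complex.exp (χ i))⁻¹))
      / (Complex.exp (χ i) - (Complex.exp (χ i))⁻¹) ^ 2 := by
  obtain ⟨k1, k2, k3, k4, k5, k6⟩ := invariantFun_posRoots (-(α * β)) 0 (-((α - β) / 2) ^ 2)
  have key : ∀ z : ℂ, Complex.exp z ^ 2 ≠ 1 →
      -(α * β) / (Complex.exp (z / 2) - Complex.exp (-(z / 2))) ^ 2
        + -((α - β) / 2) ^ 2 * 4 / (Complex.exp z - Complex.exp (-z)) ^ 2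
      = -((α ^ 2 + β ^ 2 + α * β * (Complex.exp z + (Complex.exp z)⁻¹))
        / (Complex.exp z - (Complex.exp z)⁻¹) ^ 2) := by
    intro z hz
    have hv : Complex.exp (z / 2) ≠ 0 := Complex.exp_ne_zero _
    have h2 : Complex.exp z = Complex.exp (z / 2) ^ 2 := by
      rw [← Complex.exp_nat_mul]; congr 1; push_cast; ring
    rw [Complex.exp_neg, Complex.exp_neg, h2]
    rw [h2] at hz
    generalize Complex.exp (z / 2) = v at hv hz
    have h1 : v ^ 2 - 1 ≠ 0 := fun h => hz (by linear_combination (v ^ 2 + 1) * h)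
    have h3 : v ^ 2 + 1 ≠ 0 := fun h => hz (by linear_combination (v ^ 2 - 1) * h)
    have d1 : v - v⁻¹ = (v ^ 2 - 1) / v := by field_simp
    have d2 : v ^ 2 - (v ^ 2)⁻¹ = (v ^ 2 - 1) * (v ^ 2 + 1) / v ^ 2 := by field_simp; ring
    rw [d1, d2]
    field_simp
    ring
  have h := congrArg₂ (· + ·) (key (χ 0) (hy2 0)) (key (χ 1) (hy2 1))
  rw [potential, sum_posRoots, Fin.sum_univ_two, neg_add]
  refine Eq.trans ?_ h
  simp only [coeffL, k1, k2, k3, k4, k5, k6, rootExp, rootNormSq]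
  have t : ∀ w : ℂ, 1 / 2 * (2 * w) = w := fun w => by ring
  have t' : ∀ w : ℂ, -(1 / 2) * (2 * w) = -w := fun w => by ring
  have s : ∀ w : ℂ, 1 / 2 * w = w / 2 := fun w => by ring
  have s' : ∀ w : ℂ, -(1 / 2) * w = -(w / 2) := fun w => by ring
  simp only [Matrix.cons_val_zero, Matrix.cons_val_one, Matrix.cons_val_fin_one, Int.cast_one,
    Int.cast_zero, Int.cast_ofNat, zero_mul, one_mul, add_zero, zero_add, t, t', s, s']
  norm_num
  ring

namespace IsCartanModel

variable (hM : IsCartanModel p q I K L U μ T)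

include hM

theorem param_mem_tildeG {χ : Fin 2 → ℂ} (hχ : χ ∈ region I) : param p q I χ ∈ tildeG p q := by
  obtain ⟨h1, h2⟩ := region_subset I hχ
  exact hM.toIsModel.mem_tildeG (param_mem_groupG χ) (y := fun i => Complex.exp (χ i))
    (fun i => Complex.exp_ne_zero _) (fun i => exp_sq_ne_one (h1 i))
    (exp_mul_exp_ne_one (h1 0) (h1 1)) (exp_ne_exp (h1 0) (h1 1) h2) (hM.param_stdR hχ)

/-- The combination of directional derivatives that defines `∂_{χ_i}` corresponds to `stdH i`,
whichever real form of the Cartan subalgebra `I` selects. -/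
theorem sum_inv_gen (i : Fin 2) :
    ∑ j, (cartanEps I)⁻¹ i j • cx (cartanGen p q I j) = K * stdH i * L := by
  have h := Matrix.nonsing_inv_mul _ (isUnit_det_cartanEps I)
  have h' : ∀ k, ∑ j, (cartanEps I)⁻¹ i j * cartanEps I j k = if i = k then 1 else 0 := by
    intro k
    rw [← Matrix.mul_apply, h, Matrix.one_apply]
  simp only [hM.gen, Finset.smul_sum, smul_smul]
  rw [Finset.sum_comm]
  simp only [← Finset.sum_smul, h', ite_smul, one_smul, zero_smul, Finset.sum_ite_eq,
    Finset.mem_univ, if_true]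

theorem partialChi_restrict_eq {χ : Fin 2 → ℂ}
    {D₁ : Matrix (Fin (p + q + 2)) (Fin (p + q + 2)) ℂ →ₗ[ℂ] ℂ}
    {D₂ : Matrix (Fin (p + q + 2)) (Fin (p + q + 2)) ℂ →ₗ[ℂ]
      Matrix (Fin (p + q + 2)) (Fin (p + q + 2)) ℂ →ₗ[ℂ] ℂ}
    (hJ : IsJet p q α β f (param p q I χ) D₁ D₂) (i : Fin 2) :
    partialChi I i (restrict p q I f) χ = D₁ (K * stdH i * L) := by
  rw [partialChi_restrict hM.commute, ← hM.sum_inv_gen, map_sum]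
  refine Finset.sum_congr rfl fun j _ => ?_
  rw [map_smul, smul_eq_mul, hJ.right_one _ (isSkew_cartanGen j)]

theorem partialChi_partialChi_restrict_eq {χ : Fin 2 → ℂ}
    {D₁ : Matrix (Fin (p + q + 2)) (Fin (p + q + 2)) ℂ →ₗ[ℂ] ℂ}
    {D₂ : Matrix (Fin (p + q + 2)) (Fin (p + q + 2)) ℂ →ₗ[ℂ]
      Matrix (Fin (p + q + 2)) (Fin (p + q + 2)) ℂ →ₗ[ℂ] ℂ}
    (hJ : IsJet p q α β f (param p q I χ) D₁ D₂) (i : Fin 2) :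
    partialChi I i (partialChi I i (restrict p q I f)) χ
      = D₂ (K * stdH i * L) (K * stdH i * L) := by
  rw [partialChi_restrict hM.commute, partialChi_restrict hM.commute, ← hM.sum_inv_gen]
  simp only [map_sum, map_smul, LinearMap.sum_apply, LinearMap.smul_apply, smul_eq_mul]
  refine Finset.sum_congr rfl fun j _ => ?_
  congr 1
  refine HasDerivAt.deriv (f := fun t : ℝ => ∑ k, (cartanEps I)⁻¹ i k * rightAct f
    (cartanGen p q I k) (NormedSpace.exp (t • cartanGen p q I j) * param p q I χ)) ?_
  exact HasDerivAt.fun_sum fun k _ =>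
    (hJ.right_two _ _ (isSkew_cartanGen k) (isSkew_cartanGen j)).const_mul _

section

attribute [local instance] Matrix.linftyOpNormedRing Matrix.linftyOpNormedAlgebra

theorem contDiffOn_restrict (hf : IsSpherical p q α β f) :
    ContDiffOn ℝ ∞ (restrict p q I f) (region I) :=
  hf.1.comp contDiff_param.contDiffOn fun _ => hM.param_mem_tildeG

end
theorem casimir_restrict (hd : 2 ≤ p + q) (hf : IsSpherical p q α β f) {χ : Fin 2 → ℂ}
    (hχ : χ ∈ region I) :
    restrict p q I (casimirLeft p q f) χ = restrict p q I (casimirRight p q f) χ ∧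
    restrict p q I (casimirLeft p q f) χ = laplacian I (multK (p + q)) (restrict p q I f) χ
      + potential α β χ * restrict p q I f χ := by
  have hx := hM.param_mem_tildeG hχ
  obtain ⟨h1, h2⟩ := region_subset I hχ
  obtain ⟨D₁, D₂, hJ⟩ := exists_isJet hf hx
  have hy2 := fun i => exp_sq_ne_one (h1 i)
  have hp := exp_mul_exp_ne_one (h1 0) (h1 1)
  have hm := exp_ne_exp (h1 0) (h1 1) h2
  refine ⟨(casimirLeft_eq hx hJ).trans (casimirRight_eq hJ).symm, (casimirLeft_eq hx hJ).trans ?_⟩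
  rw [casimirTensor_eq_radial hd hM.toIsModel hx hJ (y := fun i => Complex.exp (χ i))
    (fun i => Complex.exp_ne_zero _) hy2 hp hm (hM.param_stdR hχ), multK,
    laplacian_eq, potential_eq α β hy2]
  simp only [hM.partialChi_restrict_eq hJ, hM.partialChi_partialChi_restrict_eq hJ,
    Fin.sum_univ_two, restrict]
  push_cast
  ring

end IsCartanModel

end RadialPart

end ConformalCasimir

namespace ConformalCasimir

open Matrix

/-! ### Models supported on four coordinates. -/

section FourDimensional

variable {p q : ℕ}

/-- The isometric inclusion of a four-dimensional coordinate subspace. -/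
def inclusion (ι : Fin 4 → Fin (p + q + 2)) : Matrix (Fin (p + q + 2)) (Fin 4) ℂ :=
  Matrix.of fun i c => if i = ι c then 1 else 0

/-- The generators `F_{cd}` of the orthogonal algebra of the form `diag s`. -/
def fourF (s : Fin 4 → ℂ) (c d : Fin 4) : Matrix (Fin 4) (Fin 4) ℂ :=
  Matrix.of fun a b => (if a = c ∧ b = d then s d else 0) - if a = d ∧ b = c then s c else 0

variable {ι : Fin 4 → Fin (p + q + 2)} (hι : Function.Injective ι)

include hι

theorem inclusion_transpose_mul : (inclusion ι)ᵀ * inclusion ι = 1 := by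
  ext c d
  simp [inclusion, Matrix.mul_apply, Matrix.one_apply, hι.eq_iff, eq_comm]

theorem inclusion_mul_mul_transpose (A : Matrix (Fin 4) (Fin 4) ℂ) (c d : Fin 4) :
    (inclusion ι * A * (inclusion ι)ᵀ) (ι c) (ι d) = A c d := by
  simp [inclusion, Matrix.mul_apply, hι.eq_iff]

omit hι in
theorem inclusion_mul_apply_eq_zero {k : Type*} (A : Matrix (Fin 4) k ℂ)
    {i : Fin (p + q + 2)} (hi : ∀ c, i ≠ ι c) (j : k) : (inclusion ι * A) i j = 0 := by
  simp [inclusion, Matrix.mul_apply, hi]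

omit hι in
theorem mul_inclusion_transpose_apply_eq_zero {k : Type*} (A : Matrix k (Fin 4) ℂ)
    {i : Fin (p + q + 2)} (hi : ∀ c, i ≠ ι c) (j : k) : (A * (inclusion ι)ᵀ) j i = 0 := by
  simp [inclusion, Matrix.mul_apply, hi]

variable {s : Fin 4 → ℂ} (hs : ∀ c, (eta p (ι c) : ℂ) = s c)

include hs

theorem cx_genF_inclusion (c d : Fin 4) :
    cx (genF p q (ι c) (ι d)) = inclusion ι * fourF s c d * (inclusion ι)ᵀ := by
  ext i j
  by_cases hi : ∃ a, i = ι a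
  · by_cases hj : ∃ b, j = ι b
    · obtain ⟨a, rfl⟩ := hi
      obtain ⟨b, rfl⟩ := hj
      rw [inclusion_mul_mul_transpose hι]
      simp only [Matrix.map_apply, genF, fourF, Matrix.of_apply, Fin.val_inj, hι.eq_iff, ← hs]
      split_ifs <;> simp
    · have hj' : ∀ b, j ≠ ι b := not_exists.1 hj
      have hj2 : ∀ b, (j : ℕ) ≠ ι b := fun b h => hj' b (Fin.ext h)
      rw [mul_inclusion_transpose_apply_eq_zero _ hj']
      simp [genF, hj2]
  · have hi' : ∀ b, i ≠ ι b := not_exists.1 hi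
    have hi2 : ∀ b, (i : ℕ) ≠ ι b := fun b h => hi' b (Fin.ext h)
    rw [Matrix.mul_assoc, inclusion_mul_apply_eq_zero _ hi']
    simp [genF, hi2]

theorem metric_inclusion :
    cx (metric p q) = inclusion ι * diagonal s * (inclusion ι)ᵀ
      + diagonal fun i : Fin (p + q + 2) =>
        if i ∈ Finset.univ \ Finset.univ.image ι then (eta p i : ℂ) else 0 := by
  ext i j
  rw [cx_metric_eq_diagonal, Matrix.add_apply]
  by_cases hi : ∃ a, i = ι a
  · obtain ⟨a, rfl⟩ := hi
    by_cases hj : ∃ b, j = ι b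
    · obtain ⟨b, rfl⟩ := hj
      rw [inclusion_mul_mul_transpose hι]
      by_cases hab : a = b
      · subst hab; simp [hs]
      · simp [hab, hι.eq_iff]
    · have hj' : ∀ b, j ≠ ι b := not_exists.1 hj
      rw [mul_inclusion_transpose_apply_eq_zero _ hj', diagonal_apply_ne _ (hj' a).symm,
        diagonal_apply_ne _ (hj' a).symm, add_zero]
  · have hi' : ∀ b, i ≠ ι b := not_exists.1 hi
    have hi2 : ∀ b, ι b ≠ i := fun b => (hi' b).symm
    rw [Matrix.mul_assoc, inclusion_mul_apply_eq_zero _ hi', zero_add]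
    by_cases hij : i = j
    · subst hij; simp [hi2]
    · simp [hij]

variable {K₄ : Matrix (Fin 4) (Fin 4) ℂ} {μ : ℂ} (hμ : μ ≠ 0)
  (hform : K₄ᵀ * diagonal s * K₄ = μ • stdJ)

include hμ hform

omit hι hs in
theorem four_left_inv : (μ⁻¹ • (stdJ * K₄ᵀ * diagonal s)) * K₄ = 1 := by
  rw [Matrix.smul_mul, Matrix.mul_assoc, Matrix.mul_assoc, ← Matrix.mul_assoc K₄ᵀ, hform,
    Matrix.mul_smul, stdJ_mul_stdJ, smul_smul, inv_mul_cancel₀ hμ, one_smul]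

omit hι hs in
theorem inclusion_conj {X Z : Matrix (Fin 4) (Fin 4) ℂ} (h : X * K₄ = K₄ * Z) :
    inclusion ι * X * (inclusion ι)ᵀ
      = inclusion ι * K₄ * Z * (μ⁻¹ • (stdJ * K₄ᵀ * diagonal s) * (inclusion ι)ᵀ) := by
  have hR := mul_eq_one_comm.1 (four_left_inv hμ hform)
  generalize μ⁻¹ • (stdJ * K₄ᵀ * diagonal s) = L₄ at hR ⊢
  calc inclusion ι * X * (inclusion ι)ᵀ = inclusion ι * (X * (K₄ * L₄)) * (inclusion ι)ᵀ := by
        rw [hR, Matrix.mul_one]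
    _ = inclusion ι * (X * K₄) * L₄ * (inclusion ι)ᵀ := by simp only [Matrix.mul_assoc]
    _ = _ := by rw [h]; simp only [Matrix.mul_assoc]

/-- The relation `hform` already forces the left inverse of `K₄` and the decomposition of the
metric, so only it and the shape of the dilation remain to be checked in each case. -/
theorem isModel_of_four (h03 : ι 0 = ⟨0, by omega⟩) (h3 : ι 3 = ⟨p + q + 1, by omega⟩)
    (hdil : -fourF s 0 3 * K₄ = K₄ * (stdR 0 1 + stdR 1 1)) :
    IsModel p q (inclusion ι * K₄) (μ⁻¹ • (stdJ * K₄ᵀ * diagonal s) * (inclusion ι)ᵀ)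
      (Finset.univ \ Finset.univ.image ι) μ := by
  have hPP := inclusion_transpose_mul hι
  have hL := four_left_inv hμ hform
  have hR := mul_eq_one_comm.1 hL
  have hss : diagonal s * diagonal s = (1 : Matrix (Fin 4) (Fin 4) ℂ) := by
    rw [diagonal_mul_diagonal, ← diagonal_one]
    congr 1
    ext c
    rw [← hs]
    exact_mod_cast eta_mul_self p (ι c)
  refine ⟨?_, hμ, ?_, ?_, ?_, ?_, ?_⟩
  · rw [Matrix.mul_assoc, ← Matrix.mul_assoc _ (inclusion ι), hPP, Matrix.one_mul, hL]
  · have h1 : (inclusion ι)ᵀ * cx (metric p q) = diagonal s * (inclusion ι)ᵀ := by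
      rw [cx_metric_eq_diagonal]
      ext c j
      rw [Matrix.mul_diagonal, Matrix.diagonal_mul, Matrix.transpose_apply, ← hs]
      by_cases h : j = ι c
      · subst h; ring
      · simp [inclusion, h]
    rw [transpose_mul, Matrix.mul_assoc, h1, Matrix.smul_mul, Matrix.mul_smul, smul_smul,
      mul_inv_cancel₀ hμ, one_smul]
    simp only [← Matrix.mul_assoc]
    rw [stdJ_mul_stdJ, Matrix.one_mul]
  · conv_lhs => rw [metric_inclusion hι hs]
    congr 1
    have h2 : diagonal s = μ⁻¹ • (K₄ * stdJ * K₄ᵀ) := by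
      calc diagonal s = K₄ * (μ⁻¹ • (stdJ * K₄ᵀ * diagonal s)) * diagonal s := by
            rw [hR, Matrix.one_mul]
        _ = μ⁻¹ • (K₄ * stdJ * K₄ᵀ) := by
            rw [Matrix.mul_smul, Matrix.smul_mul, Matrix.mul_assoc, Matrix.mul_assoc _ (diagonal s),
              hss, Matrix.mul_one, Matrix.mul_assoc]
    rw [h2, Matrix.mul_smul, Matrix.smul_mul, transpose_mul]
    simp only [Matrix.mul_assoc]
  · intro u hu
    have hu' : ∀ c, ι c ≠ u := by simpa using hu
    have : (inclusion ι)ᵀ *ᵥ Pi.single u 1 = 0 := by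
      ext c
      simp [inclusion, (hu' c).symm]
    rw [← Matrix.mulVec_mulVec, this, Matrix.mulVec_zero]
  · rw [Finset.card_sdiff_of_subset (Finset.subset_univ _), Finset.card_image_of_injective _ hι]
    simp
  · have h := cx_genF_inclusion hι hs 0 3
    rw [h03, h3] at h
    rw [dilation, cx_neg, h, ← Matrix.neg_mul, ← Matrix.mul_neg, inclusion_conj hμ hform hdil]

theorem isCartanModel_of_four (h03 : ι 0 = ⟨0, by omega⟩) (h3 : ι 3 = ⟨p + q + 1, by omega⟩)
    (hdil : -fourF s 0 3 * K₄ = K₄ * (stdR 0 1 + stdR 1 1)) {I : CartanLabel}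
    {X : Fin 2 → Matrix (Fin 4) (Fin 4) ℂ}
    (hX : ∀ j, cx (cartanGen p q I j) = inclusion ι * X j * (inclusion ι)ᵀ)
    (hXK : ∀ j, X j * K₄ = K₄ * ∑ i, cartanEps I j i • stdH i)
    {t T : Matrix (Fin 4) (Fin 4) ℂ}
    (ht : cx (cartanTwist p q I) * inclusion ι = inclusion ι * t)
    (ht' : (inclusion ι)ᵀ * cx (cartanTwist p q I) = t * (inclusion ι)ᵀ)
    (htK : t * K₄ = K₄ * T) (hT : ∀ i, T * stdR i 1 = stdR i (twistSign I i) * T) :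
    IsCartanModel p q I (inclusion ι * K₄) (μ⁻¹ • (stdJ * K₄ᵀ * diagonal s) * (inclusion ι)ᵀ)
      (Finset.univ \ Finset.univ.image ι) μ T := by
  have hL := four_left_inv hμ hform
  refine ⟨isModel_of_four hι hs hμ hform h03 h3 hdil, fun j => ?_, ?_, ?_, hT⟩
  · rw [hX, inclusion_conj hμ hform (hXK j)]
    generalize μ⁻¹ • (stdJ * K₄ᵀ * diagonal s) * (inclusion ι)ᵀ = L
    simp only [Matrix.mul_sum, Matrix.sum_mul, Matrix.mul_smul, Matrix.smul_mul]
  · rw [← Matrix.mul_assoc, ht, Matrix.mul_assoc, htK, Matrix.mul_assoc]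
  · rw [Matrix.mul_assoc, ht', ← Matrix.mul_assoc, ← Matrix.mul_assoc T]
    congr 1
    have hR := mul_eq_one_comm.1 hL
    generalize μ⁻¹ • (stdJ * K₄ᵀ * diagonal s) = L₄ at hL hR ⊢
    calc L₄ * t = L₄ * (t * K₄) * L₄ := by
          rw [Matrix.mul_assoc, Matrix.mul_assoc t, hR, Matrix.mul_one]
      _ = _ := by rw [htK, ← Matrix.mul_assoc, hL, Matrix.one_mul]

omit hs hμ hform in
theorem exp_inclusion_conj {Z : Matrix (Fin (p + q + 2)) (Fin (p + q + 2)) ℂ}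
    {Y : Matrix (Fin 4) (Fin 4) ℂ} (h : Z = inclusion ι * Y * (inclusion ι)ᵀ) :
    NormedSpace.exp Z * inclusion ι = inclusion ι * NormedSpace.exp Y ∧
      (inclusion ι)ᵀ * NormedSpace.exp Z = NormedSpace.exp Y * (inclusion ι)ᵀ := by
  have hPP := inclusion_transpose_mul hι
  constructor
  · exact exp_mul_eq_mul_exp (by rw [h, Matrix.mul_assoc, hPP, Matrix.mul_one])
  · exact (exp_mul_eq_mul_exp (by
      rw [h, ← Matrix.mul_assoc, ← Matrix.mul_assoc, hPP, Matrix.one_mul])).symm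

end FourDimensional

/-! ### Explicit weight bases and twists. -/

section Labels

/-- The joint eigenvectors of `F_{01}` and `F_{23}` for the form `diag(1, 1, -1, -1)`. -/
def kEmpty : Matrix (Fin 4) (Fin 4) ℂ :=
  !![1, 0, 0, 1; Complex.I, 0, 0, -Complex.I; 0, Complex.I, -Complex.I, 0; 0, 1, 1, 0]

/-- Joint eigenvectors of the rotation `F_{01}` and the boost `F_{23}` for `diag(1, 1, 1, -1)`,
scaled so that the dilation becomes standard. Used for the labels `E` and `{1}`. -/
def kEuclid : Matrix (Fin 4) (Fin 4) ℂ :=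
  !![1, 0, 0, 1; Complex.I, 0, 0, -Complex.I; 0, -1, 1, 0; 0, 1, 1, 0]

/-- The analogue for `diag(1, -1, -1, -1)`, where `F_{23}` is the rotation and `F_{01}` the boost.
-/
def kPrime : Matrix (Fin 4) (Fin 4) ℂ :=
  !![0, 1, 1, 0; 0, -1, 1, 0; Complex.I, 0, 0, -Complex.I; 1, 0, 0, 1]

/-- Joint eigenvectors of `F_{01} + F_{23}` and `F_{02} - F_{13}` for `diag(1, 1, -1, -1)`; each of
the two acts in a single `sl(2)` factor. -/
def kZero : Matrix (Fin 4) (Fin 4) ℂ :=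
  !![1, Complex.I, Complex.I, 1; Complex.I, -1, 1, -Complex.I; -1, Complex.I, -Complex.I, 1;
    Complex.I, 1, 1, Complex.I]

/-- This is `kZero` with its middle columns exchanged, i.e. with the tensor factors swapped: the
labels `{0}` and `{2}` share `𝔠_I` but interchange `ε_1` and `ε_2`. -/
def kTwo : Matrix (Fin 4) (Fin 4) ℂ :=
  !![1, Complex.I, Complex.I, 1; Complex.I, 1, -1, -Complex.I; -1, -Complex.I, Complex.I, 1;
    Complex.I, 1, 1, Complex.I]

/-- Joint eigenvectors of the boosts `F_{02}` and `F_{13}`, shared by the labels `{0,1}`, `{0,2}`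
and `{1,2}`, which use the same generators with different twists. -/
def kSplit : Matrix (Fin 4) (Fin 4) ℂ :=
  !![1, 0, 0, 1; 0, -1, 1, 0; -1, 0, 0, 1; 0, 1, 1, 0]

/-- The twists in the weight bases: `tTwo` is the half turn in `kTwo`, `tSplit` the half turn in
`kSplit`, and `tSplit'` the quarter turn in `kSplit`. -/
def tTwo : Matrix (Fin 4) (Fin 4) ℂ :=
  !![0, 0, Complex.I, 0; 0, 0, 0, -Complex.I; -Complex.I, 0, 0, 0; 0, Complex.I, 0, 0]

def tSplit : Matrix (Fin 4) (Fin 4) ℂ :=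
  !![0, 0, 0, 1; 0, 0, -1, 0; 0, -1, 0, 0; 1, 0, 0, 0]

def tSplit' : Matrix (Fin 4) (Fin 4) ℂ :=
  !![0, 0, 1, 0; 0, 0, 0, 1; -1, 0, 0, 0; 0, -1, 0, 0]

/-- The rotation by `π` in the last two coordinates. -/
def halfTurn : Matrix (Fin 4) (Fin 4) ℂ := diagonal ![1, 1, -1, -1]

/-- The rotation by `π / 2` in the first two and in the last two coordinates. -/
def quarterTurn : Matrix (Fin 4) (Fin 4) ℂ :=
  !![0, 1, 0, 0; -1, 0, 0, 0; 0, 0, 0, -1; 0, 0, 1, 0]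

/-- The basis `kEmpty` diagonalises both rotations, so the exponential can be read off on the
diagonal. -/
theorem exp_rotation {φ ψ : ℂ} {t : Matrix (Fin 4) (Fin 4) ℂ}
    (ht : t * kEmpty = kEmpty * diagonal ![Complex.exp (Complex.I * φ), Complex.exp (Complex.I * ψ),
      Complex.exp (-(Complex.I * ψ)), Complex.exp (-(Complex.I * φ))]) :
    NormedSpace.exp (φ • fourF ![1, 1, -1, -1] 0 1 + ψ • fourF ![1, 1, -1, -1] 2 3) = t := by
  have h : (φ • fourF ![1, 1, -1, -1] 0 1 + ψ • fourF ![1, 1, -1, -1] 2 3) * kEmpty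
      = kEmpty * diagonal ![Complex.I * φ, Complex.I * ψ, -(Complex.I * ψ), -(Complex.I * φ)] := by
    ext a b
    fin_cases a <;> fin_cases b <;> simp [fourF, kEmpty, Matrix.mul_apply, Fin.sum_univ_four] <;>
      ring_nf <;> simp
  -- The columns of `kEmpty` are orthogonal with squared norm `2`, so its inverse is half its
  -- conjugate transpose.
  have hinv : kEmpty * ((1 / 2 : ℂ) • !![1, -Complex.I, 0, 0; 0, 0, -Complex.I, 1;
      0, 0, Complex.I, 1; 1, Complex.I, 0, 0]) = 1 := by
    ext a b
    fin_cases a <;> fin_cases b <;> simp [kEmpty, Matrix.mul_apply, Fin.sum_univ_four] <;>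
      ring_nf <;> simp
  have h1 := exp_mul_eq_mul_exp h
  have h2 : NormedSpace.exp (diagonal ![Complex.I * φ, Complex.I * ψ, -(Complex.I * ψ),
      -(Complex.I * φ)]) = diagonal ![Complex.exp (Complex.I * φ), Complex.exp (Complex.I * ψ),
      Complex.exp (-(Complex.I * ψ)), Complex.exp (-(Complex.I * φ))] := by
    rw [Matrix.exp_diagonal]
    congr 1
    ext a
    rw [Pi.coe_exp]
    fin_cases a <;> simp [Complex.exp_eq_exp_ℂ]
  rw [h2, ← ht] at h1
  have h3 := congrArg (· * ((1 / 2 : ℂ) • !![1, -Complex.I, 0, 0; 0, 0, -Complex.I, 1;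
      0, 0, Complex.I, 1; 1, Complex.I, 0, 0])) h1
  simpa only [Matrix.mul_assoc, hinv, Matrix.mul_one] using h3

theorem exp_rotation_pi :
    NormedSpace.exp ((0 : ℂ) • fourF ![1, 1, -1, -1] 0 1
      + (Real.pi : ℂ) • fourF ![1, 1, -1, -1] 2 3) = halfTurn := by
  refine exp_rotation ?_
  have h1 : Complex.exp (Complex.I * Real.pi) = -1 := by rw [mul_comm, Complex.exp_pi_mul_I]
  have h2 : Complex.exp (-(Complex.I * Real.pi)) = -1 := by rw [Complex.exp_neg, h1]; norm_num
  rw [h1, h2]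
  ext a b
  fin_cases a <;> fin_cases b <;> simp [kEmpty, halfTurn, Matrix.diagonal_mul, Matrix.mul_diagonal]

theorem exp_rotation_pi_div_two :
    NormedSpace.exp (((Real.pi / 2 : ℝ) : ℂ) • fourF ![1, 1, -1, -1] 0 1
      + ((Real.pi / 2 : ℝ) : ℂ) • fourF ![1, 1, -1, -1] 2 3)
      = quarterTurn := by
  refine exp_rotation ?_
  have h1 : Complex.exp (Complex.I * (Real.pi / 2 : ℝ)) = Complex.I := by
    rw [mul_comm]; push_cast; exact Complex.exp_pi_div_two_mul_I
  have h2 : Complex.exp (-(Complex.I * (Real.pi / 2 : ℝ))) = -Complex.I := by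
    rw [Complex.exp_neg, h1, Complex.inv_I]
  rw [h1, h2]
  ext a b
  fin_cases a <;> fin_cases b <;> simp [kEmpty, quarterTurn, Matrix.mul_apply, Fin.sum_univ_four]

variable {p q : ℕ}

/-- The coordinates `0, a, b, d + 1`. -/
def coords (p q a b : ℕ) (c : Fin 4) : Fin (p + q + 2) :=
  Fin.ofNat (p + q + 2) ((![0, a, b, p + q + 1] : Fin 4 → ℕ) c)

section Coords

variable {a b : ℕ} (ha : 0 < a) (hab : a < b) (hb : b < p + q + 1)

include hab hb

theorem coords_val (c : Fin 4) :
    (coords p q a b c : ℕ) = (![0, a, b, p + q + 1] : Fin 4 → ℕ) c := by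
  rw [coords, Fin.val_ofNat, Nat.mod_eq_of_lt]
  fin_cases c <;> simp <;> omega

theorem eta_coords {u v : ℂ} (hu : (eta p a : ℂ) = u) (hv : (eta p b : ℂ) = v) (c : Fin 4) :
    (eta p (coords p q a b c) : ℂ) = (![1, u, v, -1] : Fin 4 → ℂ) c := by
  rw [coords_val hab hb]
  fin_cases c
  · simp [eta]
  · simp [hu]
  · simp [hv]
  · have : ¬p + q + 1 ≤ p := by omega
    simp [eta, this]

include ha

theorem coords_injective : Function.Injective (coords p q a b) := by
  intro c d h
  have h' := congrArg Fin.val h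
  rw [coords_val hab hb, coords_val hab hb] at h'
  fin_cases c <;> fin_cases d <;> simp at h' ⊢ <;> omega

end Coords

theorem eta_eq_one {a : ℕ} (h : a ≤ p) : (eta p a : ℂ) = 1 := by simp [eta, h]

theorem eta_eq_neg_one {a : ℕ} (h : p < a) : (eta p a : ℂ) = -1 := by
  simp [eta, Nat.not_le.2 h]

theorem one_stdR (i : Fin 2) : (1 : Matrix (Fin 4) (Fin 4) ℂ) * stdR i 1
    = stdR i ((![1, 1] : Fin 2 → ℂ) i) * 1 := by
  fin_cases i <;> simp

end Labels

end ConformalCasimir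

namespace ConformalCasimir

open Matrix

/-! ### Entrywise checks of form, dilation and Cartan generators. -/

section Existence

variable {p q : ℕ}

theorem kEuclid_form : kEuclidᵀ * diagonal ![1, 1, 1, -1] * kEuclid = (2 : ℂ) • stdJ := by
  ext a b
  fin_cases a <;> fin_cases b <;>
    simp [kEuclid, stdJ, Matrix.mul_apply, Fin.sum_univ_four, diagonal_apply] <;> ring_nf

theorem kEuclid_dil : -fourF ![1, 1, 1, -1] 0 3 * kEuclid = kEuclid * (stdR 0 1 + stdR 1 1) := by
  ext a b
  fin_cases a <;> fin_cases b <;>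
    simp [kEuclid, fourF, stdR, Matrix.mul_apply, Fin.sum_univ_four] <;> ring_nf

theorem kEuclid_gen (j : Fin 2) :
    (![fourF ![1, 1, 1, -1] 0 1,
      fourF ![1, 1, 1, -1] 2 3] : Fin 2 → Matrix (Fin 4) (Fin 4) ℂ) j * kEuclid
      = kEuclid * ∑ i, (!![Complex.I, Complex.I; 1, -1] : Matrix (Fin 2) (Fin 2) ℂ) j i • stdH i := by
  revert j
  rw [Fin.forall_fin_two]
  constructor <;> ext a b <;> fin_cases a <;> fin_cases b <;>
    simp [kEuclid, fourF, stdH, Matrix.mul_apply, Fin.sum_univ_four] <;> ring_nf <;> simp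

theorem kPrime_form : kPrimeᵀ * diagonal ![1, -1, -1, -1] * kPrime = (-2 : ℂ) • stdJ := by
  ext a b
  fin_cases a <;> fin_cases b <;>
    simp [kPrime, stdJ, Matrix.mul_apply, Fin.sum_univ_four, diagonal_apply] <;> ring_nf

theorem kPrime_dil : -fourF ![1, -1, -1, -1] 0 3 * kPrime = kPrime * (stdR 0 1 + stdR 1 1) := by
  ext a b
  fin_cases a <;> fin_cases b <;>
    simp [kPrime, fourF, stdR, Matrix.mul_apply, Fin.sum_univ_four] <;> ring_nf

theorem kPrime_gen (j : Fin 2) :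
    (![fourF ![1, -1, -1, -1] 2 3,
      fourF ![1, -1, -1, -1] 0 1] : Fin 2 → Matrix (Fin 4) (Fin 4) ℂ) j * kPrime
      = kPrime * ∑ i, (!![Complex.I, Complex.I; 1, -1] : Matrix (Fin 2) (Fin 2) ℂ) j i • stdH i := by
  revert j
  rw [Fin.forall_fin_two]
  constructor <;> ext a b <;> fin_cases a <;> fin_cases b <;>
    simp [kPrime, fourF, stdH, Matrix.mul_apply, Fin.sum_univ_four] <;> ring_nf <;> simp

theorem kEmpty_form : kEmptyᵀ * diagonal ![1, 1, -1, -1] * kEmpty = (2 : ℂ) • stdJ := by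
  ext a b
  fin_cases a <;> fin_cases b <;>
    simp [kEmpty, stdJ, Matrix.mul_apply, Fin.sum_univ_four, diagonal_apply] <;> ring_nf

theorem kEmpty_dil : -fourF ![1, 1, -1, -1] 0 3 * kEmpty = kEmpty * (stdR 0 1 + stdR 1 1) := by
  ext a b
  fin_cases a <;> fin_cases b <;>
    simp [kEmpty, fourF, stdR, Matrix.mul_apply, Fin.sum_univ_four] <;> ring_nf

theorem kEmpty_gen (j : Fin 2) :
    (![fourF ![1, 1, -1, -1] 0 1,
      fourF ![1, 1, -1, -1] 2 3] : Fin 2 → Matrix (Fin 4) (Fin 4) ℂ) j * kEmpty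
      = kEmpty * ∑ i, (!![Complex.I, Complex.I; Complex.I, -Complex.I] : Matrix (Fin 2) (Fin 2) ℂ) j i • stdH i := by
  revert j
  rw [Fin.forall_fin_two]
  constructor <;> ext a b <;> fin_cases a <;> fin_cases b <;>
    simp [kEmpty, fourF, stdH, Matrix.mul_apply, Fin.sum_univ_four] <;> ring_nf <;> simp

theorem kZero_form : kZeroᵀ * diagonal ![1, 1, -1, -1] * kZero = (4 : ℂ) • stdJ := by
  ext a b
  fin_cases a <;> fin_cases b <;>
    simp [kZero, stdJ, Matrix.mul_apply, Fin.sum_univ_four, diagonal_apply] <;> ring_nf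

theorem kZero_dil : -fourF ![1, 1, -1, -1] 0 3 * kZero = kZero * (stdR 0 1 + stdR 1 1) := by
  ext a b
  fin_cases a <;> fin_cases b <;>
    simp [kZero, fourF, stdR, Matrix.mul_apply, Fin.sum_univ_four] <;> ring_nf

theorem kZero_gen (j : Fin 2) :
    (![fourF ![1, 1, -1, -1] 0 1 + fourF ![1, 1, -1, -1] 2 3,
      fourF ![1, 1, -1, -1] 0 2 - fourF ![1, 1, -1, -1] 1 3] : Fin 2 → Matrix (Fin 4) (Fin 4) ℂ) j * kZero
      = kZero * ∑ i, (!![2 * Complex.I, 0; 0, 2] : Matrix (Fin 2) (Fin 2) ℂ) j i • stdH i := by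
  revert j
  rw [Fin.forall_fin_two]
  constructor <;> ext a b <;> fin_cases a <;> fin_cases b <;>
    simp [kZero, fourF, stdH, Matrix.mul_apply, Fin.sum_univ_four] <;> ring_nf <;> simp

theorem kTwo_form : kTwoᵀ * diagonal ![1, 1, -1, -1] * kTwo = (4 : ℂ) • stdJ := by
  ext a b
  fin_cases a <;> fin_cases b <;>
    simp [kTwo, stdJ, Matrix.mul_apply, Fin.sum_univ_four, diagonal_apply] <;> ring_nf

theorem kTwo_dil : -fourF ![1, 1, -1, -1] 0 3 * kTwo = kTwo * (stdR 0 1 + stdR 1 1) := by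
  ext a b
  fin_cases a <;> fin_cases b <;>
    simp [kTwo, fourF, stdR, Matrix.mul_apply, Fin.sum_univ_four] <;> ring_nf

theorem kTwo_gen (j : Fin 2) :
    (![fourF ![1, 1, -1, -1] 0 1 + fourF ![1, 1, -1, -1] 2 3,
      fourF ![1, 1, -1, -1] 0 2 - fourF ![1, 1, -1, -1] 1 3] : Fin 2 → Matrix (Fin 4) (Fin 4) ℂ) j * kTwo
      = kTwo * ∑ i, (!![0, 2 * Complex.I; 2, 0] : Matrix (Fin 2) (Fin 2) ℂ) j i • stdH i := by
  revert j
  rw [Fin.forall_fin_two]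
  constructor <;> ext a b <;> fin_cases a <;> fin_cases b <;>
    simp [kTwo, fourF, stdH, Matrix.mul_apply, Fin.sum_univ_four] <;> ring_nf <;> simp

theorem kSplit_form : kSplitᵀ * diagonal ![1, 1, -1, -1] * kSplit = (2 : ℂ) • stdJ := by
  ext a b
  fin_cases a <;> fin_cases b <;>
    simp [kSplit, stdJ, Matrix.mul_apply, Fin.sum_univ_four, diagonal_apply] <;> ring_nf

theorem kSplit_dil : -fourF ![1, 1, -1, -1] 0 3 * kSplit = kSplit * (stdR 0 1 + stdR 1 1) := by
  ext a b
  fin_cases a <;> fin_cases b <;>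
    simp [kSplit, fourF, stdR, Matrix.mul_apply, Fin.sum_univ_four] <;> ring_nf

theorem kSplit_gen (j : Fin 2) :
    (![fourF ![1, 1, -1, -1] 0 2,
      fourF ![1, 1, -1, -1] 1 3] : Fin 2 → Matrix (Fin 4) (Fin 4) ℂ) j * kSplit
      = kSplit * ∑ i, (!![1, 1; 1, -1] : Matrix (Fin 2) (Fin 2) ℂ) j i • stdH i := by
  revert j
  rw [Fin.forall_fin_two]
  constructor <;> ext a b <;> fin_cases a <;> fin_cases b <;>
    simp [kSplit, fourF, stdH, Matrix.mul_apply, Fin.sum_univ_four] <;> ring_nf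

end Existence

end ConformalCasimir

namespace ConformalCasimir

open Matrix

/-! ### A Cartan model for every label. -/

section ExistenceOfModels

variable {p q : ℕ}

section

variable {a b : ℕ} (ha : 0 < a) (hab : a < b) (hb : b < p + q + 1) {u v : ℂ}
  (hu : (eta p a : ℂ) = u) (hv : (eta p b : ℂ) = v)

include ha hab hb hu hv

theorem cx_genF_coords (c d : Fin 4) {m n : ℕ} (hm : (![0, a, b, p + q + 1] : Fin 4 → ℕ) c = m)
    (hn : (![0, a, b, p + q + 1] : Fin 4 → ℕ) d = n) :
    cx (genF p q m n) = inclusion (coords p q a b) * fourF ![1, u, v, -1] c d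
      * (inclusion (coords p q a b))ᵀ := by
  have h := cx_genF_inclusion (coords_injective (p := p) (q := q) ha hab hb)
    (eta_coords hab hb hu hv) c d
  rwa [coords_val hab hb, coords_val hab hb, hm, hn] at h

theorem exists_isCartanModel_of_four {K₄ : Matrix (Fin 4) (Fin 4) ℂ} {μ : ℂ} (hμ : μ ≠ 0)
    (hform : K₄ᵀ * diagonal ![1, u, v, -1] * K₄ = μ • stdJ)
    (hdil : -fourF ![1, u, v, -1] 0 3 * K₄ = K₄ * (stdR 0 1 + stdR 1 1)) {I : CartanLabel}
    {E : Matrix (Fin 2) (Fin 2) ℂ} (hE : cartanEps I = E)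
    {X₀ X₁ : Matrix (Fin (p + q + 2)) (Fin (p + q + 2)) ℝ} (hX : cartanGen p q I = ![X₀, X₁])
    {Y₀ Y₁ : Matrix (Fin 4) (Fin 4) ℂ}
    (h₀ : cx X₀ = inclusion (coords p q a b) * Y₀ * (inclusion (coords p q a b))ᵀ)
    (h₁ : cx X₁ = inclusion (coords p q a b) * Y₁ * (inclusion (coords p q a b))ᵀ)
    (hY : ∀ j, (![Y₀, Y₁] : Fin 2 → Matrix (Fin 4) (Fin 4) ℂ) j * K₄
      = K₄ * ∑ i, E j i • stdH i)
    {t T : Matrix (Fin 4) (Fin 4) ℂ}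
    (ht : cx (cartanTwist p q I) * inclusion (coords p q a b) = inclusion (coords p q a b) * t ∧
      (inclusion (coords p q a b))ᵀ * cx (cartanTwist p q I)
        = t * (inclusion (coords p q a b))ᵀ)
    (htK : t * K₄ = K₄ * T) (hT : ∀ i, T * stdR i 1 = stdR i (twistSign I i) * T) :
    ∃ K L U μ T, IsCartanModel p q I K L U μ T := by
  have h0 : coords p q a b 0 = ⟨0, by omega⟩ := Fin.ext (coords_val hab hb 0)
  have h3 : coords p q a b 3 = ⟨p + q + 1, by omega⟩ := Fin.ext (coords_val hab hb 3)
  have hXY : ∀ j, cx (cartanGen p q I j) = inclusion (coords p q a b)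
      * (![Y₀, Y₁] : Fin 2 → Matrix (Fin 4) (Fin 4) ℂ) j * (inclusion (coords p q a b))ᵀ := by
    rw [hX]
    exact Fin.forall_fin_two.2 ⟨h₀, h₁⟩
  subst hE
  exact ⟨_, _, _, _, _, isCartanModel_of_four (coords_injective ha hab hb)
    (eta_coords hab hb hu hv) hμ hform h0 h3 hdil hXY hY ht.1 ht.2 htK hT⟩

theorem exists_isCartanModel_of_untwisted {K₄ : Matrix (Fin 4) (Fin 4) ℂ} {μ : ℂ} (hμ : μ ≠ 0)
    (hform : K₄ᵀ * diagonal ![1, u, v, -1] * K₄ = μ • stdJ)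
    (hdil : -fourF ![1, u, v, -1] 0 3 * K₄ = K₄ * (stdR 0 1 + stdR 1 1)) {I : CartanLabel}
    {E : Matrix (Fin 2) (Fin 2) ℂ} (hE : cartanEps I = E)
    {X₀ X₁ : Matrix (Fin (p + q + 2)) (Fin (p + q + 2)) ℝ} (hX : cartanGen p q I = ![X₀, X₁])
    {Y₀ Y₁ : Matrix (Fin 4) (Fin 4) ℂ}
    (h₀ : cx X₀ = inclusion (coords p q a b) * Y₀ * (inclusion (coords p q a b))ᵀ)
    (h₁ : cx X₁ = inclusion (coords p q a b) * Y₁ * (inclusion (coords p q a b))ᵀ)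
    (hY : ∀ j, (![Y₀, Y₁] : Fin 2 → Matrix (Fin 4) (Fin 4) ℂ) j * K₄
      = K₄ * ∑ i, E j i • stdH i)
    (ht : cartanTwist p q I = 1) (hτ : twistSign I = ![1, 1]) :
    ∃ K L U μ T, IsCartanModel p q I K L U μ T := by
  refine exists_isCartanModel_of_four ha hab hb hu hv hμ hform hdil hE hX h₀ h₁ hY (t := 1) (T := 1)
    ?_ ?_ ?_
  · rw [ht, cx_one, Matrix.one_mul, Matrix.mul_one, Matrix.one_mul, Matrix.mul_one]
    exact ⟨rfl, rfl⟩
  · rw [Matrix.one_mul, Matrix.mul_one]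
  · rw [hτ]; exact one_stdR

end

theorem exists_isCartanModel_euclid (hd : 2 < p + q) (hq : q = 0) :
    ∃ K L U μ T, IsCartanModel p q .euclid K L U μ T := by
  have hu : (eta p 1 : ℂ) = 1 := eta_eq_one (by omega)
  have hv : (eta p (p + q) : ℂ) = 1 := eta_eq_one (by omega)
  have hF := cx_genF_coords (q := q) one_pos (by omega) (by omega) hu hv
  exact exists_isCartanModel_of_untwisted one_pos (by omega) (by omega) hu hv two_ne_zero
    kEuclid_form kEuclid_dil (I := .euclid) rfl rfl (hF 0 1 rfl rfl) (hF 2 3 rfl rfl) kEuclid_gen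
    rfl rfl

/-- The hypotheses give `p ≥ 2`, so the coordinates `0, 1, 2, d + 1` carry `diag(1, 1, 1, -1)` and
the Euclidean four-dimensional data apply. -/
theorem exists_isCartanModel_s1 (hqp : q ≤ p) (hd : 2 < p + q) :
    ∃ K L U μ T, IsCartanModel p q .s1 K L U μ T := by
  have hu : (eta p 1 : ℂ) = 1 := eta_eq_one (by omega)
  have hv : (eta p 2 : ℂ) = 1 := eta_eq_one (by omega)
  have hF := cx_genF_coords (q := q) one_pos (by omega) (by omega) hu hv
  exact exists_isCartanModel_of_untwisted one_pos (by omega) (by omega) hu hv two_ne_zero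
    kEuclid_form kEuclid_dil (I := .s1) rfl rfl (hF 0 1 rfl rfl) (hF 2 3 rfl rfl) kEuclid_gen
    rfl rfl

/-- For `q ≥ 2` the last three coordinates are all negative, so `0, d - 1, d, d + 1` carry `diag(1,
-1, -1, -1)`. -/
theorem exists_isCartanModel_s1prime (hqp : q ≤ p) (hq : 2 ≤ q) :
    ∃ K L U μ T, IsCartanModel p q .s1prime K L U μ T := by
  have hu : (eta p (p + q - 1) : ℂ) = -1 := eta_eq_neg_one (by omega)
  have hv : (eta p (p + q) : ℂ) = -1 := eta_eq_neg_one (by omega)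
  have hF := cx_genF_coords (q := q) (by omega) (by omega) (by omega) hu hv
  exact exists_isCartanModel_of_untwisted (by omega) (by omega) (by omega) hu hv (by norm_num)
    kPrime_form kPrime_dil (I := .s1prime) rfl rfl (hF 2 3 rfl rfl) (hF 0 1 rfl rfl) kPrime_gen
    rfl rfl

section Split

variable (hqp : q ≤ p) (hd : 2 < p + q) (hq : 1 ≤ q)

include hqp hd hq

theorem cx_genF_split (c d : Fin 4) {m n : ℕ}
    (hm : (![0, 1, p + q, p + q + 1] : Fin 4 → ℕ) c = m)
    (hn : (![0, 1, p + q, p + q + 1] : Fin 4 → ℕ) d = n) :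
    cx (genF p q m n) = inclusion (coords p q 1 (p + q)) * fourF ![1, 1, -1, -1] c d
      * (inclusion (coords p q 1 (p + q)))ᵀ :=
  cx_genF_coords one_pos (by omega) (by omega) (eta_eq_one (by omega)) (eta_eq_neg_one (by omega))
    c d hm hn

theorem exists_isCartanModel_empty : ∃ K L U μ T, IsCartanModel p q .empty K L U μ T := by
  have hF := cx_genF_split hqp hd hq
  exact exists_isCartanModel_of_untwisted one_pos (by omega) (by omega) (eta_eq_one (by omega))
    (eta_eq_neg_one (by omega)) two_ne_zero kEmpty_form kEmpty_dil (I := .empty) rfl rfl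
    (hF 0 1 rfl rfl) (hF 2 3 rfl rfl) kEmpty_gen rfl rfl

theorem exists_isCartanModel_s01 : ∃ K L U μ T, IsCartanModel p q .s01 K L U μ T := by
  have hF := cx_genF_split hqp hd hq
  exact exists_isCartanModel_of_untwisted one_pos (by omega) (by omega) (eta_eq_one (by omega))
    (eta_eq_neg_one (by omega)) two_ne_zero kSplit_form kSplit_dil (I := .s01) rfl rfl
    (hF 0 2 rfl rfl) (hF 1 3 rfl rfl) kSplit_gen rfl rfl

theorem cx_genF_add_split :
    cx (genF p q 0 1 + genF p q (p + q) (p + q + 1)) = inclusion (coords p q 1 (p + q))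
      * (fourF ![1, 1, -1, -1] 0 1 + fourF ![1, 1, -1, -1] 2 3)
      * (inclusion (coords p q 1 (p + q)))ᵀ := by
  rw [cx_add, cx_genF_split hqp hd hq 0 1 (m := 0) (n := 1) rfl rfl, cx_genF_split hqp hd hq 2 3 (m := p + q) (n := p + q + 1) rfl rfl,
    Matrix.mul_add, Matrix.add_mul]

theorem cx_genF_sub_split :
    cx (genF p q 0 (p + q) - genF p q 1 (p + q + 1)) = inclusion (coords p q 1 (p + q))
      * (fourF ![1, 1, -1, -1] 0 2 - fourF ![1, 1, -1, -1] 1 3)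
      * (inclusion (coords p q 1 (p + q)))ᵀ := by
  rw [cx_sub, cx_genF_split hqp hd hq 0 2 (m := 0) (n := p + q) rfl rfl, cx_genF_split hqp hd hq 1 3 (m := 1) (n := p + q + 1) rfl rfl,
    Matrix.mul_sub, Matrix.sub_mul]

theorem exists_isCartanModel_s0 : ∃ K L U μ T, IsCartanModel p q .s0 K L U μ T :=
  exists_isCartanModel_of_untwisted one_pos (by omega) (by omega) (eta_eq_one (by omega))
    (eta_eq_neg_one (by omega)) (by norm_num) kZero_form kZero_dil (I := .s0) rfl rfl
    (cx_genF_add_split hqp hd hq) (cx_genF_sub_split hqp hd hq) kZero_gen rfl rfl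

theorem exp_pi_inclusion :
    cx (NormedSpace.exp (Real.pi • genF p q (p + q) (p + q + 1))) * inclusion (coords p q 1 (p + q))
      = inclusion (coords p q 1 (p + q)) * halfTurn ∧
    (inclusion (coords p q 1 (p + q)))ᵀ
        * cx (NormedSpace.exp (Real.pi • genF p q (p + q) (p + q + 1)))
      = halfTurn * (inclusion (coords p q 1 (p + q)))ᵀ := by
  rw [cx_exp, ← exp_rotation_pi]
  refine exp_inclusion_conj (coords_injective one_pos (by omega) (by omega)) ?_
  rw [cx_smul, cx_genF_split hqp hd hq 2 3 (m := p + q) (n := p + q + 1) rfl rfl, zero_smul, zero_add, Matrix.mul_smul,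
    Matrix.smul_mul]

theorem exp_pi_div_two_inclusion :
    cx (NormedSpace.exp ((Real.pi / 2) • genF p q 0 1
        + (Real.pi / 2) • genF p q (p + q) (p + q + 1))) * inclusion (coords p q 1 (p + q))
      = inclusion (coords p q 1 (p + q)) * quarterTurn ∧
    (inclusion (coords p q 1 (p + q)))ᵀ * cx (NormedSpace.exp ((Real.pi / 2) • genF p q 0 1
        + (Real.pi / 2) • genF p q (p + q) (p + q + 1)))
      = quarterTurn
        * (inclusion (coords p q 1 (p + q)))ᵀ := by
  rw [cx_exp, ← exp_rotation_pi_div_two]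
  refine exp_inclusion_conj (coords_injective one_pos (by omega) (by omega)) ?_
  rw [cx_add, cx_smul, cx_smul, cx_genF_split hqp hd hq 0 1 (m := 0) (n := 1) rfl rfl,
    cx_genF_split hqp hd hq 2 3 (m := p + q) (n := p + q + 1) rfl rfl]
  simp only [Matrix.mul_add, Matrix.add_mul, Matrix.mul_smul, Matrix.smul_mul]

theorem exists_isCartanModel_s2 : ∃ K L U μ T, IsCartanModel p q .s2 K L U μ T := by
  refine exists_isCartanModel_of_four one_pos (by omega) (by omega) (eta_eq_one (by omega))
    (eta_eq_neg_one (by omega)) (by norm_num) kTwo_form kTwo_dil (I := .s2) rfl rfl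
    (cx_genF_add_split hqp hd hq) (cx_genF_sub_split hqp hd hq) kTwo_gen
    (exp_pi_inclusion hqp hd hq) (T := tTwo) ?_ ?_
  · ext a b
    fin_cases a <;> fin_cases b <;>
      simp [kTwo, tTwo, halfTurn, Matrix.mul_apply, Fin.sum_univ_four, diagonal_apply]
  · rw [Fin.forall_fin_two]
    constructor <;> ext a b <;> fin_cases a <;> fin_cases b <;>
      simp [tTwo, stdR, twistSign, Matrix.mul_apply, Fin.sum_univ_four] <;> ring_nf

theorem exists_isCartanModel_s12 : ∃ K L U μ T, IsCartanModel p q .s12 K L U μ T := by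
  have hF := cx_genF_split hqp hd hq
  refine exists_isCartanModel_of_four one_pos (by omega) (by omega) (eta_eq_one (by omega))
    (eta_eq_neg_one (by omega)) two_ne_zero kSplit_form kSplit_dil (I := .s12) rfl rfl
    (hF 0 2 rfl rfl) (hF 1 3 rfl rfl) kSplit_gen (exp_pi_inclusion hqp hd hq) (T := tSplit) ?_ ?_
  · ext a b
    fin_cases a <;> fin_cases b <;>
      simp [kSplit, tSplit, halfTurn, Matrix.mul_apply, Fin.sum_univ_four, diagonal_apply]
  · rw [Fin.forall_fin_two]
    constructor <;> ext a b <;> fin_cases a <;> fin_cases b <;>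
      simp [tSplit, stdR, twistSign, Matrix.mul_apply, Fin.sum_univ_four] <;> ring_nf

theorem exists_isCartanModel_s02 : ∃ K L U μ T, IsCartanModel p q .s02 K L U μ T := by
  have hF := cx_genF_split hqp hd hq
  refine exists_isCartanModel_of_four one_pos (by omega) (by omega) (eta_eq_one (by omega))
    (eta_eq_neg_one (by omega)) two_ne_zero kSplit_form kSplit_dil (I := .s02) rfl rfl
    (hF 0 2 rfl rfl) (hF 1 3 rfl rfl) kSplit_gen (exp_pi_div_two_inclusion hqp hd hq)
    (T := tSplit') ?_ ?_
  · ext a b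
    fin_cases a <;> fin_cases b <;> simp [kSplit, tSplit', quarterTurn, Matrix.mul_apply,
      Fin.sum_univ_four]
  · rw [Fin.forall_fin_two]
    constructor <;> ext a b <;> fin_cases a <;> fin_cases b <;>
      simp [tSplit', stdR, twistSign, Matrix.mul_apply, Fin.sum_univ_four] <;> ring_nf

end Split

theorem exists_isCartanModel (hqp : q ≤ p) (hd : 2 < p + q) (I : CartanLabel) (hI : I.Occurs q) :
    ∃ K L U μ T, IsCartanModel p q I K L U μ T := by
  cases I
  case euclid => exact exists_isCartanModel_euclid hd hI
  case empty => exact exists_isCartanModel_empty hqp hd hI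
  case s0 => exact exists_isCartanModel_s0 hqp hd hI
  case s2 => exact exists_isCartanModel_s2 hqp hd hI
  case s1 => exact exists_isCartanModel_s1 hqp hd
  case s1prime => exact exists_isCartanModel_s1prime hqp hI
  case s01 => exact exists_isCartanModel_s01 hqp hd hI
  case s02 => exact exists_isCartanModel_s02 hqp hd hI
  case s12 => exact exists_isCartanModel_s12 hqp hd hI

end ExistenceOfModels

end ConformalCasimir

namespace ConformalCasimir

open Matrix

/-! ### Skew tensors of a given weight. -/

section WeightSpaces

variable {N : Type*} [DecidableEq N]

/-- The skew-symmetric tensors of weight `γ / 2` for a basis whose elements have weights `wt / 2`. -/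
def weightSpace (wt : N → Fin 2 → ℤ) (γ : Fin 2 → ℂ) : Submodule ℂ (Matrix N N ℂ) where
  carrier := {A | Aᵀ = -A ∧ ∀ i a b, ((wt a i : ℂ) / 2 + wt b i / 2) * A a b = γ i * A a b}
  add_mem' := by
    rintro A B ⟨hA, hA'⟩ ⟨hB, hB'⟩
    refine ⟨by rw [transpose_add, hA, hB, neg_add], fun i a b => ?_⟩
    rw [Matrix.add_apply, mul_add, mul_add, hA', hB']
  zero_mem' := by simp
  smul_mem' := by
    rintro c A ⟨hA, hA'⟩
    refine ⟨by rw [transpose_smul, hA, smul_neg], fun i a b => ?_⟩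
    rw [Matrix.smul_apply, smul_eq_mul, mul_left_comm, hA', mul_left_comm]

variable {wt : N → Fin 2 → ℤ} {γ : Fin 2 → ℂ}

theorem weightSpace_apply_eq_zero {A : Matrix N N ℂ} (hA : A ∈ weightSpace wt γ) {a b : N}
    (h : a ≠ b → ∃ i, (wt a i : ℂ) / 2 + wt b i / 2 ≠ γ i) : A a b = 0 := by
  by_cases hab : a = b
  · subst hab
    have := congrFun (congrFun hA.1 a) a
    simp only [transpose_apply, Matrix.neg_apply] at this
    linear_combination this / 2
  · obtain ⟨i, hi⟩ := h hab
    have := hA.2 i a b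
    exact (mul_eq_zero.1 (by linear_combination this :
      ((wt a i : ℂ) / 2 + wt b i / 2 - γ i) * A a b = 0)).resolve_left (sub_ne_zero.2 hi)

theorem exists_of_weightSpace_ne_bot (h : weightSpace wt γ ≠ ⊥) :
    ∃ a b, a ≠ b ∧ ∀ i, (wt a i : ℂ) / 2 + wt b i / 2 = γ i := by
  obtain ⟨A, hA, hA0⟩ := Submodule.exists_mem_ne_zero_of_ne_bot h
  by_contra! hc
  exact hA0 (by ext a b; exact weightSpace_apply_eq_zero hA fun hab => hc a b hab)

/-- A skew tensor of weight `γ` is determined by its entries at the unordered index pairs of that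
weight, and these entries are free. The maps `l`, `r` orient each pair; `hinj` and `hne` exclude
repetitions, also in reversed order, and `hne` with `k = m` gives `l k ≠ r k`. -/
theorem finrank_weightSpace {ι : Type*} [Fintype ι] [DecidableEq ι] (l r : ι → N)
    (hsum : ∀ k i, (wt (l k) i : ℂ) / 2 + wt (r k) i / 2 = γ i)
    (hinj : ∀ k m, l k = l m → r k = r m → k = m) (hne : ∀ k m, l k = r m → r k ≠ l m)
    (hex : ∀ a b, a ≠ b → (∀ i, (wt a i : ℂ) / 2 + wt b i / 2 = γ i) →
      ∃ k, (a = l k ∧ b = r k) ∨ (a = r k ∧ b = l k)) :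
    Module.finrank ℂ (weightSpace wt γ) = Fintype.card ι := by
  let φ : weightSpace wt γ →ₗ[ℂ] (ι → ℂ) :=
    { toFun := fun A k => A.1 (l k) (r k)
      map_add' := fun A B => rfl
      map_smul' := fun c A => rfl }
  have hφ : Function.Bijective φ := by
    constructor
    · rw [← LinearMap.ker_eq_bot, LinearMap.ker_eq_bot']
      rintro ⟨A, hA⟩ h
      have h0 : ∀ k, A (l k) (r k) = 0 := fun k => congrFun h k
      apply Subtype.ext
      ext a b
      by_cases hw : a ≠ b ∧ ∀ i, (wt a i : ℂ) / 2 + wt b i / 2 = γ i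
      · obtain ⟨k, ⟨rfl, rfl⟩ | ⟨rfl, rfl⟩⟩ := hex a b hw.1 hw.2
        · exact h0 k
        · have := congrFun (congrFun hA.1 (l k)) (r k)
          simp only [transpose_apply, Matrix.neg_apply, h0, neg_zero] at this
          exact this
      · refine weightSpace_apply_eq_zero hA fun hab => ?_
        by_contra! hc
        exact hw ⟨hab, hc⟩
    · intro v
      let A : Matrix N N ℂ := ∑ k, v k • (single (l k) (r k) 1 - single (r k) (l k) 1)
      have hA : ∀ a b, A a b = ∑ k, v k * ((if l k = a ∧ r k = b then 1 else 0)
          - if r k = a ∧ l k = b then 1 else 0) := by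
        intro a b
        simp [A, Matrix.sum_apply, single_apply]
      refine ⟨⟨A, ?_, fun i a b => ?_⟩, ?_⟩
      · ext a b
        rw [transpose_apply, Matrix.neg_apply, hA, hA, ← Finset.sum_neg_distrib]
        refine Finset.sum_congr rfl fun k _ => ?_
        simp only [and_comm]
        ring
      · rw [hA, Finset.mul_sum, Finset.mul_sum]
        refine Finset.sum_congr rfl fun k _ => ?_
        by_cases h1 : l k = a ∧ r k = b
        · obtain ⟨rfl, rfl⟩ := h1
          rw [hsum]
        · by_cases h2 : r k = a ∧ l k = b
          · obtain ⟨rfl, rfl⟩ := h2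
            rw [add_comm, hsum]
          · rw [if_neg h1, if_neg h2]; simp
      · ext m
        change A (l m) (r m) = v m
        rw [hA, Finset.sum_eq_single m]
        · have : ¬(r m = l m ∧ l m = r m) := fun h => hne m m h.2 h.1
          simp [this]
        · intro k _ hk
          rw [if_neg fun h => hk (hinj k m h.1 h.2), if_neg fun h => hne k m h.2 h.1]
          simp
        · simp
  rw [(LinearEquiv.ofBijective φ hφ).finrank_eq, Module.finrank_fintype_fun_eq_card]

/-- Twice the weights of the standard representation. -/
def stdWeight : Fin 4 → Fin 2 → ℤ := ![![1, 1], ![1, -1], ![-1, 1], ![-1, -1]]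

/-- Twice the weights of the sum of the standard representation and a trivial one. -/
def fullWeight (U : Type*) : Fin 4 ⊕ U → Fin 2 → ℤ := Sum.elim stdWeight fun _ => 0

variable {U : Type*} [Fintype U] [DecidableEq U]

theorem half_add_half_iff {m n k : Fin 2 → ℤ} :
    (∀ i, (m i : ℂ) / 2 + n i / 2 = (k i : ℂ) / 2) ↔ m + n = k := by
  rw [funext_iff]
  refine forall_congr' fun i => ⟨fun h => ?_, fun h => ?_⟩
  · have : ((m i + n i : ℤ) : ℂ) = k i := by push_cast; linear_combination 2 * h
    exact_mod_cast this
  · rw [← h, Pi.add_apply]; push_cast; ring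

/-- Doubled standard weights have odd entries and sums of two of them even entries. So the only
pairs of this weight consist of `a` and a zero-weight index. -/
theorem finrank_weightSpace_short (a : Fin 4) :
    Module.finrank ℂ (weightSpace (fullWeight U) fun i => (stdWeight a i : ℂ) / 2)
      = Fintype.card U := by
  refine finrank_weightSpace (fun _ => Sum.inl a) Sum.inr (fun u i => ?_) (fun k m _ h => ?_)
    (fun k m h => by simp at h) fun c d hcd h => ?_
  · simp [fullWeight]
  · exact Sum.inr_injective h
  · rw [half_add_half_iff] at h
    rcases c with c | u <;> rcases d with d | u'
    · simp only [fullWeight, Sum.elim_inl] at h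
      exfalso; clear hcd; revert a c d; decide
    · simp only [fullWeight, Sum.elim_inl, Sum.elim_inr] at h
      have : c = a := by clear hcd; revert a c; decide
      exact ⟨u', Or.inl ⟨by rw [this], rfl⟩⟩
    · simp only [fullWeight, Sum.elim_inl, Sum.elim_inr] at h
      have : d = a := by clear hcd; revert a d; decide
      exact ⟨u, Or.inr ⟨rfl, by rw [this]⟩⟩
    · simp only [fullWeight, Sum.elim_inr] at h
      exfalso; clear hcd; revert a; decide

omit [Fintype U] in
-- A nonzero sum of two distinct standard weights determines the pair.
theorem finrank_weightSpace_long {a b : Fin 4} (hab : stdWeight a + stdWeight b ≠ 0)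
    (hne : a ≠ b) :
    Module.finrank ℂ (weightSpace (fullWeight U)
      fun i => ((stdWeight a + stdWeight b) i : ℂ) / 2) = 1 := by
  refine (finrank_weightSpace (ι := Unit) (fun _ => Sum.inl a) (fun _ => Sum.inl b)
    (fun u i => ?_) (fun _ _ _ _ => rfl) (fun _ _ h => absurd (Sum.inl_injective h) hne)
    fun c d hcd h => ?_).trans Fintype.card_unit
  · simp [fullWeight]; ring
  · rw [half_add_half_iff] at h
    rcases c with c | u <;> rcases d with d | u'
    · simp only [fullWeight, Sum.elim_inl] at h
      have hcd' : c ≠ d := fun h => hcd (by rw [h])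
      have : (c = a ∧ d = b) ∨ (c = b ∧ d = a) := by
        clear hcd
        revert a b c d; decide
      exact ⟨(), by simpa using this⟩
    · simp only [fullWeight, Sum.elim_inl, Sum.elim_inr] at h
      exfalso; clear hcd; revert a b c; decide
    · simp only [fullWeight, Sum.elim_inl, Sum.elim_inr] at h
      exfalso; clear hcd; revert a b d; decide
    · simp only [fullWeight, Sum.elim_inr] at h
      exact absurd h.symm (by simpa using hab)

theorem exists_stdWeight_of_normSq_two {γ : Fin 2 → ℤ} (h : rootNormSq γ = 2) :
    ∃ a, γ = stdWeight a := by
  have h0 : γ 0 ≤ 1 := by by_contra! hc; unfold rootNormSq at h; nlinarith [sq_nonneg (γ 1)]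
  have h0' : -1 ≤ γ 0 := by by_contra! hc; unfold rootNormSq at h; nlinarith [sq_nonneg (γ 1)]
  have h1 : γ 1 ≤ 1 := by by_contra! hc; unfold rootNormSq at h; nlinarith [sq_nonneg (γ 0)]
  have h1' : -1 ≤ γ 1 := by by_contra! hc; unfold rootNormSq at h; nlinarith [sq_nonneg (γ 0)]
  have hγ : γ = ![γ 0, γ 1] := by ext i; fin_cases i <;> rfl
  rw [hγ] at h ⊢
  generalize γ 0 = x at *
  generalize γ 1 = y at *
  interval_cases x <;> interval_cases y <;> (revert h; decide)

theorem exists_stdWeight_of_normSq_four {γ : Fin 2 → ℤ} (h : rootNormSq γ = 4) :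
    ∃ a b, a ≠ b ∧ stdWeight a + stdWeight b ≠ 0 ∧ γ = stdWeight a + stdWeight b := by
  have h0 : γ 0 ≤ 2 := by by_contra! hc; unfold rootNormSq at h; nlinarith [sq_nonneg (γ 1)]
  have h0' : -2 ≤ γ 0 := by by_contra! hc; unfold rootNormSq at h; nlinarith [sq_nonneg (γ 1)]
  have h1 : γ 1 ≤ 2 := by by_contra! hc; unfold rootNormSq at h; nlinarith [sq_nonneg (γ 0)]
  have h1' : -2 ≤ γ 1 := by by_contra! hc; unfold rootNormSq at h; nlinarith [sq_nonneg (γ 0)]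
  have hγ : γ = ![γ 0, γ 1] := by ext i; fin_cases i <;> rfl
  rw [hγ] at h ⊢
  generalize γ 0 = x at *
  generalize γ 1 = y at *
  interval_cases x <;> interval_cases y <;> (revert h; decide)

theorem normSq_stdWeight (a : Fin 4) : rootNormSq (stdWeight a) = 2 := by
  revert a; decide

theorem normSq_stdWeight_add {a b : Fin 4} (hne : a ≠ b) (h : stdWeight a + stdWeight b ≠ 0) :
    rootNormSq (stdWeight a + stdWeight b) = 4 := by
  revert a b; decide

/-- Doubling multiplies the squared norm by four, so only roots of squared norm one double to roots.
-/
theorem mem_rootsBC_iff {γ : Fin 2 → ℤ} :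
    (γ ∈ rootsBC ∧ 2 • γ ∉ rootsBC) ↔ rootNormSq γ = 2 ∨ rootNormSq γ = 4 := by
  have h : rootNormSq (2 • γ) = 4 * rootNormSq γ := by
    simp [rootNormSq]; ring
  change (_ ∨ _ ∨ _) ∧ ¬(_ ∨ _ ∨ _) ↔ _
  rw [h]
  omega

end WeightSpaces

end ConformalCasimir

/-! ### Root spaces of `𝔠_I` as weight spaces. -/

namespace ConformalCasimir

open Matrix

/-- The coordinate vectors with indices in `U`, as columns. -/
def coordCols {n : Type*} [DecidableEq n] (U : Finset n) : Matrix n U ℂ :=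
  of fun i u => if i = u then 1 else 0

theorem coordCols_mul_transpose {n : Type*} [Fintype n] [DecidableEq n] (U : Finset n) :
    coordCols U * (coordCols U)ᵀ = diagonal fun i => if i ∈ U then 1 else 0 := by
  ext i j
  rw [mul_apply, diagonal_apply]
  simp only [coordCols, of_apply, transpose_apply, mul_ite, mul_one, mul_zero, ← ite_and]
  rw [Finset.univ_eq_attach, Finset.sum_attach U fun u => if j = u ∧ i = u then (1 : ℂ) else 0]
  by_cases hij : i = j
  · subst hij
    simp
  · rw [if_neg fun h => hij h.1]
    exact Finset.sum_eq_zero fun u _ => if_neg fun h => hij (h.2.trans h.1.symm)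

theorem diagonal_fullWeight (U : Type*) [DecidableEq U] (i : Fin 2) :
    fromBlocks (stdH i) 0 0 (0 : Matrix U U ℂ)
      = diagonal fun a => (fullWeight U a i : ℂ) / 2 := by
  have : stdH i = diagonal fun a => (stdWeight a i : ℂ) / 2 := by
    ext a b
    fin_cases i <;> fin_cases a <;> fin_cases b <;> simp [stdH, stdWeight, neg_div]
  rw [this, ← diagonal_zero, fromBlocks_diagonal]
  congr 1
  ext a
  rcases a with a | a <;> simp [fullWeight]

variable {p q : ℕ} {I : CartanLabel} {K : Matrix (Fin (p + q + 2)) (Fin 4) ℂ}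
  {L : Matrix (Fin 4) (Fin (p + q + 2)) ℂ} {U : Finset (Fin (p + q + 2))} {μ : ℂ}
  {T : Matrix (Fin 4) (Fin 4) ℂ}

theorem cx_metric_mul_self : cx (metric p q) * cx (metric p q) = 1 := by
  rw [cx_metric_eq_diagonal, diagonal_mul_diagonal, ← diagonal_one]
  congr 1
  ext i
  exact_mod_cast eta_mul_self p i

section

variable (hM : IsModel p q K L U μ)

include hM

/-- Multiplying the decomposition of the metric by the metric, whose square is `1`, turns it into a
resolution of the identity. -/
theorem IsModel.fromCols_mul_fromRows :
    fromCols K (coordCols U) * fromRows L (coordCols U)ᵀ = 1 := by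
  have h : cx (metric p q) * cx (metric p q) = _ :=
    congrArg (· * cx (metric p q)) hM.tensor
  rw [cx_metric_mul_self] at h
  rw [Matrix.fromCols_mul_fromRows, coordCols_mul_transpose, h, Matrix.add_mul, Matrix.smul_mul,
    Matrix.mul_assoc, hM.form, Matrix.mul_smul, smul_smul, inv_mul_cancel₀ hM.ne_zero, one_smul,
    Matrix.mul_assoc, ← Matrix.mul_assoc stdJ, stdJ_mul_stdJ, Matrix.one_mul,
    cx_metric_eq_diagonal, diagonal_mul_diagonal]
  congr 2
  ext i
  split_ifs
  · exact_mod_cast (eta_mul_self p i).symm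
  · simp

theorem IsModel.fromRows_mul_fromCols (hd : 2 ≤ p + q) :
    fromRows L (coordCols U)ᵀ * fromCols K (coordCols U) = 1 := by
  refine (Matrix.mul_eq_one_comm_of_card_eq _ _ _ ?_).1 hM.fromCols_mul_fromRows
  simp only [Fintype.card_fin, Fintype.card_sum, Fintype.card_coe, hM.card]
  omega

theorem IsModel.stdH_mul_fromCols (hd : 2 ≤ p + q) (i : Fin 2) :
    K * stdH i * L * fromCols K (coordCols U)
      = fromCols K (coordCols U) * diagonal fun a => (fullWeight U a i : ℂ) / 2 := by
  have h := hM.fromRows_mul_fromCols hd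
  rw [Matrix.fromRows_mul_fromCols, ← fromBlocks_one, fromBlocks_inj] at h
  rw [← diagonal_fullWeight, fromCols_mul_fromBlocks, mul_fromCols, Matrix.mul_assoc _ L K,
    Matrix.mul_assoc _ L, h.1, h.2.1]
  simp

/-- Tensors in the basis adapted to the model, as endomorphisms. -/
noncomputable def IsModel.tensorEquiv (hd : 2 ≤ p + q) :
    Matrix (Fin 4 ⊕ U) (Fin 4 ⊕ U) ℂ ≃ₗ[ℂ]
      Matrix (Fin (p + q + 2)) (Fin (p + q + 2)) ℂ where
  toFun A := fromCols K (coordCols U) * A * ((fromCols K (coordCols U))ᵀ * cx (metric p q))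
  invFun X := fromRows L (coordCols U)ᵀ * X
    * (cx (metric p q) * (fromRows L (coordCols U)ᵀ)ᵀ)
  map_add' A B := by rw [Matrix.mul_add, Matrix.add_mul]
  map_smul' c A := by rw [Matrix.mul_smul, Matrix.smul_mul]; rfl
  left_inv A := by
    have h := hM.fromRows_mul_fromCols hd
    have h' : (fromCols K (coordCols U))ᵀ * (fromRows L (coordCols U)ᵀ)ᵀ = 1 := by
      rw [← transpose_mul, h, transpose_one]
    generalize fromCols K (coordCols U) = R at *
    generalize fromRows L (coordCols U)ᵀ = R' at *
    calc R' * (R * A * (Rᵀ * cx (metric p q))) * (cx (metric p q) * R'ᵀ)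
        = R' * R * A * (Rᵀ * (cx (metric p q) * cx (metric p q)) * R'ᵀ) := by
          simp only [Matrix.mul_assoc]
      _ = A := by rw [cx_metric_mul_self, Matrix.mul_one, h, h', Matrix.one_mul, Matrix.mul_one]
  right_inv X := by
    have h := hM.fromCols_mul_fromRows
    have h' : (fromRows L (coordCols U)ᵀ)ᵀ * (fromCols K (coordCols U))ᵀ = 1 := by
      rw [← transpose_mul, h, transpose_one]
    generalize fromCols K (coordCols U) = R at *
    generalize fromRows L (coordCols U)ᵀ = R' at *
    calc R * (R' * X * (cx (metric p q) * R'ᵀ)) * (Rᵀ * cx (metric p q))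
        = R * R' * X * (cx (metric p q) * (R'ᵀ * Rᵀ) * cx (metric p q)) := by
          simp only [Matrix.mul_assoc]
      _ = X := by rw [h, h', Matrix.mul_one, cx_metric_mul_self, Matrix.one_mul, Matrix.mul_one]

theorem IsModel.tensorEquiv_apply (hd : 2 ≤ p + q) (A : Matrix (Fin 4 ⊕ U) (Fin 4 ⊕ U) ℂ) :
    hM.tensorEquiv hd A
      = fromCols K (coordCols U) * A * ((fromCols K (coordCols U))ᵀ * cx (metric p q)) := rfl

theorem IsModel.isSkew_tensorEquiv_iff (hd : 2 ≤ p + q)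
    (A : Matrix (Fin 4 ⊕ U) (Fin 4 ⊕ U) ℂ) :
    IsSkew (cx (metric p q)) (hM.tensorEquiv hd A) ↔ Aᵀ = -A := by
  have h : (hM.tensorEquiv hd A)ᵀ * cx (metric p q) + cx (metric p q) * hM.tensorEquiv hd A
      = cx (metric p q) * hM.tensorEquiv hd (Aᵀ + A) := by
    simp only [hM.tensorEquiv_apply, transpose_mul, cx_metric_transpose, transpose_transpose,
      Matrix.mul_add, Matrix.add_mul, Matrix.mul_assoc]
  rw [IsSkew, h]
  constructor
  · intro h0
    have := congrArg (cx (metric p q) * ·) h0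
    simp only [← Matrix.mul_assoc, cx_metric_mul_self, Matrix.one_mul, Matrix.mul_zero] at this
    exact eq_neg_of_add_eq_zero_left ((LinearEquiv.map_eq_zero_iff _).1 this)
  · intro h0
    rw [h0, neg_add_cancel, map_zero, Matrix.mul_zero]

/-- Left multiplication acts on the first leg; skewness moves right multiplication past the metric
onto the second leg. The commutator thus multiplies each entry by the sum of its two weights. -/
theorem IsModel.commutator_tensorEquiv (hd : 2 ≤ p + q) (i : Fin 2)
    (A : Matrix (Fin 4 ⊕ U) (Fin 4 ⊕ U) ℂ) :
    K * stdH i * L * hM.tensorEquiv hd A - hM.tensorEquiv hd A * (K * stdH i * L)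
      = hM.tensorEquiv hd (of fun a b =>
          ((fullWeight U a i : ℂ) / 2 + fullWeight U b i / 2) * A a b) := by
  have h1 := hM.stdH_mul_fromCols hd i
  have h2 : IsSkew (cx (metric p q)) (K * stdH i * L) := hM.isSkew_of_std (isSkew_stdH i)
  have h2 := eq_neg_of_add_eq_zero_right h2
  have h3 := congrArg transpose h1
  rw [transpose_mul (K * stdH i * L), transpose_mul (fromCols K _), diagonal_transpose] at h3
  rw [hM.tensorEquiv_apply, hM.tensorEquiv_apply]
  generalize fromCols K (coordCols U) = R at *
  generalize K * stdH i * L = H at *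
  set D : Matrix (Fin 4 ⊕ U) (Fin 4 ⊕ U) ℂ := diagonal fun a => (fullWeight U a i : ℂ) / 2 with hD
  have hA : (of fun a b => ((fullWeight U a i : ℂ) / 2 + fullWeight U b i / 2) * A a b)
      = D * A + A * D := by
    ext a b
    rw [Matrix.add_apply, hD, diagonal_mul, mul_diagonal, of_apply]
    ring
  rw [hA]
  calc H * (R * A * (Rᵀ * cx (metric p q))) - R * A * (Rᵀ * cx (metric p q)) * H
      = H * R * A * (Rᵀ * cx (metric p q)) - R * A * (Rᵀ * (cx (metric p q) * H)) := by
        simp only [Matrix.mul_assoc]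
    _ = R * D * A * (Rᵀ * cx (metric p q)) + R * A * (Rᵀ * Hᵀ * cx (metric p q)) := by
        rw [h1, h2, Matrix.mul_neg, Matrix.mul_neg, sub_neg_eq_add,
          Matrix.mul_assoc Rᵀ]
    _ = _ := by
        rw [h3]
        simp only [Matrix.mul_add, Matrix.add_mul, Matrix.mul_assoc]

end

section

variable (hM : IsCartanModel p q I K L U μ T)

include hM

/-- Since `cartanEps I` is invertible, the eigenvalue conditions for `X_0, X_1` can be traded for
those of the complex basis `stdH 0, stdH 1`. -/
theorem IsCartanModel.mem_rootSpace_iff (γ : Fin 2 → ℂ)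
    (X : Matrix (Fin (p + q + 2)) (Fin (p + q + 2)) ℂ) :
    X ∈ rootSpace p q I γ ↔ IsSkew (cx (metric p q)) X ∧
      ∀ i, K * stdH i * L * X - X * (K * stdH i * L) = γ i • X := by
  refine and_congr Iff.rfl ⟨fun h i => ?_, fun h j => ?_⟩
  · have hε := congrFun (congrArg (· *ᵥ γ) (Matrix.nonsing_inv_mul _ (isUnit_det_cartanEps I))) i
    simp only [one_mulVec, ← mulVec_mulVec] at hε
    rw [← hM.sum_inv_gen i, Finset.sum_mul, Finset.mul_sum, ← Finset.sum_sub_distrib, ← hε]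
    simp only [Matrix.smul_mul, Matrix.mul_smul, ← smul_sub]
    rw [mulVec, dotProduct, Finset.sum_smul]
    refine Finset.sum_congr rfl fun j _ => ?_
    rw [h j, smul_smul]
    rfl
  · change cx (cartanGen p q I j) * X - X * cx (cartanGen p q I j) = _
    rw [hM.gen, Finset.sum_mul, Finset.mul_sum, ← Finset.sum_sub_distrib, Finset.sum_smul]
    refine Finset.sum_congr rfl fun i _ => ?_
    rw [Matrix.smul_mul, Matrix.mul_smul, ← smul_sub, h i, smul_smul]

theorem IsCartanModel.rootSpace_eq_map (hd : 2 ≤ p + q) (γ : Fin 2 → ℂ) :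
    rootSpace p q I γ
      = (weightSpace (fullWeight U) γ).map (hM.tensorEquiv hd).toLinearMap := by
  ext X
  obtain ⟨A, rfl⟩ := (hM.tensorEquiv hd).surjective X
  rw [hM.mem_rootSpace_iff, hM.isSkew_tensorEquiv_iff, Submodule.mem_map_equiv,
    LinearEquiv.symm_apply_apply]
  refine and_congr Iff.rfl (forall_congr' fun i => ?_)
  rw [hM.commutator_tensorEquiv, ← map_smul, (hM.tensorEquiv hd).injective.eq_iff, ← ext_iff]
  rfl

theorem IsCartanModel.finrank_rootSpace (hd : 2 ≤ p + q) (γ : Fin 2 → ℂ) :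
    Module.finrank ℂ (rootSpace p q I γ)
      = Module.finrank ℂ (weightSpace (fullWeight U) γ) := by
  rw [hM.rootSpace_eq_map hd]
  exact LinearEquiv.finrank_map_eq _ _

theorem IsCartanModel.multK_eq (hd : 2 < p + q) {γ : Fin 2 → ℤ} (hγ : γ ∈ rootsBC)
    (h2 : 2 • γ ∉ rootsBC) :
    multK (p + q) γ
      = (Module.finrank ℂ (rootSpace p q I fun i => (γ i : ℂ) / 2) : ℂ) / 2 := by
  rw [hM.finrank_rootSpace hd.le]
  rcases mem_rootsBC_iff.1 ⟨hγ, h2⟩ with h | h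
  · obtain ⟨a, rfl⟩ := exists_stdWeight_of_normSq_two h
    rw [finrank_weightSpace_short, Fintype.card_coe, hM.card, multK, invariantFun, if_neg (by omega),
      if_pos h, Nat.cast_sub hd.le]
    norm_num
  · obtain ⟨a, b, hne, h0, rfl⟩ := exists_stdWeight_of_normSq_four h
    rw [finrank_weightSpace_long h0 hne, multK, invariantFun, if_neg (by omega), if_neg (by omega),
      if_pos h, Nat.cast_one]

theorem IsCartanModel.two_smul_cartanRoots (hd : 2 < p + q) :
    (fun γ : Fin 2 → ℂ => (2 : ℂ) • γ) '' cartanRoots p q I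
      = {ζ | ∃ γ ∈ rootsBC, 2 • γ ∉ rootsBC ∧ ζ = fun i => (γ i : ℂ)} := by
  have hne : ∀ γ, rootSpace p q I γ ≠ ⊥ ↔ weightSpace (fullWeight U) γ ≠ ⊥ := by
    intro γ
    rw [hM.rootSpace_eq_map hd.le, Ne, Submodule.map_eq_bot_iff]
  ext ζ
  constructor
  · rintro ⟨γ, ⟨h0, hγ⟩, rfl⟩
    obtain ⟨a, b, hab, h⟩ := exists_of_weightSpace_ne_bot ((hne γ).1 hγ)
    have hsum : (fun γ : Fin 2 → ℂ => (2 : ℂ) • γ) γ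
        = fun i => (((fullWeight U a + fullWeight U b) i : ℤ) : ℂ) := by
      ext i
      simp only [Pi.smul_apply, smul_eq_mul, Pi.add_apply, ← h i]
      push_cast
      ring
    have hs0 : fullWeight U a + fullWeight U b ≠ 0 := by
      intro hs
      refine h0 (funext fun i => ?_)
      have := congrFun hsum i
      rw [hs] at this
      simpa using this
    refine ⟨_, (mem_rootsBC_iff.2 ?_).1, (mem_rootsBC_iff.2 ?_).2, hsum⟩ <;>
    · rcases a with a | a <;> rcases b with b | b <;>
        simp only [fullWeight, Sum.elim_inl, Sum.elim_inr, zero_add, add_zero] at hs0 ⊢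
      · exact Or.inr (normSq_stdWeight_add (fun h => hab (by rw [h])) hs0)
      · exact Or.inl (normSq_stdWeight a)
      · exact Or.inl (normSq_stdWeight b)
      · exact absurd rfl hs0
  · rintro ⟨γ, hγ, h2, rfl⟩
    refine ⟨fun i => (γ i : ℂ) / 2, ⟨fun h => ?_, fun h => ?_⟩, ?_⟩
    · have : γ = 0 := by
        ext i
        have := congrFun h i
        simpa using this
      rw [this] at hγ
      simp [rootsBC, rootNormSq] at hγ
    -- A zero root space would make the multiplicity zero, but it is `1/2` or `(d - 2)/2`, and `d >
    -- 2`.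
    · have hk := hM.multK_eq hd hγ h2
      rw [h, finrank_bot, multK, invariantFun] at hk
      have hd' : ((p + q : ℕ) : ℂ) - 2 ≠ 0 := by
        rw [sub_ne_zero]
        exact_mod_cast hd.ne'
      rcases mem_rootsBC_iff.1 ⟨hγ, h2⟩ with h | h <;> norm_num [h] at hk
      exact hd' (by push_cast; exact hk)
    · ext i
      simp only [Pi.smul_apply, smul_eq_mul]
      ring

end

end ConformalCasimir

/-! ### Calculus along the real directions of `Y_I`. -/

namespace ConformalCasimir

open Matrix Topology

/-- The directions `v_0, v_1` preserve the linear equations of each region, and the strict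
inequalities are open conditions. This replaces openness in `ℂ²`, which fails. -/
theorem eventually_mem_region {I : CartanLabel} {χ : Fin 2 → ℂ} (hχ : χ ∈ region I) :
    ∀ᶠ c : Fin 2 → ℝ in 𝓝 0, χ + ∑ j, c j • cartanEps I j ∈ region I := by
  have hφ : Continuous fun c : Fin 2 → ℝ => χ + ∑ j, c j • cartanEps I j := by fun_prop
  have hev : ∀ {O : Set (Fin 2 → ℂ)}, IsOpen O → χ ∈ O →
      ∀ᶠ c : Fin 2 → ℝ in 𝓝 0, χ + ∑ j, c j • cartanEps I j ∈ O := by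
    intro O hO hχO
    refine hφ.continuousAt.eventually (hO.mem_nhds ?_)
    simpa using hχO
  have r : ∀ i, Continuous fun ξ : Fin 2 → ℂ => (ξ i).re := fun i => by fun_prop
  have m : ∀ i, Continuous fun ξ : Fin 2 → ℂ => (ξ i).im := fun i => by fun_prop
  have k : ∀ x : ℝ, Continuous fun _ : Fin 2 → ℂ => x := fun x => continuous_const
  cases I <;> simp only [region, Set.mem_ofPred_eq] at hχ
  case empty =>
    obtain ⟨h1, h2, h3, h4, h5⟩ := hχ
    filter_upwards [hev (isOpen_lt (k 0) (m 0)) h3, hev (isOpen_lt (m 0) (m 1)) h4,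
      hev (isOpen_lt (m 1) (k _)) h5] with c k3 k4 k5
    exact ⟨by simp [cartanEps, h1], by simp [cartanEps, h2], k3, k4, k5⟩
  case s0 =>
    obtain ⟨h1, h2, h3, h4, h5⟩ := hχ
    filter_upwards [hev (isOpen_lt (k 0) (m 0)) h2, hev (isOpen_lt (m 0) (k _)) h3,
      hev (isOpen_lt (k 0) (r 1)) h4] with c k2 k3 k4
    exact ⟨by simp [cartanEps, h1], k2, k3, k4, by simp [cartanEps, h5]⟩
  case s2 =>
    obtain ⟨h1, h2, h3, h4, h5⟩ := hχ
    filter_upwards [hev (isOpen_lt (k 0) (r 0)) h1, hev (isOpen_lt (k 0) (m 1)) h4,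
      hev (isOpen_lt (m 1) (k _)) h5] with c k1 k4 k5
    exact ⟨k1, by simp [cartanEps, h2], by simp [cartanEps, h3], k4, k5⟩
  case s01 =>
    obtain ⟨h1, h2, h3, h4⟩ := hχ
    filter_upwards [hev (isOpen_lt (k 0) (r 0)) h1, hev (isOpen_lt (r 0) (r 1)) h2] with c k1 k2
    exact ⟨k1, k2, by simp [cartanEps, h3], by simp [cartanEps, h4]⟩
  case s02 =>
    obtain ⟨h1, h2, h3, h4⟩ := hχ
    filter_upwards [hev (isOpen_lt (k 0) (r 0)) h1, hev (isOpen_lt (k 0) (r 1)) h2] with c k1 k2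
    exact ⟨k1, k2, by simp [cartanEps, h3], by simp [cartanEps, h4]⟩
  case s12 =>
    obtain ⟨h1, h2, h3, h4⟩ := hχ
    filter_upwards [hev (isOpen_lt (k 0) (r 0)) h1, hev (isOpen_lt (r 0) (r 1)) h2] with c k1 k2
    exact ⟨k1, k2, by simp [cartanEps, h3], by simp [cartanEps, h4]⟩
  all_goals
    obtain ⟨h1, h2, h3, h4, h5⟩ := hχ
    filter_upwards [hev (isOpen_lt (k 0) (r 1)) h1, hev (isOpen_lt (k 0) (m 0)) h4,
      hev (isOpen_lt (m 0) (k _)) h5] with c k1 k4 k5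
    refine ⟨k1, ?_, ?_, k4, k5⟩
    · simp [cartanEps, h2, add_comm]
    · simp [cartanEps, h3]

section Lines

variable {I : CartanLabel} {χ : Fin 2 → ℂ}

theorem eventually_add_smul_mem_region (hχ : χ ∈ region I) (j : Fin 2) :
    ∀ᶠ s : ℝ in 𝓝 0, χ + s • cartanEps I j ∈ region I := by
  have h : Filter.Tendsto (fun s : ℝ => (Pi.single j s : Fin 2 → ℝ)) (𝓝 0) (𝓝 0) := by
    have : Continuous fun s : ℝ => (Pi.single j s : Fin 2 → ℝ) :=
      continuous_single (A := fun _ => ℝ) j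
    simpa using this.tendsto 0
  filter_upwards [h.eventually (eventually_mem_region hχ)] with s hs
  rwa [Finset.sum_eq_single j (fun k _ hk => by simp [hk]) (by simp), Pi.single_eq_same] at hs

/-- Differentiability along the directions of the region. -/
def LineDifferentiableAt (I : CartanLabel) (F : (Fin 2 → ℂ) → ℂ) (χ : Fin 2 → ℂ) : Prop :=
  ∀ j, DifferentiableAt ℝ (fun s : ℝ => F (χ + s • cartanEps I j)) 0

theorem eventuallyEq_line {F G : (Fin 2 → ℂ) → ℂ} (h : Set.EqOn F G (region I))
    (hχ : χ ∈ region I) (j : Fin 2) :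
    (fun s : ℝ => F (χ + s • cartanEps I j)) =ᶠ[𝓝 0] fun s => G (χ + s • cartanEps I j) := by
  filter_upwards [eventually_add_smul_mem_region hχ j] with s hs using h hs

theorem partialChi_congr {F G : (Fin 2 → ℂ) → ℂ} (h : Set.EqOn F G (region I))
    (hχ : χ ∈ region I) (i : Fin 2) : partialChi I i F χ = partialChi I i G χ :=
  Finset.sum_congr rfl fun j _ => by rw [(eventuallyEq_line h hχ j).deriv_eq]

theorem LineDifferentiableAt.mul {F G : (Fin 2 → ℂ) → ℂ} (hF : LineDifferentiableAt I F χ)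
    (hG : LineDifferentiableAt I G χ) : LineDifferentiableAt I (fun ξ => F ξ * G ξ) χ :=
  fun j => (hF j).mul (hG j)

theorem LineDifferentiableAt.sub {F G : (Fin 2 → ℂ) → ℂ} (hF : LineDifferentiableAt I F χ)
    (hG : LineDifferentiableAt I G χ) : LineDifferentiableAt I (fun ξ => F ξ - G ξ) χ :=
  fun j => (hF j).sub (hG j)

theorem partialChi_mul {F G : (Fin 2 → ℂ) → ℂ} (hF : LineDifferentiableAt I F χ)
    (hG : LineDifferentiableAt I G χ) (i : Fin 2) :
    partialChi I i (fun ξ => F ξ * G ξ) χ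
      = partialChi I i F χ * G χ + F χ * partialChi I i G χ := by
  simp only [partialChi, Finset.sum_mul, Finset.mul_sum, ← Finset.sum_add_distrib]
  refine Finset.sum_congr rfl fun j _ => ?_
  rw [deriv_fun_mul (hF j) (hG j)]
  simp only [zero_smul, add_zero]
  ring

theorem partialChi_sub {F G : (Fin 2 → ℂ) → ℂ} (hF : LineDifferentiableAt I F χ)
    (hG : LineDifferentiableAt I G χ) (i : Fin 2) :
    partialChi I i (fun ξ => F ξ - G ξ) χ = partialChi I i F χ - partialChi I i G χ := by
  simp only [partialChi, ← Finset.sum_sub_distrib]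
  refine Finset.sum_congr rfl fun j _ => ?_
  rw [deriv_fun_sub (hF j) (hG j), mul_sub]

theorem hasDerivAt_line {φ : ℂ → ℂ} {φ' : ℂ} {k : Fin 2} (h : HasDerivAt φ φ' (χ k)) (j : Fin 2) :
    HasDerivAt (fun s : ℝ => φ ((χ + s • cartanEps I j) k)) (cartanEps I j k * φ') 0 := by
  have h1 : HasDerivAt (fun s : ℝ => (χ + s • cartanEps I j) k) (cartanEps I j k) 0 := by
    have := ((hasDerivAt_id (0 : ℝ)).smul_const (cartanEps I j k)).const_add (χ k)
    simpa using this
  rw [← smul_eq_mul]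
  refine HasDerivAt.scomp (0 : ℝ) ?_ h1
  simpa using h

theorem lineDifferentiableAt_coord {φ : ℂ → ℂ} {φ' : ℂ} {k : Fin 2}
    (h : HasDerivAt φ φ' (χ k)) : LineDifferentiableAt I (fun ξ => φ (ξ k)) χ :=
  fun j => (hasDerivAt_line h j).differentiableAt

/-- The chain rule gives the entry `(j, k)` of `cartanEps I` times `φ'` along `v_j`, and the inverse
matrix turns these into a Kronecker delta. -/
theorem partialChi_coord {φ : ℂ → ℂ} {φ' : ℂ} {k : Fin 2} (h : HasDerivAt φ φ' (χ k))
    (i : Fin 2) : partialChi I i (fun ξ => φ (ξ k)) χ = if i = k then φ' else 0 := by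
  have hε : ((cartanEps I)⁻¹ * cartanEps I) i k = _ :=
    congrFun (congrFun (Matrix.nonsing_inv_mul _ (isUnit_det_cartanEps I)) i) k
  rw [one_apply] at hε
  simp only [partialChi, (hasDerivAt_line h _).deriv, ← mul_assoc, ← Finset.sum_mul]
  rw [← mul_apply, hε, ite_mul, one_mul, zero_mul]

/-- In the real chart `c ↦ χ + ∑ c_j v_j` the region becomes a neighbourhood of `0`, so ordinary
differentiability is available there. -/
theorem contDiffAt_chart {F : (Fin 2 → ℂ) → ℂ} (hF : ContDiffOn ℝ ∞ F (region I))
    (hχ : χ ∈ region I) :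
    ContDiffAt ℝ ∞ (fun c : Fin 2 → ℝ => F (χ + ∑ j, c j • cartanEps I j)) 0 := by
  have h : ContDiffWithinAt ℝ ∞ (fun c : Fin 2 → ℝ => F (χ + ∑ j, c j • cartanEps I j))
      ((fun c : Fin 2 → ℝ => χ + ∑ j, c j • cartanEps I j) ⁻¹' region I) 0 := by
    refine ContDiffWithinAt.comp (t := region I) 0 (hF _ (by simpa using hχ)) ?_
      (Set.mapsTo_preimage _ _)
    exact ContDiff.contDiffWithinAt (by fun_prop)
  exact h.contDiffAt (eventually_mem_region hχ)

theorem add_sum_single (c : Fin 2 → ℝ) (s : ℝ) (j : Fin 2) :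
    χ + ∑ k, (c + s • (Pi.single j 1 : Fin 2 → ℝ)) k • cartanEps I k
      = χ + ∑ k, c k • cartanEps I k + s • cartanEps I j := by
  rw [add_assoc]
  congr 1
  simp only [Pi.add_apply, add_smul, Finset.sum_add_distrib]
  congr 1
  rw [Finset.sum_eq_single j (fun k _ hk => by simp [hk]) (by simp)]
  simp

theorem lineDifferentiableAt_of_contDiffAt {F : (Fin 2 → ℂ) → ℂ}
    (hF : DifferentiableAt ℝ (fun c : Fin 2 → ℝ => F (χ + ∑ j, c j • cartanEps I j)) 0) :
    LineDifferentiableAt I F χ := by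
  intro j
  have h : (fun s : ℝ => F (χ + s • cartanEps I j))
      = (fun c : Fin 2 → ℝ => F (χ + ∑ j, c j • cartanEps I j))
        ∘ fun s : ℝ => (0 : Fin 2 → ℝ) + s • (Pi.single j 1 : Fin 2 → ℝ) := by
    ext s
    simp only [Function.comp_apply, add_sum_single]
    simp
  rw [h]
  refine DifferentiableAt.comp (0 : ℝ) ?_ (by fun_prop)
  simpa using hF

theorem lineDifferentiableAt_of_contDiffOn {F : (Fin 2 → ℂ) → ℂ}
    (hF : ContDiffOn ℝ ∞ F (region I)) (hχ : χ ∈ region I) : LineDifferentiableAt I F χ :=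
  lineDifferentiableAt_of_contDiffAt ((contDiffAt_chart hF hχ).differentiableAt (by simp))

/-- On a whole neighbourhood in the chart `partialChi` is a constant-coefficient combination of
values of `fderiv`, so it can be differentiated again. -/
theorem lineDifferentiableAt_partialChi {F : (Fin 2 → ℂ) → ℂ}
    (hF : ContDiffOn ℝ ∞ F (region I)) (hχ : χ ∈ region I) (i : Fin 2) :
    LineDifferentiableAt I (partialChi I i F) χ := by
  apply lineDifferentiableAt_of_contDiffAt
  set Φ : (Fin 2 → ℝ) → ℂ := fun c => F (χ + ∑ j, c j • cartanEps I j) with hΦ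
  have hc : ContDiffAt ℝ ∞ Φ 0 := contDiffAt_chart hF hχ
  have hd : ∀ᶠ c in 𝓝 0, DifferentiableAt ℝ Φ c := by
    have := hc.of_le (m := 1) (by exact_mod_cast le_top)
    filter_upwards [this.eventually (by simp)] with c hc using hc.differentiableAt (by simp)
  have he : (fun c : Fin 2 → ℝ => partialChi I i F (χ + ∑ j, c j • cartanEps I j)) =ᶠ[𝓝 0]
      fun c => ∑ j, (cartanEps I)⁻¹ i j * fderiv ℝ Φ c (Pi.single j 1) := by
    filter_upwards [hd] with c hc
    refine Finset.sum_congr rfl fun j _ => ?_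
    congr 1
    have h1 : (fun s : ℝ => F (χ + ∑ k, c k • cartanEps I k + s • cartanEps I j))
        = fun s : ℝ => Φ (c + s • (Pi.single j 1 : Fin 2 → ℝ)) := by
      ext s
      rw [hΦ]
      simp only [add_sum_single]
    rw [h1]
    exact (hc.hasFDerivAt.hasLineDerivAt _).lineDeriv
  refine he.differentiableAt_iff.2 ?_
  have h2 : DifferentiableAt ℝ (fderiv ℝ Φ) 0 :=
    (hc.fderiv_right (m := ∞) (by simp)).differentiableAt (by simp)
  refine DifferentiableAt.fun_sum fun j _ => ?_
  exact (h2.clm_apply (differentiableAt_const _)).const_mul _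

end Lines

end ConformalCasimir

namespace ConformalCasimir

open Matrix Topology

/-! ### Principal powers on the strip and the factors of `δ`. -/

section Strip

variable {z : ℂ}

theorem im_sinh (z : ℂ) : (Complex.sinh z).im = Real.cosh z.re * Real.sin z.im := by
  conv_lhs => rw [← Complex.re_add_im z, Complex.sinh_add, Complex.sinh_mul_I, Complex.cosh_mul_I]
  simp [Complex.cosh_ofReal_re, Complex.sin_ofReal_re]

theorem re_sinh (z : ℂ) : (Complex.sinh z).re = Real.sinh z.re * Real.cos z.im := by
  conv_lhs => rw [← Complex.re_add_im z, Complex.sinh_add, Complex.sinh_mul_I, Complex.cosh_mul_I]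
  simp [Complex.sinh_ofReal_re, Complex.cos_ofReal_re]

theorem re_cosh (z : ℂ) : (Complex.cosh z).re = Real.cosh z.re * Real.cos z.im := by
  conv_lhs => rw [← Complex.re_add_im z, Complex.cosh_add, Complex.sinh_mul_I, Complex.cosh_mul_I]
  simp [Complex.cosh_ofReal_re, Complex.cos_ofReal_re]

theorem im_cosh (z : ℂ) : (Complex.cosh z).im = Real.sinh z.re * Real.sin z.im := by
  conv_lhs => rw [← Complex.re_add_im z, Complex.cosh_add, Complex.sinh_mul_I, Complex.cosh_mul_I]
  simp [Complex.sinh_ofReal_re, Complex.sin_ofReal_re]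

/-- Halving brings the imaginary part into `[0, π/2]`, where `cosh` has positive real part except on
the upper edge; there it is a nonzero imaginary number. -/
theorem cosh_half_mem_slitPlane (hz : z ∈ coshStrip) : Complex.cosh (z / 2) ∈ Complex.slitPlane := by
  obtain ⟨h0, h1, h2⟩ := hz
  have hre : (z / 2).re = z.re / 2 := by simp
  have him : (z / 2).im = z.im / 2 := by simp
  rcases h1.lt_or_eq with h | h
  · left
    rw [re_cosh, him]
    exact mul_pos (Real.cosh_pos _) (Real.cos_pos_of_mem_Ioo ⟨by linarith, by linarith⟩)
  · right
    rw [im_cosh, hre, him, h, Real.sin_pi_div_two, mul_one]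
    exact (Real.sinh_pos_iff.2 (by linarith [h2 (Or.inr h)])).ne'

/-- Off the lower edge the imaginary part is positive; on the lower edge the value is real and
positive. -/
theorem sinh_half_mem_slitPlane (hz : z ∈ coshStrip) : Complex.sinh (z / 2) ∈ Complex.slitPlane := by
  obtain ⟨h0, h1, h2⟩ := hz
  have hpi := Real.pi_pos
  have hre : (z / 2).re = z.re / 2 := by simp
  have him : (z / 2).im = z.im / 2 := by simp
  rcases h0.lt_or_eq with h | h
  · right
    rw [im_sinh, him]
    exact (mul_pos (Real.cosh_pos _) (Real.sin_pos_of_pos_of_lt_pi (by linarith)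
      (by linarith))).ne'
  · left
    rw [re_sinh, hre, him, ← h, zero_div, Real.cos_zero, mul_one]
    exact Real.sinh_pos_iff.2 (by linarith [h2 (Or.inl h.symm)])

theorem mul_cpow_of_arg {x y : ℂ} (hx : x ≠ 0) (hy : y ≠ 0)
    (h : x.arg + y.arg ∈ Set.Ioc (-Real.pi) Real.pi) (a : ℂ) :
    (x * y) ^ a = x ^ a * y ^ a := by
  rw [Complex.cpow_def_of_ne_zero (mul_ne_zero hx hy), Complex.cpow_def_of_ne_zero hx,
    Complex.cpow_def_of_ne_zero hy, Complex.log_mul hx hy h, add_mul, Complex.exp_add]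

theorem ofReal_mul_cpow {r : ℝ} (hr : 0 < r) {x : ℂ} (hx : x ≠ 0) (a : ℂ) :
    (r * x) ^ a = (r : ℂ) ^ a * x ^ a := by
  refine mul_cpow_of_arg (by exact_mod_cast hr.ne') hx ?_ a
  rw [Complex.arg_ofReal_of_nonneg hr.le, zero_add]
  exact Complex.arg_mem_Ioc x

/-- Powers split if the arguments add up without leaving `(-π, π]`. The lower bound is clear from
the separate ranges. A sum above `π` would put the product in the open lower half-plane, but the
product is `sinh z / 2`, whose imaginary part is nonnegative on the strip. -/
theorem sinh_half_mul_cosh_half_cpow (hz : z ∈ coshStrip) (a : ℂ) :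
    (Complex.sinh (z / 2) * Complex.cosh (z / 2)) ^ a
      = Complex.sinh (z / 2) ^ a * Complex.cosh (z / 2) ^ a := by
  have hs := sinh_half_mem_slitPlane hz
  have hc := cosh_half_mem_slitPlane hz
  have hs0 := Complex.slitPlane_ne_zero hs
  have hc0 := Complex.slitPlane_ne_zero hc
  obtain ⟨h0, h1, h2⟩ := hz
  have hpi := Real.pi_pos
  have him : (z / 2).im = z.im / 2 := by simp
  refine mul_cpow_of_arg hs0 hc0 ?_ a
  have hsa : 0 ≤ (Complex.sinh (z / 2)).arg := by
    rw [Complex.arg_nonneg_iff, im_sinh, him]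
    exact mul_nonneg (Real.cosh_pos _).le
      (Real.sin_nonneg_of_nonneg_of_le_pi (by linarith) (by linarith))
  have hca : |(Complex.cosh (z / 2)).arg| ≤ Real.pi / 2 := by
    rw [Complex.abs_arg_le_pi_div_two_iff, re_cosh, him]
    exact mul_nonneg (Real.cosh_pos _).le (Real.cos_nonneg_of_mem_Icc ⟨by linarith, by linarith⟩)
  rw [abs_le] at hca
  refine ⟨by linarith, ?_⟩
  by_contra! hgt
  have hle := Complex.arg_le_pi (Complex.sinh (z / 2))
  have him2 : (Complex.sinh (z / 2) * Complex.cosh (z / 2)).im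
      = ‖Complex.sinh (z / 2)‖ * ‖Complex.cosh (z / 2)‖
        * Real.sin ((Complex.sinh (z / 2)).arg + (Complex.cosh (z / 2)).arg) := by
    conv_lhs => rw [← Complex.norm_mul_cos_add_sin_mul_I (Complex.sinh (z / 2)),
      ← Complex.norm_mul_cos_add_sin_mul_I (Complex.cosh (z / 2))]
    rw [Real.sin_add]
    simp only [← Complex.ofReal_cos, ← Complex.ofReal_sin, Complex.mul_im, Complex.mul_re,
      Complex.add_re, Complex.add_im, Complex.ofReal_re, Complex.ofReal_im, Complex.I_re,
      Complex.I_im]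
    ring
  have hneg : Real.sin ((Complex.sinh (z / 2)).arg + (Complex.cosh (z / 2)).arg) < 0 := by
    rw [← Real.sin_sub_two_pi]
    exact Real.sin_neg_of_neg_of_neg_pi_lt (by linarith) (by linarith)
  have hpos : 0 ≤ (Complex.sinh (z / 2) * Complex.cosh (z / 2)).im := by
    have : Complex.sinh (z / 2) * Complex.cosh (z / 2) = Complex.sinh z / 2 := by
      rw [show z = 2 * (z / 2) by ring, Complex.sinh_two_mul]
      ring_nf
    rw [this]
    have : (Complex.sinh z / 2).im = (Complex.sinh z).im / 2 := by simp
    rw [this, im_sinh]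
    exact div_nonneg (mul_nonneg (Real.cosh_pos _).le (Real.sin_nonneg_of_nonneg_of_le_pi h0 h1))
      two_pos.le
  rw [him2] at hpos
  have := mul_pos (norm_pos_iff.2 hs0) (norm_pos_iff.2 hc0)
  nlinarith

/-- The factor of `δ` that depends on one coordinate. -/
noncomputable def halfPow (α β z : ℂ) : ℂ :=
  Complex.cosh (z / 2) ^ ((-α + β) / 2) * Complex.sinh (z / 2) ^ ((α + β) / 2)

theorem halfPow_ne_zero (α β : ℂ) (hz : z ∈ coshStrip) : halfPow α β z ≠ 0 := by
  have hs0 := Complex.slitPlane_ne_zero (sinh_half_mem_slitPlane hz)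
  have hc0 := Complex.slitPlane_ne_zero (cosh_half_mem_slitPlane hz)
  exact mul_ne_zero (by simp [Complex.cpow_eq_zero_iff, hc0])
    (by simp [Complex.cpow_eq_zero_iff, hs0])

/-- The logarithmic derivative of `halfPow` as a function of `exp z`. -/
noncomputable def halfPowLog (α β y : ℂ) : ℂ := (β * (y + y⁻¹) + 2 * α) / (2 * (y - y⁻¹))

theorem hasDerivAt_halfPow (α β : ℂ) (hz : z ∈ coshStrip) :
    HasDerivAt (halfPow α β) (halfPowLog α β (Complex.exp z) * halfPow α β z) z := by
  have hs := sinh_half_mem_slitPlane hz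
  have hc := cosh_half_mem_slitPlane hz
  have hs0 := Complex.slitPlane_ne_zero hs
  have hc0 := Complex.slitPlane_ne_zero hc
  have hhalf : HasDerivAt (fun w : ℂ => w / 2) (1 / 2) z := (hasDerivAt_id z).div_const 2
  have h1 := (hhalf.ccosh.cpow_const (c := (-α + β) / 2) hc).mul
    (hhalf.csinh.cpow_const (c := (α + β) / 2) hs)
  refine h1.congr_deriv ?_
  rw [Complex.cpow_sub _ _ hc0, Complex.cpow_sub _ _ hs0, Complex.cpow_one, Complex.cpow_one,
    halfPow]
  have hy : Complex.exp z - (Complex.exp z)⁻¹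
      = 4 * (Complex.sinh (z / 2) * Complex.cosh (z / 2)) := by
    have h := Complex.sinh_two_mul (z / 2)
    rw [show 2 * (z / 2) = z by ring, Complex.sinh, Complex.exp_neg] at h
    linear_combination 2 * h
  have hy' : Complex.exp z + (Complex.exp z)⁻¹
      = 2 * (Complex.sinh (z / 2) ^ 2 + Complex.cosh (z / 2) ^ 2) := by
    have h := Complex.cosh_two_mul (z / 2)
    rw [show 2 * (z / 2) = z by ring, Complex.cosh, Complex.exp_neg] at h
    linear_combination 2 * h
  have hcs : Complex.cosh (z / 2) ^ 2 - Complex.sinh (z / 2) ^ 2 = 1 := Complex.cosh_sq_sub_sinh_sq _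
  rw [halfPowLog, hy, hy']
  generalize Complex.sinh (z / 2) = s at *
  generalize Complex.cosh (z / 2) = c at *
  field_simp
  linear_combination (4 * α * c ^ ((-α + β) / 2) * s ^ ((α + β) / 2)) * hcs

theorem hasDerivAt_halfPowLog (α β : ℂ) (hz : z ∈ coshStrip) :
    HasDerivAt (fun w => halfPowLog α β (Complex.exp w))
      (-(2 * β + α * (Complex.exp z + (Complex.exp z)⁻¹))
        / (Complex.exp z - (Complex.exp z)⁻¹) ^ 2) z := by
  have h0 := Complex.exp_ne_zero z
  have h2 : Complex.exp z - (Complex.exp z)⁻¹ ≠ 0 := by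
    have := exp_sq_ne_one hz
    contrapose! this
    field_simp at this
    linear_combination this
  have he := Complex.hasDerivAt_exp z
  have hi := he.inv h0
  have h1 := (((he.add hi).const_mul β).add_const (2 * α)).div ((he.sub hi).const_mul 2)
    (mul_ne_zero two_ne_zero h2)
  refine h1.congr_deriv ?_
  simp only [Pi.add_apply, Pi.sub_apply, Pi.inv_apply]
  generalize Complex.exp z = y at *
  field_simp
  ring

end Strip

/-- The multiplicities `m` and `k` agree on `ε_1 ± ε_2`, so those factors are `1`. The factor of
`2ε_i` contains both `sinh (χ_i / 2)` and `cosh (χ_i / 2)`, and that of `ε_i` only `sinh (χ_i / 2)`,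
which gives the exponents of `halfPow`. -/
theorem deltaFun_eq (d : ℕ) (α β : ℂ) :
    ∃ c : ℂ, c ≠ 0 ∧ ∀ χ : Fin 2 → ℂ, (∀ i, χ i ∈ coshStrip) →
      deltaFun d α β χ = c * (halfPow α β (χ 0) * halfPow α β (χ 1)) := by
  -- From `e^{z/2} - e^{-z/2} = 2 sinh (z/2)` and `e^z - e^{-z} = 4 sinh (z/2) cosh (z/2)`; the
  -- square accounts for the two coordinates.
  refine ⟨(((2 : ℝ) : ℂ) ^ α * ((4 : ℝ) : ℂ) ^ ((-α + β) / 2)) ^ 2, ?_, fun χ hχ => ?_⟩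
  · refine pow_ne_zero _ (mul_ne_zero ?_ ?_) <;> simp [Complex.cpow_eq_zero_iff]
  obtain ⟨k1, k2, k3, k4, k5, k6⟩ := invariantFun_posRoots 0 (((d : ℂ) - 2) / 2) (1 / 2)
  obtain ⟨m1, m2, m3, m4, m5, m6⟩ :=
    invariantFun_posRoots α (((d : ℂ) - 2) / 2) ((1 - α + β) / 2)
  have key : ∀ z ∈ coshStrip, (Complex.exp (z / 2) - Complex.exp (-(z / 2))) ^ α
      * (Complex.exp z - Complex.exp (-z)) ^ ((-α + β) / 2)
      = ((2 : ℝ) : ℂ) ^ α * ((4 : ℝ) : ℂ) ^ ((-α + β) / 2) * halfPow α β z := by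
    intro z hz
    have hs0 := Complex.slitPlane_ne_zero (sinh_half_mem_slitPlane hz)
    have hc0 := Complex.slitPlane_ne_zero (cosh_half_mem_slitPlane hz)
    have e1 : Complex.exp (z / 2) - Complex.exp (-(z / 2)) = (2 : ℝ) * Complex.sinh (z / 2) := by
      rw [Complex.sinh]; push_cast; ring
    have e2 : Complex.exp z - Complex.exp (-z)
        = (4 : ℝ) * (Complex.sinh (z / 2) * Complex.cosh (z / 2)) := by
      have h := Complex.sinh_two_mul (z / 2)
      rw [show 2 * (z / 2) = z by ring, Complex.sinh] at h
      push_cast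
      linear_combination 2 * h
    rw [e1, e2, ofReal_mul_cpow two_pos hs0, ofReal_mul_cpow four_pos (mul_ne_zero hs0 hc0),
      sinh_half_mul_cosh_half_cpow hz, halfPow,
      show (α + β) / 2 = α + (-α + β) / 2 by ring, Complex.cpow_add _ _ hs0]
    ring
  rw [deltaFun, multM, multK]
  have hp : ∀ g : (Fin 2 → ℤ) → ℂ, ∏ γ ∈ posRoots, g γ = g ![1, 0] * (g ![0, 1] * (g ![1, 1]
      * (g ![1, -1] * (g ![2, 0] * g ![0, 2])))) := by
    intro g
    rw [posRoots, Finset.prod_insert (by decide), Finset.prod_insert (by decide),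
      Finset.prod_insert (by decide), Finset.prod_insert (by decide),
      Finset.prod_insert (by decide), Finset.prod_singleton]
  have r1 : ∀ c, rootExp c ![1, 0] χ = Complex.exp (c * χ 0) := fun c => by simp [rootExp]
  have r2 : ∀ c, rootExp c ![0, 1] χ = Complex.exp (c * χ 1) := fun c => by simp [rootExp]
  have r3 : ∀ c, rootExp c ![2, 0] χ = Complex.exp (c * (2 * χ 0)) := fun c => by simp [rootExp]
  have r4 : ∀ c, rootExp c ![0, 2] χ = Complex.exp (c * (2 * χ 1)) := fun c => by simp [rootExp]
  rw [hp, k1, k2, k3, k4, k5, k6, m1, m2, m3, m4, m5, m6, r1, r2, r3, r4, r1, r2, r3, r4]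
  have h0 := key _ (hχ 0)
  have h1 := key _ (hχ 1)
  simp only [sub_self, Complex.cpow_zero, sub_zero, one_mul]
  rw [show (1 - α + β) / 2 - 1 / 2 = (-α + β) / 2 by ring]
  have q1 : ∀ z : ℂ, 1 / 2 * z = z / 2 := fun z => by ring
  have q2 : ∀ z : ℂ, -(1 / 2) * z = -(z / 2) := fun z => by ring
  have q3 : ∀ z : ℂ, 1 / 2 * (2 * z) = z := fun z => by ring
  have q4 : ∀ z : ℂ, -(1 / 2) * (2 * z) = -z := fun z => by ring
  rw [q3, q4, q3, q4, q1, q2, q1, q2, sq]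
  linear_combination (norm := ring1) congrArg₂ (· * ·) h0 h1

end ConformalCasimir

/-! ### Norms of `ρ` and conjugation by `δ`. -/

namespace ConformalCasimir

open Matrix Topology

theorem rhoNormSq_invariantFun (a b c : ℂ) :
    rhoNormSq (invariantFun a b c) = ((a + 2 * b + 2 * c) ^ 2 + (a + 2 * c) ^ 2) / 4 := by
  obtain ⟨k1, k2, k3, k4, k5, k6⟩ := invariantFun_posRoots a b c
  rw [rhoNormSq, Fin.sum_univ_two, sum_posRoots, sum_posRoots, k1, k2, k3, k4, k5, k6]
  simp
  ring

theorem rhoNormSq_multK (d : ℕ) : rhoNormSq (multK d) = ((d : ℂ) ^ 2 - 2 * d + 2) / 4 := by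
  rw [multK, rhoNormSq_invariantFun]
  ring

theorem rhoNormSq_multM (d : ℕ) (α β : ℂ) :
    rhoNormSq (multM d α β) = (((d : ℂ) + β - 1) ^ 2 + (β + 1) ^ 2) / 4 := by
  rw [multM, rhoNormSq_invariantFun]
  ring

section Conjugation

variable {I : CartanLabel} {χ : Fin 2 → ℂ} {α β : ℂ} {d : ℕ}

/-- The logarithmic derivative of `δ` in the direction `i`. -/
noncomputable def deltaLog (α β : ℂ) (i : Fin 2) (χ : Fin 2 → ℂ) : ℂ :=
  halfPowLog α β (Complex.exp (χ i))

theorem lineDifferentiableAt_deltaLog (hχ : χ ∈ region I) (i : Fin 2) :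
    LineDifferentiableAt I (deltaLog α β i) χ :=
  lineDifferentiableAt_coord (φ := fun w => halfPowLog α β (Complex.exp w))
    (hasDerivAt_halfPowLog α β ((region_subset I hχ).1 i))

theorem lineDifferentiableAt_inv_deltaFun (hχ : χ ∈ region I) :
    LineDifferentiableAt I (fun ξ => (deltaFun d α β ξ)⁻¹) χ ∧
      ∀ i, partialChi I i (fun ξ => (deltaFun d α β ξ)⁻¹) χ
        = -(deltaLog α β i χ * (deltaFun d α β χ)⁻¹) := by
  obtain ⟨c, hc, hδ⟩ := deltaFun_eq d α β
  have hs := (region_subset I hχ).1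
  have hinv : ∀ i, HasDerivAt (fun w => (halfPow α β w)⁻¹)
      (-(deltaLog α β i χ * (halfPow α β (χ i))⁻¹)) (χ i) := by
    intro i
    have h0 := halfPow_ne_zero α β (hs i)
    refine ((hasDerivAt_halfPow α β (hs i)).inv h0).congr_deriv ?_
    rw [deltaLog]
    field_simp
  have hconst : HasDerivAt (fun _ : ℂ => c⁻¹) 0 (χ 0) := hasDerivAt_const _ _
  have hl := fun i => lineDifferentiableAt_coord (I := I) (hinv i)
  have hlc := lineDifferentiableAt_coord (I := I) hconst
  have he : Set.EqOn (fun ξ => (deltaFun d α β ξ)⁻¹)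
      (fun ξ => c⁻¹ * ((halfPow α β (ξ 0))⁻¹ * (halfPow α β (ξ 1))⁻¹)) (region I) := by
    intro ξ hξ
    simp only [hδ ξ (region_subset I hξ).1, mul_inv]
  refine ⟨fun j => (eventuallyEq_line he hχ j).differentiableAt_iff.2
    ((hlc.mul ((hl 0).mul (hl 1))) j), fun i => ?_⟩
  rw [partialChi_congr he hχ, partialChi_mul hlc ((hl 0).mul (hl 1)), partialChi_mul (hl 0) (hl 1),
    partialChi_coord (hinv 0), partialChi_coord (hinv 1), partialChi_coord hconst,
    hδ χ hs, mul_inv, mul_inv]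
  fin_cases i <;> simp <;> ring

theorem partialChi_inv_deltaFun_mul {F : (Fin 2 → ℂ) → ℂ} (hχ : χ ∈ region I)
    (hF : LineDifferentiableAt I F χ) (i : Fin 2) :
    partialChi I i (fun ξ => (deltaFun d α β ξ)⁻¹ * F ξ) χ
      = (deltaFun d α β χ)⁻¹ * (partialChi I i F χ - deltaLog α β i χ * F χ) := by
  obtain ⟨h1, h2⟩ := lineDifferentiableAt_inv_deltaFun (d := d) (α := α) (β := β) hχ
  rw [partialChi_mul h1 hF, h2]
  ring

/-- Conjugation replaces `∂_i` by `∂_i - g_i` with `g_i` the logarithmic derivative of `δ`. Squaring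
leaves the zeroth-order term `g_i² - ∂_i g_i`, and the fraction is `-∂_i g_i`. -/
theorem partialChi_partialChi_inv_deltaFun_mul {F : (Fin 2 → ℂ) → ℂ} (hχ : χ ∈ region I)
    (hF : ContDiffOn ℝ ∞ F (region I)) (i : Fin 2) :
    partialChi I i (partialChi I i (fun ξ => (deltaFun d α β ξ)⁻¹ * F ξ)) χ
      = (deltaFun d α β χ)⁻¹ * (partialChi I i (partialChi I i F) χ
        - 2 * deltaLog α β i χ * partialChi I i F χ
        + (deltaLog α β i χ ^ 2 + (2 * β + α * (Complex.exp (χ i) + (Complex.exp (χ i))⁻¹))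
          / (Complex.exp (χ i) - (Complex.exp (χ i))⁻¹) ^ 2) * F χ) := by
  have hl := lineDifferentiableAt_of_contDiffOn hF hχ
  have hl1 := lineDifferentiableAt_partialChi hF hχ i
  have hg := lineDifferentiableAt_deltaLog (α := α) (β := β) hχ i
  have he : Set.EqOn (partialChi I i fun ξ => (deltaFun d α β ξ)⁻¹ * F ξ)
      (fun ξ => (deltaFun d α β ξ)⁻¹ * (partialChi I i F ξ - deltaLog α β i ξ * F ξ)) (region I) :=
    fun ξ hξ => partialChi_inv_deltaFun_mul hξ (lineDifferentiableAt_of_contDiffOn hF hξ) i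
  have hd : partialChi I i (deltaLog α β i) χ
      = -(2 * β + α * (Complex.exp (χ i) + (Complex.exp (χ i))⁻¹))
        / (Complex.exp (χ i) - (Complex.exp (χ i))⁻¹) ^ 2 := by
    refine (partialChi_coord (φ := fun w => halfPowLog α β (Complex.exp w))
      (hasDerivAt_halfPowLog α β ((region_subset I hχ).1 i)) i).trans (if_pos rfl)
  rw [partialChi_congr he hχ, partialChi_inv_deltaFun_mul hχ (hl1.sub (hg.mul hl)),
    partialChi_sub hl1 (hg.mul hl), partialChi_mul hg hl, hd]
  ring

/-- With `y_i = e^{χ_i}` the logarithmic derivative is `(β cosh χ_i + α) / (2 sinh χ_i)`. The `α`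
parts cancel and the `β` parts combine by addition formulas, so `ε_1 ± ε_2` contribute only a
constant. -/
theorem conj_identity {y₀ y₁ : ℂ} (h0 : y₀ ≠ 0) (h1 : y₁ ≠ 0) (h0' : y₀ ^ 2 ≠ 1)
    (h1' : y₁ ^ 2 ≠ 1) (hp : y₀ * y₁ ≠ 1) (hm : y₀ ≠ y₁) :
    (y₀ * y₁ + 1) / (y₀ * y₁ - 1) * (halfPowLog α β y₀ + halfPowLog α β y₁)
      + (y₀ + y₁) / (y₀ - y₁) * (halfPowLog α β y₀ - halfPowLog α β y₁) = β := by
  have a0 : y₀ ^ 2 - 1 ≠ 0 := sub_ne_zero.2 h0'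
  have a1 : y₁ ^ 2 - 1 ≠ 0 := sub_ne_zero.2 h1'
  have a2 := sub_ne_zero.2 hp
  have a3 := sub_ne_zero.2 hm
  have e : ∀ y : ℂ, y ≠ 0 → y ^ 2 - 1 ≠ 0 →
      halfPowLog α β y = (β * (y ^ 2 + 1) + 2 * α * y) / (2 * (y ^ 2 - 1)) := by
    intro y hy hy'
    have : y - y⁻¹ = (y ^ 2 - 1) / y := by field_simp
    rw [halfPowLog, this]
    field_simp
  rw [e _ h0 a0, e _ h1 a1]
  field_simp
  ring

/-- The first identity says that the first-order coefficient for `m` becomes that for `k`; the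
second produces the potential and the constant `-(β² + 2β)/4`. Two such constants and `-(d - 2)β/2`
from `conj_identity` make `-β(β + d)/2`. -/
theorem conj_identity_single {y : ℂ} (h0 : y ≠ 0) (h0' : y ^ 2 ≠ 1) (h1 : y ≠ 1) :
    α * ((y + 1) / (y - 1)) + 2 * ((1 - α + β) / 2) * ((y + y⁻¹) / (y - y⁻¹))
        - 2 * halfPowLog α β y = 2 * (1 / 2) * ((y + y⁻¹) / (y - y⁻¹)) ∧
    halfPowLog α β y ^ 2 + (2 * β + α * (y + y⁻¹)) / (y - y⁻¹) ^ 2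
      - (α * ((y + 1) / (y - 1)) + 2 * ((1 - α + β) / 2) * ((y + y⁻¹) / (y - y⁻¹)))
        * halfPowLog α β y
      = -((α ^ 2 + β ^ 2 + α * β * (y + y⁻¹)) / (y - y⁻¹) ^ 2) - (β ^ 2 + 2 * β) / 4 := by
  have a0 : y ^ 2 - 1 ≠ 0 := sub_ne_zero.2 h0'
  have a1 : y - 1 ≠ 0 := sub_ne_zero.2 h1
  have e1 : y - y⁻¹ = (y ^ 2 - 1) / y := by field_simp
  have e2 : y + y⁻¹ = (y ^ 2 + 1) / y := by field_simp
  have e3 : (y + 1) / (y - 1) = (y + 1) ^ 2 / (y ^ 2 - 1) := by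
    rw [div_eq_div_iff a1 a0]; ring
  rw [halfPowLog, e1, e2, e3]
  constructor
  · field_simp
    ring
  · field_simp
    ring

theorem laplacian_add_potential_eq {F : (Fin 2 → ℂ) → ℂ} (hF : ContDiffOn ℝ ∞ F (region I))
    (hχ : χ ∈ region I) :
    laplacian I (multK d) F χ + potential α β χ * F χ
      = deltaFun d α β χ
        * (laplacian I (multM d α β) (fun ξ => (deltaFun d α β ξ)⁻¹ * F ξ) χ
          + (rhoNormSq (multM d α β) - rhoNormSq (multK d)) * ((deltaFun d α β χ)⁻¹ * F χ)) := by
  obtain ⟨hs, hne⟩ := region_subset I hχ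
  have hy2 := fun i => exp_sq_ne_one (hs i)
  have hy := fun i => Complex.exp_ne_zero (χ i)
  have hy1 : ∀ i, Complex.exp (χ i) ≠ 1 := fun i h => hy2 i (by rw [h, one_pow])
  have hp := exp_mul_exp_ne_one (hs 0) (hs 1)
  have hm := exp_ne_exp (hs 0) (hs 1) hne
  have hδ0 : deltaFun d α β χ ≠ 0 := by
    obtain ⟨c, hc, hδ⟩ := deltaFun_eq d α β
    rw [hδ χ hs]
    exact mul_ne_zero hc (mul_ne_zero (halfPow_ne_zero _ _ (hs 0)) (halfPow_ne_zero _ _ (hs 1)))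
  have hl := lineDifferentiableAt_of_contDiffOn hF hχ
  rw [rhoNormSq_multM, rhoNormSq_multK, multK, multM, laplacian_eq, laplacian_eq,
    potential_eq α β hy2]
  simp only [partialChi_inv_deltaFun_mul hχ hl, partialChi_partialChi_inv_deltaFun_mul hχ hF,
    Fin.sum_univ_two, cothPlus, cothMinus, deltaLog]
  have hpair := conj_identity (α := α) (β := β) (hy 0) (hy 1) (hy2 0) (hy2 1) hp hm
  obtain ⟨u0, v0⟩ := conj_identity_single (α := α) (β := β) (hy 0) (hy2 0) (hy1 0)
  obtain ⟨u1, v1⟩ := conj_identity_single (α := α) (β := β) (hy 1) (hy2 1) (hy1 1)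
  -- Derivatives and fractions now enter only through `hpair`, `u0`, `u1`, `v0` and `v1`; once they
  -- are opaque the claim is a linear combination of these.
  generalize partialChi I 0 (partialChi I 0 F) χ = F00 at *
  generalize partialChi I 1 (partialChi I 1 F) χ = F11 at *
  generalize partialChi I 0 F χ = F0 at *
  generalize partialChi I 1 F χ = F1 at *
  generalize deltaFun d α β χ = δ at *
  generalize halfPowLog α β (Complex.exp (χ 0)) = g0 at *
  generalize halfPowLog α β (Complex.exp (χ 1)) = g1 at *
  generalize Complex.exp (χ 0) = y0 at *
  generalize Complex.exp (χ 1) = y1 at *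
  generalize (y0 * y1 + 1) / (y0 * y1 - 1) = cp at *
  generalize (y0 + y1) / (y0 - y1) = cm at *
  generalize (y0 + y0⁻¹) / (y0 - y0⁻¹) = c0 at *
  generalize (y1 + y1⁻¹) / (y1 - y1⁻¹) = c1 at *
  generalize (y0 + 1) / (y0 - 1) = e0 at *
  generalize (y1 + 1) / (y1 - 1) = e1 at *
  generalize (2 * β + α * (y0 + y0⁻¹)) / (y0 - y0⁻¹) ^ 2 = s0 at *
  generalize (2 * β + α * (y1 + y1⁻¹)) / (y1 - y1⁻¹) ^ 2 = s1 at *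
  generalize (α ^ 2 + β ^ 2 + α * β * (y0 + y0⁻¹)) / (y0 - y0⁻¹) ^ 2 = t0 at *
  generalize (α ^ 2 + β ^ 2 + α * β * (y1 + y1⁻¹)) / (y1 - y1⁻¹) ^ 2 = t1 at *
  have hδ : ∀ x, x = δ * (δ⁻¹ * x) := fun x => by rw [mul_inv_cancel_left₀ hδ0]
  refine (hδ _).trans ?_
  linear_combination δ * δ⁻¹ * (-u0 * F0 - u1 * F1 - (v0 + v1) * F χ
    + ((d : ℂ) - 2) / 2 * F χ * hpair)

end Conjugation

end ConformalCasimir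

/-! ### Assembly. -/

open ConformalCasimir

theorem mainTheorem4 (p q : ℕ) (hqp : q ≤ p) (hd : 2 < p + q) (α β : ℂ)
    (I : CartanLabel) (hI : I.Occurs q) :
    -- the parametrisation takes values in `G̃`
    (∀ χ ∈ region I,
      param p q I χ ∈ tildeG p q) ∧
    -- `2Σ(𝔤 : 𝔠_I)` is the set of roots of `BC_2` whose double is not a root
    ((fun γ : Fin 2 → ℂ => (2 : ℂ) • γ) '' cartanRoots p q I
      = {ζ | ∃ γ ∈ rootsBC, 2 • γ ∉ rootsBC ∧
          ζ = fun i => (γ i : ℂ)}) ∧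
    -- and `k_{2γ} = n_γ / 2`
    (∀ γ ∈ rootsBC, 2 • γ ∉ rootsBC →
      multK (p + q) γ
        = (Module.finrank ℂ
            (rootSpace p q I (fun i => (γ i : ℂ) / 2)) : ℂ) / 2) ∧
    -- the radial part of the Casimir element, before and after conjugation
    (∀ f, IsSpherical p q α β f →
      ContDiffOn ℝ ∞ (restrict p q I f)
        (region I) ∧
      ∀ χ ∈ region I,
        restrict p q I (casimirLeft p q f) χ
          = restrict p q I (casimirRight p q f) χ ∧
        restrict p q I (casimirLeft p q f) χ
          = laplacian I (multK (p + q))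
              (restrict p q I f) χ
            + potential α β χ * restrict p q I f χ ∧
        restrict p q I (casimirLeft p q f) χ
          = deltaFun (p + q) α β χ
            * (laplacian I (multM (p + q) α β)
                (fun ξ => (deltaFun (p + q) α β ξ)⁻¹
                  * restrict p q I f ξ) χ
              + β * (β + (p + q)) / 2 * ((deltaFun (p + q) α β χ)⁻¹
                  * restrict p q I f χ))) ∧
    -- the conjugation as an identity of differential operators on `Y_I`
    (∀ F : (Fin 2 → ℂ) → ℂ,
      ContDiffOn ℝ ∞ F (region I) →
      ∀ χ ∈ region I,
        laplacian I (multK (p + q)) F χ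
            + potential α β χ * F χ
          = deltaFun (p + q) α β χ
            * (laplacian I (multM (p + q) α β)
                (fun ξ => (deltaFun (p + q) α β ξ)⁻¹ * F ξ) χ
              + (rhoNormSq (multM (p + q) α β)
                  - rhoNormSq (multK (p + q)))
                * ((deltaFun (p + q) α β χ)⁻¹ * F χ))) ∧
    rhoNormSq (multK (p + q))
      = (((p + q : ℕ) : ℂ) ^ 2 - 2 * ((p + q : ℕ) : ℂ) + 2) / 4 ∧
    rhoNormSq (multM (p + q) α β)
      = ((((p + q : ℕ) : ℂ) + β - 1) ^ 2 + (β + 1) ^ 2) / 4 ∧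
    -- `δ` up to a constant
    (∃ c : ℂ, c ≠ 0 ∧ ∀ χ ∈ region I,
      deltaFun (p + q) α β χ
        = c * (Complex.cosh (χ 0 / 2) ^ ((-α + β) / 2) * Complex.cosh (χ 1 / 2) ^ ((-α + β) / 2)
          * Complex.sinh (χ 0 / 2) ^ ((α + β) / 2) * Complex.sinh (χ 1 / 2) ^ ((α + β) / 2))) := by
  obtain ⟨K, L, U, μ, T, hM⟩ := exists_isCartanModel hqp hd I hI
  refine ⟨fun χ => hM.param_mem_tildeG, hM.two_smul_cartanRoots hd,
    fun γ hγ h2 => hM.multK_eq hd hγ h2, fun f hf => ⟨hM.contDiffOn_restrict hf, fun χ hχ => ?_⟩,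
    fun F hF χ hχ => laplacian_add_potential_eq hF hχ, rhoNormSq_multK _, rhoNormSq_multM _ _ _, ?_⟩
  · obtain ⟨h1, h2⟩ := hM.casimir_restrict hd.le hf hχ
    refine ⟨h1, h2, h2.trans ?_⟩
    -- The final `ring` uses `‖ρ(m)‖² - ‖ρ(k)‖² = β(β + d)/2`.
    rw [laplacian_add_potential_eq (hM.contDiffOn_restrict hf) hχ, rhoNormSq_multM,
      rhoNormSq_multK]
    push_cast
    ring
  · obtain ⟨c, hc, hδ⟩ := deltaFun_eq (p + q) α β
    refine ⟨c, hc, fun χ hχ => ?_⟩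
    rw [hδ χ (region_subset I hχ).1, halfPow, halfPow]
    ring
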